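/- Fix $d\ge 2$. For a weighted undirected graph on $n$ vertices with weights $\gamma_{ij}=\gamma_{ji}\ge 0$, the quantum Kuramoto system on $SO(d)^n$ (with coupling function $f(x)=x$ and no forcing) is $$X_i'\,X_i^{-1}=\tfrac12\sum_{j}\gamma_{ij}\bigl(X_jX_i^{-1}-X_iX_j^{-1}\bigr),\qquad i\in\mathbb Z/n .$$ Let $T\in SO(d)$ be the rotation by the angle $2\pi/n$ in the first coordinate plane, the identity on its orthogonal complement. The $1$-twist is the configuration $X_i=T^i$, and the family of $1$-twists consists of all configurations $X_i=S\,T^i R$ with $S,R\in SO(d)$ (the system is invariant under left and right translations). The graph *supports $1$-twists* if the $1$-twist is stable: it is a Lyapunov stable point of the system, and every trajectory starting close enough to it converges, as $t\to\infty$, to a member of the family of $1$-twists. For $\alpha\in(0,1)$ let $\Gamma^{(\alpha,n)}$ be the graph on $\mathbb Z/n$ in which $i$ and $j$ at cyclic distance $k=|i-j|$ are joined with weight $1$ if $k<\lfloor\alpha n\rfloor$ and with weight $0$ otherwise. **Theorem.** The function $\pi\alpha-\sin 2\pi\alpha+\tfrac14\sin4\pi\alpha$ has a smallest positive root $\alpha^*$,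 and $|\alpha^*-0.340461|<5\cdot10^{-7}$. 1. If $0<\alpha<\alpha^*$, there is $n^*=n^*(\alpha)$ such that for all $n>n^*$ and all $d\ge2$ the graph $\Gamma^{(\alpha,n)}$ supports $1$-twists. 2. If $\alpha^*<\alpha\le\tfrac12$, there is $n^*=n^*(\alpha)$ such that for all $n>n^*$ and all $d\ge2$ the graph $\Gamma^{(\alpha,n)}$ does not support $1$-twists; moreover the $1$-twist is unstable: there is a neighbourhood $U$ of the family of $1$-twists such that trajectories starting arbitrarily close to the $1$-twist leave $U$. -/

import Mathlib

open scoped Topology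

noncomputable section

/-- The group `SO(d)` for `d = e + 2`, with coordinates split as `ℝ² ⊕ ℝᵉ`. -/
abbrev RotGroup (e : ℕ) : Type :=
  Matrix.specialOrthogonalGroup (Fin 2 ⊕ Fin e) ℝ

/-- A configuration: one rotation `X i` for each of the `n` vertices, the vertices being labelled
cyclically by `ZMod n`. It carries the product topology. -/
abbrev Config (n e : ℕ) : Type := ZMod n → RotGroup e

/-- The coupling `F_i(X) = ½ ∑ⱼ γ_ij (X_j X_i⁻¹ - X_i X_j⁻¹)`, a skew-symmetric matrix. -/
def qkCoupling {n e : ℕ} [NeZero n] (γ : ZMod n → ZMod n → ℝ) (X : Config n e) (i : ZMod n) :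
    Matrix (Fin 2 ⊕ Fin e) (Fin 2 ⊕ Fin e) ℝ :=
  (1 / 2 : ℝ) • ∑ j, γ i j •
    (((X j * (X i)⁻¹ : RotGroup e) : Matrix (Fin 2 ⊕ Fin e) (Fin 2 ⊕ Fin e) ℝ) -
      ((X i * (X j)⁻¹ : RotGroup e) : Matrix (Fin 2 ⊕ Fin e) (Fin 2 ⊕ Fin e) ℝ))

/-- `X` solves the quantum Kuramoto system `X_i' X_i⁻¹ = F_i(X)` on `[0, ∞)`
(coupling function `f(x) = x`, no forcing). The derivative is taken entry by entry, one-sided at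
time `0`. As `SO(d)` is compact, every solution of the system extends to `[0, ∞)`. -/
def IsQKSolution {n e : ℕ} [NeZero n] (γ : ZMod n → ZMod n → ℝ) (X : ℝ → Config n e) : Prop :=
  ∀ t : ℝ, 0 ≤ t → ∀ (i : ZMod n) (a b : Fin 2 ⊕ Fin e),
    HasDerivWithinAt
      (fun s : ℝ => (X s i : Matrix (Fin 2 ⊕ Fin e) (Fin 2 ⊕ Fin e) ℝ) a b)
      ((qkCoupling γ (X t) i * (X t i : Matrix (Fin 2 ⊕ Fin e) (Fin 2 ⊕ Fin e) ℝ)) a b)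
      (Set.Ici 0) t

/-- The symmetric circulant graph with weights `γ_ij = γ_k`, where `k` is the cyclic distance
between `i` and `j`. -/
def circulantWeight {n : ℕ} (γ : ℕ → ℝ) (i j : ZMod n) : ℝ :=
  γ (i - j).valMinAbs.natAbs

/-- The graph `Γ^(α,n)`: weight `1` at cyclic distance `k < ⌊α n⌋`, and weight `0` otherwise.
(The resulting loops, at distance `0`, have no effect on the coupling.) -/
def alphaGraph (α : ℝ) (n : ℕ) : ZMod n → ZMod n → ℝ :=
  circulantWeight fun k => if k < ⌊α * n⌋₊ then 1 else 0

/-- The matrix of the single rotation `Tw(θ, 0, …, 0)`. -/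
def singleRotationMatrix (e : ℕ) (θ : ℝ) : Matrix (Fin 2 ⊕ Fin e) (Fin 2 ⊕ Fin e) ℝ :=
  Matrix.fromBlocks !![Real.cos θ, -Real.sin θ; Real.sin θ, Real.cos θ] 0 0 1

theorem singleRotationMatrix_mem (e : ℕ) (θ : ℝ) :
    singleRotationMatrix e θ ∈ Matrix.specialOrthogonalGroup (Fin 2 ⊕ Fin e) ℝ := by
  have h := Real.cos_sq_add_sin_sq θ
  rw [Matrix.mem_specialOrthogonalGroup_iff, Matrix.mem_orthogonalGroup_iff]
  constructor
  · rw [singleRotationMatrix, Matrix.fromBlocks_transpose, Matrix.fromBlocks_multiply,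
      ← Matrix.fromBlocks_one]
    congr 1
    · ext i j
      simp only [Matrix.transpose_zero, Matrix.mul_zero, add_zero, Matrix.mul_apply,
        Matrix.transpose_apply, Fin.sum_univ_two]
      fin_cases i <;> fin_cases j <;> simp <;> nlinarith
    all_goals simp
  · rw [singleRotationMatrix, Matrix.det_fromBlocks_zero₂₁, Matrix.det_fin_two_of, Matrix.det_one]
    nlinarith

/-- The single rotation `Tw(θ, 0, …, 0)` as an element of `SO(d)`. -/
def singleRotation (e : ℕ) (θ : ℝ) : RotGroup e :=
  ⟨singleRotationMatrix e θ, singleRotationMatrix_mem e θ⟩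

/-- The `1`-twist: `X_i = T ^ i` with `T = Tw(2π/n, 0, …, 0)` (note `T ^ n = 1`). -/
def oneTwist (n e : ℕ) : Config n e :=
  fun i => singleRotation e (2 * Real.pi / n) ^ i.val

/-- All `1`-twists: the twist generated by `S T S⁻¹`, that is, by the single rotation in any
positively oriented orthonormal basis, and all right translates of such twists. -/
def oneTwistFamily (n e : ℕ) : Set (Config n e) :=
  {X | ∃ S R : RotGroup e, X = fun i => S * oneTwist n e i * R}

/-- `Γ` supports `1`-twists: the `1`-twist is a stable fixed point. It is Lyapunov stable, and all
trajectories that start close enough to it converge to a `1`-twist. (The limit can be another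
member of the family, as the system is invariant under left and right translations.) -/
def SupportsOneTwists {n : ℕ} [NeZero n] (e : ℕ) (γ : ZMod n → ZMod n → ℝ) : Prop :=
  (∀ U ∈ 𝓝 (oneTwist n e), ∃ V ∈ 𝓝 (oneTwist n e), ∀ X : ℝ → Config n e,
    IsQKSolution γ X → X 0 ∈ V → ∀ t : ℝ, 0 ≤ t → X t ∈ U) ∧
  (∃ V ∈ 𝓝 (oneTwist n e), ∀ X : ℝ → Config n e, IsQKSolution γ X → X 0 ∈ V →
    ∃ Z ∈ oneTwistFamily n e, Filter.Tendsto X Filter.atTop (𝓝 Z))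

/-- The `1`-twist is unstable, even modulo all translations: arbitrarily close to it there start
trajectories that leave a fixed neighbourhood of the whole family of `1`-twists. -/
def OneTwistUnstable {n : ℕ} [NeZero n] (e : ℕ) (γ : ZMod n → ZMod n → ℝ) : Prop :=
  ∃ U ∈ 𝓝ˢ (oneTwistFamily n e), ∀ V ∈ 𝓝 (oneTwist n e), ∃ X : ℝ → Config n e,
    IsQKSolution γ X ∧ X 0 ∈ V ∧ ∃ t : ℝ, 0 ≤ t ∧ X t ∉ U

end

/-! Write `X_i = Y_i T^i`, and let `A_i` be the skew part of `Y_i`. To first order at the twist the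
flow of the `A_i` is invariant under the cyclic shift, and it splits along `ℝ² ⊕ ℝᵉ` into scalar
systems: the entry in the plane of rotation, the mixed entries (one complex number for each normal
direction), and the normal entries. The Fourier transform on `ℤ/n` diagonalizes each of them. If `D`
denotes `cosTransform` of the weight, the growth rates of mode `m` are, up to positive factors,
`D(m+1) + D(m-1) - 2D(1)` (planar), `D(m) + D(m-1) - D(0) - D(1)` (mixed) and `D(m) - D(0)`
(normal). The modes `m = 0`, and also `m = 1` in the mixed case, are the directions of the left and
right translations.

For the window weight `D` is a Dirichlet kernel: `D(0)` is its strict maximum and `D(1)` is the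
largest of the other values (`cosTransform_windowWeight_le`). Hence only the planar modes `m = ±1`
can be unstable, according to the sign of `D(2) + D(0) - 2D(1)`. Divided by `n`, this quantity tends
to `(2/π) threshold α` (`tendsto_gap`, `gap_eq`), so for large `n` the sign of `threshold α`
decides, whatever the dimension.

Stability is proved without a centre manifold. The Lyapunov function is the squared distance to the
compact family of twists. At a nearest twist, the first variation says exactly that the translation
modes of `A` vanish, so the spectral gap makes the distance contract exponentially
(`SpectrallyStable.exists_contraction`, `IsQKSolution.famSqDist_le`). The velocity is bounded by the
distance, so trajectories have finite length and converge.

Instability is shown inside the invariant set of planar configurations, where the system is the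
classical Kuramoto model for phases. A quadratic form that favours the modes `±1` grows
exponentially as long as the phases stay close together (`modeExcess_deriv_ge`), while it is bounded
there. So some neighbouring phases separate, and this is visible in a quantity that is constant on
the family of twists (`oneTwistUnstable_of_mode`). -/

/-! ### The threshold function and its root. -/

/-- The function whose smallest positive root is the threshold. -/
noncomputable def threshold (a : ℝ) : ℝ :=
  Real.pi * a - Real.sin (2 * Real.pi * a) + 1 / 4 * Real.sin (4 * Real.pi * a)

/-- Real and imaginary parts give cosine and sine with one remainder. The constant is `11 / (10! *
10)`, from the exponential series cut off after ten terms. -/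
theorem norm_exp_mul_I_sub_taylor {x : ℝ} (hx : |x| ≤ 1) :
    ‖Complex.exp (x * Complex.I) -
      (⟨1 - x ^ 2 / 2 + x ^ 4 / 24 - x ^ 6 / 720 + x ^ 8 / 40320,
        x - x ^ 3 / 6 + x ^ 5 / 120 - x ^ 7 / 5040 + x ^ 9 / 362880⟩ : ℂ)‖
      ≤ |x| ^ 10 * (11 / 36288000) := by
  have hn : ‖(x * Complex.I : ℂ)‖ = |x| := by simp
  have h := Complex.exp_bound (x := x * Complex.I) (by rw [hn]; exact hx) (n := 10) (by norm_num)
  have hp : ∑ m ∈ Finset.range 10, (x * Complex.I : ℂ) ^ m / (m.factorial : ℂ) =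
      (⟨1 - x ^ 2 / 2 + x ^ 4 / 24 - x ^ 6 / 720 + x ^ 8 / 40320,
        x - x ^ 3 / 6 + x ^ 5 / 120 - x ^ 7 / 5040 + x ^ 9 / 362880⟩ : ℂ) := by
    rw [Complex.mk_eq_add_mul_I]
    simp only [Finset.sum_range_succ, Finset.sum_range_zero, Nat.factorial, mul_pow]
    have h2 : Complex.I ^ 2 = -1 := Complex.I_sq
    have h3 : Complex.I ^ 3 = -Complex.I := Complex.I_pow_three
    have h4 : Complex.I ^ 4 = 1 := Complex.I_pow_four
    have h5 : Complex.I ^ 5 = Complex.I := by rw [pow_succ, h4, one_mul]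
    have h6 : Complex.I ^ 6 = -1 := by rw [pow_succ, h5, ← pow_two, h2]
    have h7 : Complex.I ^ 7 = -Complex.I := by rw [pow_succ, h6]; ring
    have h8 : Complex.I ^ 8 = 1 := by rw [show (8 : ℕ) = 4 * 2 by norm_num, pow_mul, h4, one_pow]
    have h9 : Complex.I ^ 9 = Complex.I := by rw [pow_succ, h8, one_mul]
    rw [h2, h3, h4, h5, h6, h7, h8, h9]
    push_cast
    ring
  rw [hp, hn] at h
  refine h.trans (le_of_eq ?_)
  norm_num [Nat.factorial]

theorem abs_cos_sub_taylor_le {x : ℝ} (hx : |x| ≤ 1) :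
    |Real.cos x - (1 - x ^ 2 / 2 + x ^ 4 / 24 - x ^ 6 / 720 + x ^ 8 / 40320)|
      ≤ |x| ^ 10 * (11 / 36288000) := by
  have h := (Complex.abs_re_le_norm _).trans (norm_exp_mul_I_sub_taylor hx)
  rwa [Complex.sub_re, Complex.exp_ofReal_mul_I_re] at h

theorem abs_sin_sub_taylor_le {x : ℝ} (hx : |x| ≤ 1) :
    |Real.sin x - (x - x ^ 3 / 6 + x ^ 5 / 120 - x ^ 7 / 5040 + x ^ 9 / 362880)|
      ≤ |x| ^ 10 * (11 / 36288000) := by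
  have h := (Complex.abs_im_le_norm _).trans (norm_exp_mul_I_sub_taylor hx)
  rwa [Complex.sub_im, Complex.exp_ofReal_mul_I_im] at h

/-- Near the root `2πa` is about `2.14`, too large for the Taylor bounds; the shift by `π/2` brings
the argument to about `0.568`. -/
theorem threshold_eq (a : ℝ) :
    threshold a = Real.pi * a - Real.cos (Real.pi * (2 * a - 1 / 2))
      - 1 / 2 * Real.sin (Real.pi * (2 * a - 1 / 2)) * Real.cos (Real.pi * (2 * a - 1 / 2)) := by
  have h : Real.pi * (2 * a - 1 / 2) = 2 * Real.pi * a - Real.pi / 2 := by ring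
  rw [h, Real.cos_sub_pi_div_two, Real.sin_sub_pi_div_two, threshold,
    show 4 * Real.pi * a = 2 * (2 * Real.pi * a) by ring, Real.sin_two_mul]
  ring

theorem cos_sin_bounds {y l u : ℝ} (hl : 0 ≤ l) (hly : l ≤ y) (hyu : y ≤ u) (hu : u ≤ 1) :
    (1 - u ^ 2 / 2 + u ^ 4 / 24 - u ^ 6 / 720 + u ^ 8 / 40320) - u ^ 10 * (11 / 36288000)
      ≤ Real.cos y ∧
    Real.cos y ≤ (1 - l ^ 2 / 2 + l ^ 4 / 24 - l ^ 6 / 720 + l ^ 8 / 40320)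
      + l ^ 10 * (11 / 36288000) ∧
    (l - l ^ 3 / 6 + l ^ 5 / 120 - l ^ 7 / 5040 + l ^ 9 / 362880) - l ^ 10 * (11 / 36288000)
      ≤ Real.sin y ∧
    Real.sin y ≤ (u - u ^ 3 / 6 + u ^ 5 / 120 - u ^ 7 / 5040 + u ^ 9 / 362880)
      + u ^ 10 * (11 / 36288000) := by
  have hπ := Real.pi_gt_three
  have al : |l| = l := abs_of_nonneg hl
  have au : |u| = u := abs_of_nonneg (by linarith)
  have h1 := abs_le.1 (abs_cos_sub_taylor_le (x := l) (by rw [al]; linarith))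
  have h2 := abs_le.1 (abs_cos_sub_taylor_le (x := u) (by rw [au]; linarith))
  have h3 := abs_le.1 (abs_sin_sub_taylor_le (x := l) (by rw [al]; linarith))
  have h4 := abs_le.1 (abs_sin_sub_taylor_le (x := u) (by rw [au]; linarith))
  rw [al] at h1 h3
  rw [au] at h2 h4
  have c1 : Real.cos y ≤ Real.cos l := Real.cos_le_cos_of_nonneg_of_le_pi hl (by linarith) hly
  have c2 : Real.cos u ≤ Real.cos y :=
    Real.cos_le_cos_of_nonneg_of_le_pi (by linarith) (by linarith) hyu
  have s1 : Real.sin l ≤ Real.sin y :=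
    Real.sin_le_sin_of_le_of_le_pi_div_two (by linarith) (by linarith) hly
  have s2 : Real.sin y ≤ Real.sin u :=
    Real.sin_le_sin_of_le_of_le_pi_div_two (by linarith) (by linarith) hyu
  refine ⟨?_, ?_, ?_, ?_⟩ <;> linarith [h1.1, h1.2, h2.1, h2.2, h3.1, h3.2, h4.1, h4.2]

theorem threshold_neg_at : threshold 0.3404605 < 0 := by
  have p1 := Real.pi_gt_d20
  have p2 := Real.pi_lt_d20
  rw [threshold_eq]
  set y := Real.pi * (2 * 0.3404605 - 1 / 2) with hy
  obtain ⟨h1, h2, h3, h4⟩ := cos_sin_bounds (y := y) (l := 0.56838008) (u := 0.56838009)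
    (by norm_num) (by rw [hy]; norm_num at p1 p2 ⊢; linarith)
    (by rw [hy]; norm_num at p1 p2 ⊢; linarith) (by norm_num)
  norm_num at h1 h2 h3 h4 p1 p2 ⊢
  -- Both the cosine and the product enter `threshold_eq` with a minus sign, so lower bounds are
  -- needed here, and upper bounds for positivity at the other point.
  have h1' : (0.8427672 : ℝ) ≤ Real.cos y := by norm_num; linarith
  have h3' : (0.5382566 : ℝ) ≤ Real.sin y := by norm_num; linarith
  have := mul_le_mul h3' h1' (by norm_num) (by linarith)
  norm_num at this h1'
  nlinarith

theorem threshold_pos_at : 0 < threshold 0.3404615 := by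
  have p1 := Real.pi_gt_d20
  have p2 := Real.pi_lt_d20
  rw [threshold_eq]
  set y := Real.pi * (2 * 0.3404615 - 1 / 2) with hy
  obtain ⟨h1, h2, h3, h4⟩ := cos_sin_bounds (y := y) (l := 0.56838636) (u := 0.56838637)
    (by norm_num) (by rw [hy]; norm_num at p1 p2 ⊢; linarith)
    (by rw [hy]; norm_num at p1 p2 ⊢; linarith) (by norm_num)
  norm_num at h1 h2 h3 h4 p1 p2 ⊢
  have h2' : Real.cos y ≤ 0.84277066 := by norm_num; linarith
  have h4' : Real.sin y ≤ 0.53827285 := by norm_num; linarith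
  have h1' : 0 ≤ Real.cos y := by linarith
  have := mul_le_mul h4' h2' h1' (by norm_num)
  norm_num at this h2'
  nlinarith

theorem hasDerivAt_threshold (a : ℝ) :
    HasDerivAt threshold
      (2 * Real.pi * (Real.cos (2 * Real.pi * a) * (Real.cos (2 * Real.pi * a) - 1))) a := by
  have h1 : HasDerivAt (fun a : ℝ => 2 * Real.pi * a) (2 * Real.pi) a := by
    simpa using (hasDerivAt_id a).const_mul (2 * Real.pi)
  have h2 : HasDerivAt (fun a : ℝ => 4 * Real.pi * a) (4 * Real.pi) a := by
    simpa using (hasDerivAt_id a).const_mul (4 * Real.pi)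
  have h3 : HasDerivAt (fun a : ℝ => Real.pi * a) Real.pi a := by
    simpa using (hasDerivAt_id a).const_mul Real.pi
  have h := (h3.sub h1.sin).add (h2.sin.const_mul (1 / 4))
  refine h.congr_deriv ?_
  rw [show 4 * Real.pi * a = 2 * (2 * Real.pi * a) by ring, Real.cos_two_mul]
  ring

theorem continuous_threshold : Continuous threshold := by
  unfold threshold; fun_prop

theorem strictAntiOn_threshold : StrictAntiOn threshold (Set.Icc 0 (1 / 4)) := by
  refine strictAntiOn_of_deriv_neg (convex_Icc _ _) continuous_threshold.continuousOn ?_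
  intro a ha
  rw [interior_Icc] at ha
  rw [(hasDerivAt_threshold a).deriv]
  have hπ := Real.pi_pos
  have h1 : 0 < Real.cos (2 * Real.pi * a) :=
    Real.cos_pos_of_mem_Ioo ⟨by nlinarith [ha.1], by nlinarith [ha.2]⟩
  have h2 : Real.cos (2 * Real.pi * a) < 1 := by
    rw [← Real.cos_zero]
    exact Real.cos_lt_cos_of_nonneg_of_le_pi le_rfl (by nlinarith [ha.2]) (by nlinarith [ha.1])
  have := mul_pos h1 (sub_pos.2 h2)
  nlinarith

theorem strictMonoOn_threshold : StrictMonoOn threshold (Set.Icc (1 / 4) (1 / 2)) := by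
  refine strictMonoOn_of_deriv_pos (convex_Icc _ _) continuous_threshold.continuousOn ?_
  intro a ha
  rw [interior_Icc] at ha
  rw [(hasDerivAt_threshold a).deriv]
  have hπ := Real.pi_pos
  have h1 : Real.cos (2 * Real.pi * a) < 0 :=
    Real.cos_neg_of_pi_div_two_lt_of_lt (by nlinarith [ha.1]) (by nlinarith [ha.2])
  have := mul_pos_of_neg_of_neg h1 (show Real.cos (2 * Real.pi * a) - 1 < 0 by linarith)
  positivity

/-- The derivative `2π cos(2πa)(cos(2πa) - 1)` makes the function fall from its value `0` at `0`
until `1/4` and rise from there to `1/2`. So a sign change in the second half is the first positive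
root, and the signs on either side follow. -/
theorem exists_threshold_root :
    ∃ αs : ℝ, IsLeast {a : ℝ | 0 < a ∧ threshold a = 0} αs ∧ |αs - 0.340461| < 5 / 10 ^ 7 ∧
      (∀ a, 0 < a → a < αs → threshold a < 0) ∧
      (∀ a, αs < a → a ≤ 1 / 2 → 0 < threshold a) := by
  obtain ⟨αs, ⟨h1, h2⟩, h3⟩ := intermediate_value_Ioo (a := (0.3404605 : ℝ)) (b := 0.3404615)
    (by norm_num) continuous_threshold.continuousOn ⟨threshold_neg_at, threshold_pos_at⟩
  have hneg : ∀ a, 0 < a → a < αs → threshold a < 0 := by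
    intro a ha ha'
    rcases le_total a (1 / 4) with h | h
    · have := strictAntiOn_threshold (a := 0) (b := a) ⟨le_rfl, by norm_num⟩ ⟨ha.le, h⟩ ha
      simpa [threshold] using this
    · rw [← h3]
      exact strictMonoOn_threshold ⟨h, by norm_num at h2 ⊢; linarith⟩
        ⟨by norm_num at h1 ⊢; linarith, by norm_num at h2 ⊢; linarith⟩ ha'
  refine ⟨αs, ⟨⟨by norm_num at h1 ⊢; linarith, h3⟩, ?_⟩, ?_, hneg, ?_⟩
  · rintro a ⟨ha, ha'⟩
    by_contra! hlt
    exact (hneg a ha hlt).ne ha'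
  · rw [abs_lt]
    norm_num at h1 h2 ⊢
    constructor <;> linarith
  · intro a ha ha'
    rw [← h3]
    exact strictMonoOn_threshold ⟨by norm_num at h1 ⊢; linarith, by norm_num at h2 ⊢; linarith⟩
      ⟨by norm_num at h1 ⊢; linarith, ha'⟩ ha


/-! ### Sine inequalities that compare values of the Dirichlet kernel. -/

/-- The ratio `sin(mx) / sin x` decreases in `x` as long as `mx ≤ π`. Induction works through
`sin((m+1)x)/sin x = cos x · sin(mx)/sin x + cos(mx)`, in which `cos x` and `cos(mx)` decrease too.
-/
theorem sin_mul_mul_sin_le (m : ℕ) {ψ φ : ℝ} (hψ : 0 < ψ) (hψφ : ψ ≤ φ) (hφ : φ ≤ Real.pi / 2)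
    (hm : m * φ ≤ Real.pi) : Real.sin (m * φ) * Real.sin ψ ≤ Real.sin (m * ψ) * Real.sin φ := by
  have hπ := Real.pi_pos
  induction m with
  | zero => simp
  | succ m ih =>
    push_cast at hm ⊢
    have h0 : (0 : ℝ) ≤ m := m.cast_nonneg
    have h1 : (m : ℝ) * φ ≤ Real.pi := by nlinarith
    have h2 : (m : ℝ) * ψ ≤ m * φ := by gcongr
    have h3 : 0 ≤ (m : ℝ) * ψ := by positivity
    have sφ : 0 < Real.sin φ := Real.sin_pos_of_pos_of_lt_pi (by linarith) (by linarith)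
    have sψ : 0 < Real.sin ψ := Real.sin_pos_of_pos_of_lt_pi (by linarith) (by linarith)
    have cφ : 0 ≤ Real.cos φ := Real.cos_nonneg_of_mem_Icc ⟨by linarith, hφ⟩
    have cc : Real.cos φ ≤ Real.cos ψ :=
      Real.cos_le_cos_of_nonneg_of_le_pi hψ.le (by linarith) hψφ
    have cm : Real.cos (m * φ) ≤ Real.cos (m * ψ) := Real.cos_le_cos_of_nonneg_of_le_pi h3 h1 h2
    have sm : 0 ≤ Real.sin (m * ψ) := Real.sin_nonneg_of_nonneg_of_le_pi h3 (by linarith)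
    rw [add_mul, add_mul, one_mul, one_mul, Real.sin_add, Real.sin_add]
    have a1 := mul_le_mul_of_nonneg_right (ih h1) cφ
    have a2 := mul_le_mul_of_nonneg_left cc (mul_nonneg sm sφ.le)
    have a3 := mul_le_mul_of_nonneg_right cm (mul_nonneg sφ.le sψ.le)
    nlinarith

theorem sin_mul_mul_sin_lt {m : ℕ} {ψ φ : ℝ} (hm2 : 2 ≤ m) (hψ : 0 < ψ) (hψφ : ψ < φ)
    (hφ : φ ≤ Real.pi / 2) (hm : m * φ ≤ Real.pi) :
    Real.sin (m * φ) * Real.sin ψ < Real.sin (m * ψ) * Real.sin φ := by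
  have hπ := Real.pi_pos
  obtain ⟨m, rfl⟩ := Nat.exists_eq_add_of_le' (show 1 ≤ m by omega)
  push_cast at hm ⊢
  have h0 : (1 : ℝ) ≤ m := by exact_mod_cast (by omega : 1 ≤ m)
  have h1 : (m : ℝ) * φ ≤ Real.pi := by nlinarith
  have h2 : (m : ℝ) * ψ < m * φ := by gcongr
  have h3 : 0 ≤ (m : ℝ) * ψ := by positivity
  have sφ : 0 < Real.sin φ := Real.sin_pos_of_pos_of_lt_pi (by linarith) (by linarith)
  have sψ : 0 < Real.sin ψ := Real.sin_pos_of_pos_of_lt_pi (by linarith) (by linarith)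
  have cφ : 0 ≤ Real.cos φ := Real.cos_nonneg_of_mem_Icc ⟨by linarith, hφ⟩
  have cc : Real.cos φ ≤ Real.cos ψ :=
    Real.cos_le_cos_of_nonneg_of_le_pi hψ.le (by linarith) hψφ.le
  have cm : Real.cos (m * φ) < Real.cos (m * ψ) := Real.cos_lt_cos_of_nonneg_of_le_pi h3 h1 h2
  have sm : 0 ≤ Real.sin (m * ψ) := Real.sin_nonneg_of_nonneg_of_le_pi h3 (by linarith)
  rw [add_mul, add_mul, one_mul, one_mul, Real.sin_add, Real.sin_add]
  have a1 := mul_le_mul_of_nonneg_right (sin_mul_mul_sin_le m hψ hψφ.le hφ h1) cφ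
  have a2 := mul_le_mul_of_nonneg_left cc (mul_nonneg sm sφ.le)
  have a3 := mul_lt_mul_of_pos_right cm (mul_pos sφ sψ)
  nlinarith

/-- Beyond `mφ = π` monotonicity is lost, but Jordan's bound `sin x ≥ 2x/π` is enough: the right
side is at least `4ψ(mφ)/π² > 4ψ/π > ψ`. -/
theorem sin_lt_sin_mul_mul_sin {m : ℕ} {ψ φ : ℝ} (hψ : 0 < ψ)
    (hmψ : m * ψ ≤ Real.pi / 2) (hφ : φ ≤ Real.pi / 2) (hm : Real.pi < m * φ) :
    Real.sin ψ < Real.sin (m * ψ) * Real.sin φ := by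
  have hπ := Real.pi_pos
  have hπ4 := Real.pi_lt_four
  have h0 : (0 : ℝ) ≤ m := m.cast_nonneg
  have hφ0 : 0 ≤ φ := by
    by_contra! h
    nlinarith
  have h1 := Real.mul_le_sin (x := m * ψ) (by positivity) hmψ
  have h2 := Real.mul_le_sin hφ0 hφ
  have h3 := mul_le_mul h1 h2 (by positivity) ((by positivity : (0:ℝ) ≤ _).trans h1)
  refine (Real.sin_lt hψ).trans (lt_of_lt_of_le ?_ h3)
  have h4 : 2 / Real.pi * (m * ψ) * (2 / Real.pi * φ) = ψ * (4 * (m * φ) / Real.pi ^ 2) := by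
    field_simp
    ring
  rw [h4]
  have h5 : 1 < 4 * (m * φ) / Real.pi ^ 2 := by
    rw [lt_div_iff₀ (by positivity)]
    nlinarith
  nlinarith

theorem abs_sin_mul_mul_sin_le {m : ℕ} {ψ φ : ℝ} (hψ : 0 < ψ) (hψφ : ψ ≤ φ)
    (hmψ : m * ψ ≤ Real.pi / 2) (hφ : φ ≤ Real.pi / 2) :
    |Real.sin (m * φ)| * Real.sin ψ ≤ Real.sin (m * ψ) * Real.sin φ := by
  have hπ := Real.pi_pos
  have sψ : 0 < Real.sin ψ := Real.sin_pos_of_pos_of_lt_pi (by linarith) (by linarith)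
  rcases le_or_gt (m * φ) Real.pi with h | h
  · rw [abs_of_nonneg (Real.sin_nonneg_of_nonneg_of_le_pi
      (mul_nonneg m.cast_nonneg (by linarith)) h)]
    exact sin_mul_mul_sin_le m hψ hψφ hφ h
  · have := sin_lt_sin_mul_mul_sin hψ hmψ hφ h
    nlinarith [Real.abs_sin_le_one (m * φ)]

theorem abs_sin_mul_mul_sin_lt {m : ℕ} {ψ φ : ℝ} (hm : 2 ≤ m) (hψ : 0 < ψ) (hψφ : ψ < φ)
    (hmψ : m * ψ ≤ Real.pi / 2) (hφ : φ ≤ Real.pi / 2) :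
    |Real.sin (m * φ)| * Real.sin ψ < Real.sin (m * ψ) * Real.sin φ := by
  have hπ := Real.pi_pos
  have sψ : 0 < Real.sin ψ := Real.sin_pos_of_pos_of_lt_pi (by linarith) (by linarith)
  rcases le_or_gt (m * φ) Real.pi with h | h
  · rw [abs_of_nonneg (Real.sin_nonneg_of_nonneg_of_le_pi
      (mul_nonneg m.cast_nonneg (by linarith)) h)]
    exact sin_mul_mul_sin_lt hm hψ hψφ hφ h
  · have := sin_lt_sin_mul_mul_sin hψ hmψ hφ h
    nlinarith [Real.abs_sin_le_one (m * φ)]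

/-! ### The cosine transform of the window weight. -/

/-- The weight that is `1` at cyclic distance `< r` and `0` otherwise. -/
noncomputable def windowWeight (n r : ℕ) (k : ZMod n) : ℝ :=
  if k.valMinAbs.natAbs < r then 1 else 0

theorem windowWeight_nonneg {n : ℕ} (r : ℕ) (k : ZMod n) : 0 ≤ windowWeight n r k := by
  unfold windowWeight; split_ifs <;> norm_num

theorem windowWeight_neg {n : ℕ} (r : ℕ) (k : ZMod n) : windowWeight n r (-k) = windowWeight n r k := by
  unfold windowWeight
  rw [ZMod.natAbs_valMinAbs_neg]

section
variable {n : ℕ} [NeZero n]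

/-- `cos (2 π k / n)` for a residue `k` modulo `n`. -/
noncomputable def zcos (k : ZMod n) : ℝ := (ZMod.stdAddChar k).re

/-- `sin (2 π k / n)` for a residue `k` modulo `n`. -/
noncomputable def zsin (k : ZMod n) : ℝ := (ZMod.stdAddChar k).im

theorem zcos_intCast (j : ℤ) : zcos (j : ZMod n) = Real.cos (j * (2 * Real.pi / n)) := by
  rw [zcos, ZMod.stdAddChar_coe, show 2 * Real.pi * Complex.I * j / n =
    ((j * (2 * Real.pi / n) : ℝ) : ℂ) * Complex.I by push_cast; ring, Complex.exp_ofReal_mul_I_re]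

theorem zsin_intCast (j : ℤ) : zsin (j : ZMod n) = Real.sin (j * (2 * Real.pi / n)) := by
  rw [zsin, ZMod.stdAddChar_coe, show 2 * Real.pi * Complex.I * j / n =
    ((j * (2 * Real.pi / n) : ℝ) : ℂ) * Complex.I by push_cast; ring, Complex.exp_ofReal_mul_I_im]

theorem norm_stdAddChar (k : ZMod n) : ‖(ZMod.stdAddChar k : ℂ)‖ = 1 := by
  rw [ZMod.stdAddChar_apply]; exact Circle.norm_coe _

theorem star_stdAddChar (k : ZMod n) :
    (starRingEnd ℂ) (ZMod.stdAddChar k) = ZMod.stdAddChar (-k) := by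
  rw [AddChar.map_neg_eq_inv, Complex.inv_eq_conj (norm_stdAddChar k)]

theorem zcos_neg (k : ZMod n) : zcos (-k) = zcos k := by
  rw [zcos, ← star_stdAddChar, Complex.conj_re]; rfl

theorem zsin_neg (k : ZMod n) : zsin (-k) = -zsin k := by
  rw [zsin, ← star_stdAddChar, Complex.conj_im]; rfl

theorem zcos_zero : zcos (0 : ZMod n) = 1 := by simp [zcos]

theorem zcos_add (k l : ZMod n) : zcos (k + l) = zcos k * zcos l - zsin k * zsin l := by
  simp only [zcos, zsin, AddChar.map_add_eq_mul, Complex.mul_re]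

theorem zsin_add (k l : ZMod n) : zsin (k + l) = zsin k * zcos l + zcos k * zsin l := by
  simp only [zcos, zsin, AddChar.map_add_eq_mul, Complex.mul_im]; ring

theorem zcos_sq_add_zsin_sq (k : ZMod n) : zcos k ^ 2 + zsin k ^ 2 = 1 := by
  have h := norm_stdAddChar k
  rw [← sq_eq_sq₀ (norm_nonneg _) zero_le_one, Complex.sq_norm, Complex.normSq_apply] at h
  simp only [zcos, zsin]
  linarith

theorem zcos_lt_one {k : ZMod n} (hk : k ≠ 0) : zcos k < 1 := by
  have h := zcos_sq_add_zsin_sq k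
  refine lt_of_le_of_ne (by nlinarith [sq_nonneg (zsin k)]) fun h1 => hk ?_
  rw [h1] at h
  have h2 : zsin k = 0 := by nlinarith
  apply ZMod.injective_stdAddChar
  rw [AddChar.map_zero_eq_one]
  exact Complex.ext h1 h2

theorem zcos_le_one (k : ZMod n) : zcos k ≤ 1 := by
  nlinarith [zcos_sq_add_zsin_sq k, sq_nonneg (zsin k)]

/-- The discrete cosine transform of a weight on `ZMod n`. -/
noncomputable def cosTransform (w : ZMod n → ℝ) (m : ZMod n) : ℝ := ∑ k, w k * zcos (m * k)

theorem cosTransform_neg (w : ZMod n → ℝ) (m : ZMod n) :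
    cosTransform w (-m) = cosTransform w m := by
  simp only [cosTransform, neg_mul, zcos_neg]

/-- The condition `2r ≤ n` keeps the integers `|j| < r` inside the range of `valMinAbs`, so that no
residue is counted twice. -/
theorem sum_windowWeight_mul {r : ℕ} (hr : 2 * r ≤ n) (f : ZMod n → ℝ) :
    ∑ k, windowWeight n r k * f k = ∑ j ∈ Finset.Ioo (-(r : ℤ)) r, f (j : ZMod n) := by
  have hn : 0 < n := NeZero.pos n
  simp only [windowWeight, ite_mul, one_mul, zero_mul]
  rw [← Finset.sum_filter]
  refine Finset.sum_nbij' (fun k => k.valMinAbs) (fun j => (j : ZMod n)) ?_ ?_ ?_ ?_ ?_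
  · intro k hk
    simp only [Finset.mem_filter, Finset.mem_univ, true_and, Finset.mem_Ioo] at hk ⊢
    omega
  · intro j hj
    simp only [Finset.mem_filter, Finset.mem_univ, true_and, Finset.mem_Ioo] at hj ⊢
    rw [(ZMod.valMinAbs_spec (j : ZMod n) j).2 ⟨rfl, ⟨by omega, by omega⟩⟩]
    omega
  · intro k _
    exact ZMod.coe_valMinAbs k
  · intro j hj
    simp only [Finset.mem_Ioo] at hj
    exact (ZMod.valMinAbs_spec (j : ZMod n) j).2 ⟨rfl, ⟨by omega, by omega⟩⟩
  · intro k _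
    rw [ZMod.coe_valMinAbs k]

theorem sum_Ioo_cos_mul_sin (p : ℕ) (x : ℝ) :
    (∑ j ∈ Finset.Ioo (-((p + 1 : ℕ) : ℤ)) ((p + 1 : ℕ) : ℤ), Real.cos (j * (2 * x))) * Real.sin x
      = Real.sin ((2 * p + 1) * x) := by
  induction p with
  | zero =>
    have : Finset.Ioo (-((0 + 1 : ℕ) : ℤ)) ((0 + 1 : ℕ) : ℤ) = {0} := by decide
    rw [this]
    simp
  | succ p ih =>
    have : Finset.Ioo (-((p + 1 + 1 : ℕ) : ℤ)) ((p + 1 + 1 : ℕ) : ℤ) =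
        insert ((p + 1 : ℕ) : ℤ) (insert (-((p + 1 : ℕ) : ℤ))
          (Finset.Ioo (-((p + 1 : ℕ) : ℤ)) ((p + 1 : ℕ) : ℤ))) := by
      ext j
      simp only [Finset.mem_Ioo, Finset.mem_insert]
      omega
    rw [this, Finset.sum_insert (by simp; omega), Finset.sum_insert (by simp), add_mul, add_mul, ih]
    push_cast
    rw [neg_mul, Real.cos_neg]
    have e1 : (2 * ((p : ℝ) + 1) + 1) * x = (p + 1) * (2 * x) + x := by ring
    have e2 : (2 * (p : ℝ) + 1) * x = (p + 1) * (2 * x) - x := by ring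
    rw [e1, e2, Real.sin_add, Real.sin_sub]
    ring

/-- The Dirichlet kernel: the window of radius `r = p + 1` consists of the `2p + 1` residues with
`|k| ≤ p`. -/
theorem cosTransform_windowWeight_mul_sin {p : ℕ} (hp : 2 * (p + 1) ≤ n) (m : ℤ) :
    cosTransform (windowWeight n (p + 1)) (m : ZMod n) * Real.sin (m * (Real.pi / n)) =
      Real.sin ((2 * p + 1) * (m * (Real.pi / n))) := by
  rw [cosTransform, sum_windowWeight_mul hp (fun k => zcos ((m : ZMod n) * k)), ← sum_Ioo_cos_mul_sin]
  congr 1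
  refine Finset.sum_congr rfl fun j _ => ?_
  rw [← Int.cast_mul, zcos_intCast]
  push_cast
  congr 1
  ring

theorem cosTransform_windowWeight_zero {p : ℕ} (hp : 2 * (p + 1) ≤ n) :
    cosTransform (windowWeight n (p + 1)) (0 : ZMod n) = 2 * p + 1 := by
  rw [cosTransform, sum_windowWeight_mul hp (fun k => zcos (0 * k))]
  simp only [zero_mul, zcos_zero, Finset.sum_const, Int.card_Ioo, nsmul_eq_mul, mul_one]
  have : ((((p + 1 : ℕ) : ℤ) - -((p + 1 : ℕ) : ℤ) - 1).toNat) = 2 * p + 1 := by omega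
  rw [this]
  push_cast
  ring

theorem cosTransform_lt_zero {w : ZMod n → ℝ} (hw : ∀ k, 0 ≤ w k) (h1 : 0 < w 1) {m : ZMod n}
    (hm : m ≠ 0) : cosTransform w m < cosTransform w 0 := by
  refine Finset.sum_lt_sum (fun k _ => ?_) ⟨1, Finset.mem_univ _, ?_⟩
  · rw [zero_mul, zcos_zero]
    exact mul_le_mul_of_nonneg_left (zcos_le_one _) (hw k)
  · rw [zero_mul, zcos_zero, mul_one]
    exact mul_lt_mul_of_pos_left (zcos_lt_one hm) h1

/-- The angle `(2p+1)π/n` may exceed `π/2`, where the sine inequalities do not apply. Replacing it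
by its supplement if necessary does not change `|sin(j ·)|`. Strictness can fail only for `p = 0`
without folding, or for `2(p+1) = n` after folding. -/
theorem exists_fold_angle {p : ℕ} (hp : 2 * (p + 1) ≤ n) :
    ∃ φ : ℝ, Real.pi / n ≤ φ ∧ φ ≤ Real.pi / 2 ∧
      (1 ≤ p → 2 * (p + 1) < n → Real.pi / n < φ) ∧
      ∀ j : ℕ, |Real.sin ((2 * p + 1) * (j * (Real.pi / n)))| = |Real.sin (j * φ)| := by
  have hn : (0 : ℝ) < n := by exact_mod_cast NeZero.pos n
  have hπ := Real.pi_pos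
  have hp' : 2 * ((p : ℝ) + 1) ≤ n := by exact_mod_cast hp
  have hψ : 0 < Real.pi / n := by positivity
  have hnψ : n * (Real.pi / n) = Real.pi := by field_simp
  have hp0 : (0 : ℝ) ≤ p := p.cast_nonneg
  rcases le_total ((2 * p + 1) * (Real.pi / n)) (Real.pi / 2) with h | h
  · refine ⟨(2 * p + 1) * (Real.pi / n), by nlinarith, h, ?_, fun j => by congr 2; ring⟩
    intro h1 _
    have : (1 : ℝ) ≤ p := by exact_mod_cast h1
    nlinarith
  · refine ⟨Real.pi - (2 * p + 1) * (Real.pi / n), by nlinarith, by linarith, ?_, fun j => ?_⟩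
    · intro _ h2
      have : 2 * ((p : ℝ) + 1) < n := by exact_mod_cast h2
      nlinarith
    · rw [mul_sub, Real.sin_nat_mul_pi_sub, abs_neg, abs_mul, abs_pow, abs_neg, abs_one, one_pow,
        one_mul]
      congr 2
      ring

theorem exists_natCast_eq_or_eq_neg (k : ZMod n) :
    ∃ j : ℕ, 2 * j ≤ n ∧ (k = (j : ZMod n) ∨ k = -(j : ZMod n)) := by
  refine ⟨k.valMinAbs.natAbs, by have := ZMod.natAbs_valMinAbs_le k; omega, ?_⟩
  have h := ZMod.coe_valMinAbs k
  rcases Int.natAbs_eq k.valMinAbs with h1 | h1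
  · left
    rw [← Int.cast_natCast, ← h1, h]
  · right
    rw [← Int.cast_natCast, ← Int.cast_neg, ← h1, h]

theorem abs_cosTransform_windowWeight_mul {p : ℕ} (hp : 2 * (p + 1) ≤ n) {φ : ℝ}
    (hφ : ∀ j : ℕ, |Real.sin ((2 * p + 1) * (j * (Real.pi / n)))| = |Real.sin (j * φ)|) (j : ℕ)
    (hj : 2 * j ≤ n) :
    |cosTransform (windowWeight n (p + 1)) (j : ZMod n)| * Real.sin (j * (Real.pi / n)) =
      |Real.sin (j * φ)| := by
  have hn : (0 : ℝ) < n := by exact_mod_cast NeZero.pos n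
  have hπ := Real.pi_pos
  have hψ : 0 < Real.pi / n := by positivity
  have hnψ : n * (Real.pi / n) = Real.pi := by field_simp
  have hj' : 2 * (j : ℝ) ≤ n := by exact_mod_cast hj
  have h := cosTransform_windowWeight_mul_sin hp (j : ℤ)
  push_cast at h
  rw [← hφ j, ← h, abs_mul, abs_of_nonneg (a := Real.sin _)]
  exact Real.sin_nonneg_of_nonneg_of_le_pi (by positivity) (by nlinarith)

theorem cosTransform_windowWeight_one {p : ℕ} (hp : 2 * (p + 1) ≤ n) {φ : ℝ}
    (hφ0 : 0 ≤ φ) (hφ2 : φ ≤ Real.pi / 2)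
    (hφ : ∀ j : ℕ, |Real.sin ((2 * p + 1) * (j * (Real.pi / n)))| = |Real.sin (j * φ)|) :
    cosTransform (windowWeight n (p + 1)) (1 : ZMod n) * Real.sin (Real.pi / n) = Real.sin φ := by
  have hn : (0 : ℝ) < n := by exact_mod_cast NeZero.pos n
  have hπ := Real.pi_pos
  have hψ : 0 < Real.pi / n := by positivity
  have hnψ : n * (Real.pi / n) = Real.pi := by field_simp
  have hp' : 2 * ((p : ℝ) + 1) ≤ n := by exact_mod_cast hp
  have h := cosTransform_windowWeight_mul_sin hp 1
  have h1 := hφ 1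
  simp only [Int.cast_one, Nat.cast_one, one_mul] at h h1
  rw [abs_of_nonneg, abs_of_nonneg] at h1
  · rw [h, h1]
  · exact Real.sin_nonneg_of_nonneg_of_le_pi hφ0 (by linarith)
  · exact Real.sin_nonneg_of_nonneg_of_le_pi (by positivity) (by nlinarith)

/-- By symmetry `k = j` with `1 ≤ j ≤ n/2`. With `ψ = π/n` and the folded angle `φ`, `|D(j)| =
|sin(jφ)|/sin(jψ)` and `D(1) = sin φ/sin ψ`, so the claim is `abs_sin_mul_mul_sin_le`. -/
theorem cosTransform_windowWeight_le {p : ℕ} (hp : 2 * (p + 1) ≤ n) {k : ZMod n} (hk : k ≠ 0) :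
    cosTransform (windowWeight n (p + 1)) k ≤ cosTransform (windowWeight n (p + 1)) 1 := by
  have hn : (0 : ℝ) < n := by exact_mod_cast NeZero.pos n
  have hπ := Real.pi_pos
  have hψ : 0 < Real.pi / n := by positivity
  have hnψ : n * (Real.pi / n) = Real.pi := by field_simp
  obtain ⟨φ, h1, h2, -, h3⟩ := exists_fold_angle hp
  obtain ⟨j, hj, hkj⟩ := exists_natCast_eq_or_eq_neg k
  have hD : cosTransform (windowWeight n (p + 1)) k =
      cosTransform (windowWeight n (p + 1)) (j : ZMod n) := by
    rcases hkj with rfl | rfl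
    · rfl
    · rw [cosTransform_neg]
  have hj0 : j ≠ 0 := by
    rintro rfl
    simp at hkj
    exact hk hkj
  have hj1 : (1 : ℝ) ≤ j := by exact_mod_cast Nat.one_le_iff_ne_zero.2 hj0
  have hj2 : 2 * (j : ℝ) ≤ n := by exact_mod_cast hj
  have sψ : 0 < Real.sin (Real.pi / n) :=
    Real.sin_pos_of_pos_of_lt_pi hψ (by nlinarith)
  have sj : 0 < Real.sin (j * (Real.pi / n)) :=
    Real.sin_pos_of_pos_of_lt_pi (by positivity) (by nlinarith)
  have key := abs_sin_mul_mul_sin_le (m := j) hψ h1 (by nlinarith) h2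
  rw [← abs_cosTransform_windowWeight_mul hp h3 j hj,
    ← cosTransform_windowWeight_one hp (by linarith) h2 h3] at key
  rw [hD]
  refine (le_abs_self _).trans (le_of_mul_le_mul_right ?_ (mul_pos sj sψ))
  linarith

theorem cosTransform_windowWeight_lt {p : ℕ} (hp1 : 1 ≤ p) (hp : 2 * (p + 1) < n) {k : ZMod n}
    (hk : k ≠ 0) (hk1 : k ≠ 1) (hk2 : k ≠ -1) :
    cosTransform (windowWeight n (p + 1)) k < cosTransform (windowWeight n (p + 1)) 1 := by
  have hn : (0 : ℝ) < n := by exact_mod_cast NeZero.pos n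
  have hπ := Real.pi_pos
  have hψ : 0 < Real.pi / n := by positivity
  have hnψ : n * (Real.pi / n) = Real.pi := by field_simp
  obtain ⟨φ, h1, h2, h1', h3⟩ := exists_fold_angle hp.le
  obtain ⟨j, hj, hkj⟩ := exists_natCast_eq_or_eq_neg k
  have hD : cosTransform (windowWeight n (p + 1)) k =
      cosTransform (windowWeight n (p + 1)) (j : ZMod n) := by
    rcases hkj with rfl | rfl
    · rfl
    · rw [cosTransform_neg]
  have hj0 : 2 ≤ j := by
    by_contra! h
    interval_cases j <;> simp_all
  have hj1 : (2 : ℝ) ≤ j := by exact_mod_cast hj0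
  have hj2 : 2 * (j : ℝ) ≤ n := by exact_mod_cast hj
  have sψ : 0 < Real.sin (Real.pi / n) :=
    Real.sin_pos_of_pos_of_lt_pi hψ (by nlinarith)
  have sj : 0 < Real.sin (j * (Real.pi / n)) :=
    Real.sin_pos_of_pos_of_lt_pi (by positivity) (by nlinarith)
  have key := abs_sin_mul_mul_sin_lt (m := j) hj0 hψ (h1' hp1 hp) (by nlinarith) h2
  rw [← abs_cosTransform_windowWeight_mul hp.le h3 j hj,
    ← cosTransform_windowWeight_one hp.le (by linarith) h2 h3] at key
  rw [hD]
  refine (le_abs_self _).trans_lt (lt_of_mul_lt_mul_right ?_ (mul_pos sj sψ).le)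
  linarith

end


/-! ### The critical growth rate in the limit of large `n`. -/

theorem tendsto_natCast_mul_sin (a : ℝ) :
    Filter.Tendsto (fun n : ℕ => (n : ℝ) * Real.sin (a / n)) Filter.atTop (𝓝 a) := by
  have h : HasDerivAt (fun x : ℝ => Real.sin (a * x)) a 0 := by
    have h1 : HasDerivAt (fun x : ℝ => a * x) a 0 := by
      simpa using (hasDerivAt_id (0 : ℝ)).const_mul a
    simpa using h1.sin
  have h2 := h.tendsto_slope_zero_right
  have h3 : Filter.Tendsto (fun n : ℕ => ((n : ℝ))⁻¹) Filter.atTop (𝓝[>] 0) :=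
    tendsto_inv_atTop_nhdsGT_zero.comp tendsto_natCast_atTop_atTop
  refine (h2.comp h3).congr fun n => ?_
  simp [div_eq_mul_inv]

theorem tendsto_floor_mul_div {α : ℝ} (hα : 0 < α) :
    Filter.Tendsto (fun n : ℕ => (2 * ((⌊α * n⌋₊ - 1 : ℕ) : ℝ) + 1) / n) Filter.atTop
      (𝓝 (2 * α)) := by
  have h1 : Filter.Tendsto (fun n : ℕ => (⌊α * n⌋₊ : ℝ) / n) Filter.atTop (𝓝 α) :=
    (tendsto_nat_floor_mul_div_atTop hα.le).comp tendsto_natCast_atTop_atTop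
  have h2 : Filter.Tendsto (fun n : ℕ => (1 : ℝ) / n) Filter.atTop (𝓝 0) :=
    tendsto_one_div_atTop_nhds_zero_nat
  have h3 := (h1.const_mul 2).sub h2
  rw [sub_zero] at h3
  refine h3.congr' ?_
  have h4 : Filter.Tendsto (fun n : ℕ => α * n) Filter.atTop Filter.atTop :=
    tendsto_natCast_atTop_atTop.const_mul_atTop hα
  filter_upwards [h4.eventually_ge_atTop 1] with n hn
  have h5 : 1 ≤ ⌊α * n⌋₊ := Nat.one_le_floor_iff _ |>.2 hn
  rw [Nat.cast_sub h5]
  push_cast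
  ring

/-- By `gap_eq` the sequence is `(2D(1) - D(2) - D(0))/n` for large `n`, with `p = ⌊αn⌋ - 1`. Since
`x → 2α` and `n sin(a/n) → a`, the threshold function appears as the limit. -/
theorem tendsto_gap {α : ℝ} (hα : 0 < α) :
    Filter.Tendsto (fun n : ℕ =>
      let x := (2 * ((⌊α * n⌋₊ - 1 : ℕ) : ℝ) + 1) / n
      2 * (Real.sin (x * Real.pi) / (n * Real.sin (Real.pi / n))) -
        (Real.sin (x * (2 * Real.pi)) / (n * Real.sin (2 * Real.pi / n)) + x)) Filter.atTop
      (𝓝 (-(2 / Real.pi) * threshold α)) := by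
  have hπ := Real.pi_pos
  have h := tendsto_floor_mul_div hα
  have h1 := ((Real.continuous_sin.tendsto _).comp (h.mul_const Real.pi)).div
    (tendsto_natCast_mul_sin Real.pi) hπ.ne'
  have h2 := ((Real.continuous_sin.tendsto _).comp (h.mul_const (2 * Real.pi))).div
    (tendsto_natCast_mul_sin (2 * Real.pi)) (by positivity)
  have h3 := (h1.const_mul 2).sub (h2.add h)
  have e : -(2 / Real.pi) * threshold α = 2 * (Real.sin (2 * α * Real.pi) / Real.pi) -
      (Real.sin (2 * α * (2 * Real.pi)) / (2 * Real.pi) + 2 * α) := by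
    rw [threshold, show 2 * α * Real.pi = 2 * Real.pi * α by ring,
      show 2 * α * (2 * Real.pi) = 4 * Real.pi * α by ring]
    field_simp
    ring
  rw [e]
  exact h3

theorem gap_eq {n : ℕ} [NeZero n] (hn : 3 ≤ n) {p : ℕ} (hp : 2 * (p + 1) ≤ n) :
    (2 * cosTransform (windowWeight n (p + 1)) 1 - (cosTransform (windowWeight n (p + 1)) 2
      + cosTransform (windowWeight n (p + 1)) 0)) / n =
      2 * (Real.sin ((2 * (p : ℝ) + 1) / n * Real.pi) / (n * Real.sin (Real.pi / n))) -
        (Real.sin ((2 * (p : ℝ) + 1) / n * (2 * Real.pi)) / (n * Real.sin (2 * Real.pi / n)) +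
          (2 * (p : ℝ) + 1) / n) := by
  have hn' : (3 : ℝ) ≤ n := by exact_mod_cast hn
  have hn0 : (0 : ℝ) < n := by linarith
  have hπ := Real.pi_pos
  have h1 := cosTransform_windowWeight_mul_sin hp 1
  have h2 := cosTransform_windowWeight_mul_sin hp 2
  rw [cosTransform_windowWeight_zero hp]
  push_cast at h1 h2
  have s1 : 0 < Real.sin (1 * (Real.pi / n)) := by
    rw [one_mul]
    exact Real.sin_pos_of_pos_of_lt_pi (by positivity) (by rw [div_lt_iff₀ hn0]; nlinarith)
  have s2 : 0 < Real.sin (2 * (Real.pi / n)) :=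
    Real.sin_pos_of_pos_of_lt_pi (by positivity)
      (by rw [← mul_div_assoc, div_lt_iff₀ hn0]; nlinarith)
  rw [← eq_div_iff s1.ne'] at h1
  rw [← eq_div_iff s2.ne'] at h2
  rw [h1, h2]
  rw [show (2 * (p : ℝ) + 1) / n * Real.pi = (2 * p + 1) * (1 * (Real.pi / n)) by ring,
    show (2 * (p : ℝ) + 1) / n * (2 * Real.pi) = (2 * p + 1) * (2 * (Real.pi / n)) by ring,
    show Real.pi / n = 1 * (Real.pi / n) by ring,
    show 2 * Real.pi / n = 2 * (Real.pi / n) by ring]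
  simp only [one_mul] at s1 ⊢
  field_simp

theorem floor_bounds {α : ℝ} (hα : 0 < α) :
    ∀ᶠ n : ℕ in Filter.atTop, 2 ≤ ⌊α * n⌋₊ := by
  have h4 : Filter.Tendsto (fun n : ℕ => α * n) Filter.atTop Filter.atTop :=
    tendsto_natCast_atTop_atTop.const_mul_atTop hα
  filter_upwards [h4.eventually_ge_atTop 2] with n hn
  exact Nat.le_floor (by exact_mod_cast hn)

theorem two_mul_floor_le {α : ℝ} (hα : 0 < α) (hα' : α ≤ 1 / 2) (n : ℕ) : 2 * ⌊α * n⌋₊ ≤ n := by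
  have h := Nat.floor_le (show 0 ≤ α * n by positivity)
  have h0 : (0 : ℝ) ≤ n := n.cast_nonneg
  have : 2 * (⌊α * n⌋₊ : ℝ) ≤ n := by nlinarith
  exact_mod_cast this

theorem two_mul_floor_lt {α : ℝ} (hα : 0 < α) (hα' : α < 1 / 2) {n : ℕ} (hn : 0 < n) :
    2 * ⌊α * n⌋₊ < n := by
  have h := Nat.floor_le (show 0 ≤ α * n by positivity)
  have h0 : (0 : ℝ) < n := by exact_mod_cast hn
  have : 2 * (⌊α * n⌋₊ : ℝ) < n := by nlinarith
  exact_mod_cast this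

/-! ### Spectral stability of the window graph. -/

/-- The spectral conditions for stability of the twist, in terms of the transform of the weight. -/
structure SpectrallyStable {n : ℕ} [NeZero n] (w : ZMod n → ℝ) : Prop where
  planar : ∀ m : ZMod n, m ≠ 0 →
    cosTransform w (m + 1) + cosTransform w (m - 1) < 2 * cosTransform w 1
  normal : ∀ m : ZMod n, m ≠ 0 → cosTransform w m < cosTransform w 0
  mixed : ∀ m : ZMod n, m ≠ 0 → m ≠ 1 →
    cosTransform w m + cosTransform w (m - 1) < cosTransform w 0 + cosTransform w 1

theorem zmod_one_ne_neg_one {n : ℕ} (hn : 3 ≤ n) : (1 : ZMod n) ≠ -1 := by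
  intro h
  have h2 : ((2 : ℕ) : ZMod n) = 0 := by push_cast; linear_combination h
  rw [ZMod.natCast_eq_zero_iff] at h2
  exact absurd (Nat.le_of_dvd (by norm_num) h2) (by omega)

theorem zmod_four_ne_zero {n : ℕ} (hn : 5 ≤ n) : (4 : ZMod n) ≠ 0 := by
  intro h
  have h2 : ((4 : ℕ) : ZMod n) = 0 := by exact_mod_cast h
  rw [ZMod.natCast_eq_zero_iff] at h2
  exact absurd (Nat.le_of_dvd (by norm_num) h2) (by omega)

theorem windowWeight_one {n r : ℕ} [NeZero n] (hn : 2 < n) (hr : 2 ≤ r) :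
    windowWeight n r 1 = 1 := by
  rw [windowWeight, if_pos]
  have : (1 : ZMod n).valMinAbs = 1 :=
    (ZMod.valMinAbs_spec (1 : ZMod n) 1).2 ⟨by simp, ⟨by omega, by omega⟩⟩
  rw [this]
  exact hr

/-- The planar modes `±1` are the hypothesis `hgap`. For any other `m ≠ 0` both `D(m+1)` and
`D(m-1)` are at most `D(1)`, and one of them is strictly smaller. -/
theorem spectrallyStable_windowWeight {n p : ℕ} [NeZero n] (hn : 5 ≤ n) (hp1 : 1 ≤ p)
    (hp : 2 * (p + 1) < n)
    (hgap : cosTransform (windowWeight n (p + 1)) 2 + cosTransform (windowWeight n (p + 1)) 0 <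
      2 * cosTransform (windowWeight n (p + 1)) 1) :
    SpectrallyStable (windowWeight n (p + 1)) := by
  have normal : ∀ m : ZMod n, m ≠ 0 →
      cosTransform (windowWeight n (p + 1)) m < cosTransform (windowWeight n (p + 1)) 0 :=
    fun m hm => cosTransform_lt_zero (windowWeight_nonneg _)
      (by rw [windowWeight_one (by omega) (by omega)]; norm_num) hm
  refine ⟨fun m hm => ?_, normal, fun m hm hm1 => ?_⟩
  · by_cases h1 : m = 1
    · rw [h1, sub_self, one_add_one_eq_two]
      exact hgap
    by_cases h2 : m = -1
    · rw [h2, neg_add_cancel, show (-1 - 1 : ZMod n) = -2 by ring, cosTransform_neg]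
      linarith
    have a1 : m + 1 ≠ 0 := fun h => h2 (by linear_combination h)
    have a2 : m - 1 ≠ 0 := fun h => h1 (by linear_combination h)
    have b1 := cosTransform_windowWeight_le hp.le a1
    have b2 := cosTransform_windowWeight_le hp.le a2
    -- For `m = -2` the value `D(m+1) = D(-1)` equals `D(1)`, so strictness has to come from `m - 1
    -- = -3`, which differs from `1` because `n ≥ 5`.
    by_cases h3 : m + 1 = -1
    · have h4 : m - 1 ≠ 1 := fun h => zmod_four_ne_zero hn (by linear_combination h3 - h)
      have h5 : m - 1 ≠ -1 := fun h => hm (by linear_combination h)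
      have := cosTransform_windowWeight_lt hp1 hp a2 h4 h5
      linarith
    · have h4 : m + 1 ≠ 1 := fun h => hm (by linear_combination h)
      have := cosTransform_windowWeight_lt hp1 hp a1 h4 h3
      linarith
  · have := cosTransform_windowWeight_le hp.le (sub_ne_zero.2 hm1)
    have := normal m hm
    linarith

theorem eventually_spectrallyStable {α : ℝ} (hα : 0 < α) (hα' : α < 1 / 2)
    (hneg : threshold α < 0) : ∃ N : ℕ, 3 ≤ N ∧ ∀ (n : ℕ) [NeZero n], N < n →
      SpectrallyStable (windowWeight n ⌊α * n⌋₊) := by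
  have hπ := Real.pi_pos
  have hl : 0 < -(2 / Real.pi) * threshold α :=
    mul_pos_of_neg_of_neg (neg_neg_of_pos (by positivity)) hneg
  obtain ⟨N, hN⟩ := Filter.eventually_atTop.1
    ((Filter.Tendsto.eventually_const_lt hl (tendsto_gap hα)).and (floor_bounds hα))
  refine ⟨max N 5, by omega, fun n _ hn => ?_⟩
  obtain ⟨h1, h2⟩ := hN n (by omega)
  have h3 := two_mul_floor_lt hα hα' (NeZero.pos n)
  obtain ⟨p, hp⟩ := Nat.exists_eq_add_of_le' (show 1 ≤ ⌊α * n⌋₊ by omega)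
  rw [hp] at h1 h2 h3 ⊢
  rw [Nat.add_sub_cancel] at h1
  refine spectrallyStable_windowWeight (by omega) (by omega) h3 ?_
  simp only at h1
  rw [← gap_eq (by omega) h3.le] at h1
  have h4 : (0 : ℝ) < n := by exact_mod_cast NeZero.pos n
  have := (div_pos_iff_of_pos_right h4).1 h1
  linarith

theorem eventually_unstable_mode {α : ℝ} (hα : 0 < α) (hα' : α ≤ 1 / 2)
    (hpos : 0 < threshold α) : ∃ N : ℕ, 3 ≤ N ∧ ∀ (n : ℕ) [NeZero n], N < n →
      2 * cosTransform (windowWeight n ⌊α * n⌋₊) 1 <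
        cosTransform (windowWeight n ⌊α * n⌋₊) 2 + cosTransform (windowWeight n ⌊α * n⌋₊) 0 ∧
      ∀ m : ZMod n, m ≠ 0 → cosTransform (windowWeight n ⌊α * n⌋₊) m ≤
        cosTransform (windowWeight n ⌊α * n⌋₊) 1 := by
  have hπ := Real.pi_pos
  have hl : -(2 / Real.pi) * threshold α < 0 :=
    mul_neg_of_neg_of_pos (neg_neg_of_pos (by positivity)) hpos
  obtain ⟨N, hN⟩ := Filter.eventually_atTop.1
    ((Filter.Tendsto.eventually_lt_const hl (tendsto_gap hα)).and (floor_bounds hα))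
  refine ⟨max N 5, by omega, fun n _ hn => ?_⟩
  obtain ⟨h1, h2⟩ := hN n (by omega)
  have h3 := two_mul_floor_le hα hα' n
  obtain ⟨p, hp⟩ := Nat.exists_eq_add_of_le' (show 1 ≤ ⌊α * n⌋₊ by omega)
  rw [hp] at h1 h2 h3 ⊢
  rw [Nat.add_sub_cancel] at h1
  refine ⟨?_, fun m hm => cosTransform_windowWeight_le h3 hm⟩
  simp only at h1
  rw [← gap_eq (by omega) h3] at h1
  have h4 : (0 : ℝ) < n := by exact_mod_cast NeZero.pos n
  have := (div_neg_iff.1 h1).resolve_left (fun h => absurd h.2 (by linarith))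
  linarith [this.1]


/-! ### Fourier analysis of the quadratic forms on `ℤ/n`. -/

section
variable {n : ℕ} [NeZero n]

/-- The discrete Fourier transform. -/
noncomputable def dft (b : ZMod n → ℂ) (m : ZMod n) : ℂ := ∑ j, ZMod.stdAddChar (-(m * j)) * b j

/-- The power spectrum is the Fourier transform of the autocorrelation. Expanding the square leaves,
by orthogonality of characters, only the pairs with `j = i + k`. -/
theorem sum_conj_mul_shift (b : ZMod n → ℂ) (k : ZMod n) :
    ∑ m, (Complex.normSq (dft b m) : ℂ) * ZMod.stdAddChar (m * k) =
      n * ∑ i, (starRingEnd ℂ) (b i) * b (i + k) := by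
  have h1 : ∀ m, (Complex.normSq (dft b m) : ℂ) * ZMod.stdAddChar (m * k) =
      ∑ i, ∑ j, (starRingEnd ℂ) (b i) * b j * ZMod.stdAddChar (m * (i - j + k)) := by
    intro m
    rw [Complex.normSq_eq_conj_mul_self, dft, map_sum, Finset.sum_mul_sum, Finset.sum_mul]
    refine Finset.sum_congr rfl fun i _ => ?_
    rw [Finset.sum_mul]
    refine Finset.sum_congr rfl fun j _ => ?_
    rw [map_mul, star_stdAddChar, show m * (i - j + k) = -(-(m * i)) + -(m * j) + m * k by ring,
      AddChar.map_add_eq_mul, AddChar.map_add_eq_mul]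
    ring
  simp only [h1]
  rw [Finset.sum_comm, Finset.mul_sum]
  refine Finset.sum_congr rfl fun i _ => ?_
  rw [Finset.sum_comm, Finset.sum_eq_single (i + k)]
  · simp only [show i - (i + k) + k = 0 by ring, mul_zero, AddChar.map_zero_eq_one, mul_one,
      Finset.sum_const, Finset.card_univ, ZMod.card, nsmul_eq_mul]
  · intro j _ hj
    rw [← Finset.mul_sum, AddChar.sum_mulShift _ (ZMod.isPrimitive_stdAddChar n), if_neg]
    · simp
    · intro h
      exact hj (by linear_combination -h)
  · simp

theorem sum_normSq_dft (b : ZMod n → ℂ) :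
    ∑ m, Complex.normSq (dft b m) = n * ∑ i, Complex.normSq (b i) := by
  have h := sum_conj_mul_shift b 0
  simp only [mul_zero, AddChar.map_zero_eq_one, mul_one, add_zero,
    ← Complex.normSq_eq_conj_mul_self] at h
  exact_mod_cast h

/-- Twisting the correlation by the character of `s` shifts the transform by `s`. The shifts `±1`
serve the planar form, `0` and `-1` the mixed form, and `0` the normal form. -/
theorem sum_weighted_shift (w : ZMod n → ℝ) (b : ZMod n → ℂ) (s : ZMod n) :
    ∑ m, Complex.normSq (dft b m) * cosTransform w (m + s) =
      n * ∑ i, ∑ k, w k * ((starRingEnd ℂ) (b i) * b (i + k) * ZMod.stdAddChar (s * k)).re := by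
  have h1 : ∀ m, Complex.normSq (dft b m) * cosTransform w (m + s) =
      ∑ k, w k * ((Complex.normSq (dft b m) : ℂ) * ZMod.stdAddChar (m * k) *
        ZMod.stdAddChar (s * k)).re := by
    intro m
    rw [cosTransform, Finset.mul_sum]
    refine Finset.sum_congr rfl fun k _ => ?_
    rw [mul_assoc, ← AddChar.map_add_eq_mul, ← add_mul, Complex.re_ofReal_mul, zcos]
    ring
  simp only [h1]
  rw [Finset.sum_comm, Finset.sum_comm (s := (Finset.univ : Finset (ZMod n))) (t := Finset.univ)
    (f := fun i k => w k * ((starRingEnd ℂ) (b i) * b (i + k) * ZMod.stdAddChar (s * k)).re),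
    Finset.mul_sum]
  refine Finset.sum_congr rfl fun k _ => ?_
  rw [← Finset.mul_sum, ← Finset.mul_sum, ← Complex.re_sum, ← Complex.re_sum, ← Finset.sum_mul,
    ← Finset.sum_mul, sum_conj_mul_shift, mul_assoc, ← Complex.ofReal_natCast,
    Complex.re_ofReal_mul]
  ring

theorem exists_uniform_gap {ι : Type*} [Finite ι] [Nonempty ι] (P : ι → Prop) (f : ι → ℝ)
    (h : ∀ m, P m → f m < 0) : ∃ c > 0, ∀ m, P m → f m ≤ -c := by
  classical
  -- The value `1` outside `P` keeps the minimum positive even when `P` holds nowhere.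
  obtain ⟨m₀, hm₀⟩ := Finite.exists_min fun m => if P m then -f m else 1
  refine ⟨if P m₀ then -f m₀ else 1, ?_, fun m hm => ?_⟩
  · split_ifs with h0
    · exact neg_pos.2 (h _ h0)
    · exact one_pos
  · have := hm₀ m
    rw [if_pos hm] at this
    linarith

theorem sum_normSq_dft_mul_le {b : ZMod n → ℂ} {P : ZMod n → Prop} {f : ZMod n → ℝ} {c : ℝ}
    (hf : ∀ m, P m → f m ≤ -c) (hb : ∀ m, ¬ P m → dft b m = 0) :
    ∑ m, Complex.normSq (dft b m) * f m ≤ n * (-c * ∑ i, Complex.normSq (b i)) := by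
  have h : ∀ m ∈ Finset.univ,
      Complex.normSq (dft b m) * f m ≤ -c * Complex.normSq (dft b m) := by
    intro m _
    by_cases hm : P m
    · nlinarith [hf m hm, Complex.normSq_nonneg (dft b m)]
    · simp [hb m hm]
  refine (Finset.sum_le_sum h).trans_eq ?_
  rw [← Finset.mul_sum, sum_normSq_dft]
  ring

/-- Here `2 cos(2πk/n)` is the sum of the characters of `1` and `-1`, whence the two shifted
transforms. -/
theorem sum_planar_form (w : ZMod n → ℝ) (a : ZMod n → ℝ) :
    n * ∑ i, ∑ k, w k * (2 * zcos k * (a i * a (i + k) - a i ^ 2)) =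
      ∑ m, Complex.normSq (dft (fun i => (a i : ℂ)) m) *
        (cosTransform w (m + 1) + cosTransform w (m - 1) - 2 * cosTransform w 1) := by
  have h1 := sum_weighted_shift w (fun i => (a i : ℂ)) 1
  have h2 := sum_weighted_shift w (fun i => (a i : ℂ)) (-1)
  have h3 := sum_normSq_dft (fun i => (a i : ℂ))
  simp only [Complex.conj_ofReal, one_mul, neg_mul, mul_assoc, Complex.re_ofReal_mul,
    Complex.normSq_ofReal] at h1 h2 h3
  simp only [mul_sub, mul_add, Finset.sum_add_distrib, Finset.sum_sub_distrib, h1,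
    sub_eq_add_neg (a := (_ : ZMod n)), h2, ← Finset.sum_mul, h3]
  have e : ∀ k : ZMod n, (ZMod.stdAddChar (-k) : ℂ).re = (ZMod.stdAddChar k : ℂ).re := zcos_neg
  simp only [e]
  have h4 : ∑ i, ∑ k, w k * (2 * zcos k * a i ^ 2) =
      2 * (∑ i, a i * a i) * cosTransform w 1 := by
    rw [mul_assoc, Finset.sum_mul, Finset.mul_sum]
    refine Finset.sum_congr rfl fun i _ => ?_
    rw [cosTransform, Finset.mul_sum, Finset.mul_sum]
    refine Finset.sum_congr rfl fun k _ => ?_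
    rw [one_mul]
    ring
  have h5 : ∑ i, ∑ k, w k * (2 * zcos k * (a i * a (i + k))) =
      2 * ∑ i, ∑ k, w k * (a i * (a (i + k) * (ZMod.stdAddChar k : ℂ).re)) := by
    rw [Finset.mul_sum]
    refine Finset.sum_congr rfl fun i _ => ?_
    rw [Finset.mul_sum]
    refine Finset.sum_congr rfl fun k _ => ?_
    rw [zcos]
    ring
  rw [h4, h5]
  ring

theorem sum_mixed_form (w : ZMod n → ℝ) (b : ZMod n → ℂ) :
    n * ∑ i, ∑ k, w k * (((starRingEnd ℂ) (b i) * b (i + k) * (1 + ZMod.stdAddChar (-k))).re -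
        (1 + zcos k) * Complex.normSq (b i)) =
      ∑ m, Complex.normSq (dft b m) *
        (cosTransform w m + cosTransform w (m - 1) - (cosTransform w 0 + cosTransform w 1)) := by
  have h1 := sum_weighted_shift w b 0
  have h2 := sum_weighted_shift w b (-1)
  have h3 := sum_normSq_dft b
  simp only [zero_mul, AddChar.map_zero_eq_one, mul_one, neg_mul, one_mul, add_zero] at h1 h2
  simp only [mul_sub, mul_add, Finset.sum_add_distrib, Finset.sum_sub_distrib, h1,
    sub_eq_add_neg (a := (_ : ZMod n)), h2, ← Finset.sum_mul, h3, mul_one, Complex.add_re]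
  have h4 : ∑ i, ∑ k, w k * ((1 + zcos k) * Complex.normSq (b i)) =
      (∑ i, Complex.normSq (b i)) * (cosTransform w 0 + cosTransform w 1) := by
    rw [Finset.sum_mul]
    refine Finset.sum_congr rfl fun i _ => ?_
    rw [cosTransform, cosTransform, ← Finset.sum_add_distrib, Finset.mul_sum]
    refine Finset.sum_congr rfl fun k _ => ?_
    rw [one_mul, zero_mul, zcos_zero]
    ring
  rw [h4]
  ring

theorem sum_normal_form (w : ZMod n → ℝ) (a : ZMod n → ℝ) :
    n * ∑ i, ∑ k, w k * (a i * a (i + k) - a i ^ 2) =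
      ∑ m, Complex.normSq (dft (fun i => (a i : ℂ)) m) *
        (cosTransform w m - cosTransform w 0) := by
  have h1 := sum_weighted_shift w (fun i => (a i : ℂ)) 0
  have h3 := sum_normSq_dft (fun i => (a i : ℂ))
  simp only [Complex.conj_ofReal, zero_mul, AddChar.map_zero_eq_one, mul_one, ← Complex.ofReal_mul,
    Complex.ofReal_re, Complex.normSq_ofReal, add_zero] at h1 h3
  simp only [mul_sub, Finset.sum_sub_distrib, h1, ← Finset.sum_mul, h3]
  have h4 : ∑ i, (∑ k, w k) * a i ^ 2 = (∑ i, a i * a i) * cosTransform w 0 := by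
    simp only [cosTransform, zero_mul, zcos_zero, mul_one, ← Finset.mul_sum, pow_two]
    ring
  rw [h4]
  ring

theorem dft_zero (b : ZMod n → ℂ) : dft b 0 = ∑ i, b i := by simp [dft]

theorem dft_ofReal_zero {a : ZMod n → ℝ} (ha : ∑ i, a i = 0) :
    dft (fun i => (a i : ℂ)) 0 = 0 := by
  rw [dft_zero, ← Complex.ofReal_sum, ha, Complex.ofReal_zero]

/-- The scalar quadratic forms of the linearization are negative definite transversally to the
symmetries. -/
theorem SpectrallyStable.exists_gap {w : ZMod n → ℝ} (hw : SpectrallyStable w) :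
    ∃ c > 0,
      (∀ a : ZMod n → ℝ, ∑ i, a i = 0 →
        ∑ i, ∑ k, w k * (2 * zcos k * (a i * a (i + k) - a i ^ 2)) ≤ -c * ∑ i, a i ^ 2) ∧
      (∀ b : ZMod n → ℂ, ∑ i, b i = 0 → ∑ i, ZMod.stdAddChar (-i) * b i = 0 →
        ∑ i, ∑ k, w k * (((starRingEnd ℂ) (b i) * b (i + k) * (1 + ZMod.stdAddChar (-k))).re -
          (1 + zcos k) * Complex.normSq (b i)) ≤ -c * ∑ i, Complex.normSq (b i)) ∧
      (∀ a : ZMod n → ℝ, ∑ i, a i = 0 →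
        ∑ i, ∑ k, w k * (a i * a (i + k) - a i ^ 2) ≤ -c * ∑ i, a i ^ 2) := by
  obtain ⟨c1, hc1, h1⟩ := exists_uniform_gap (fun m : ZMod n => m ≠ 0)
    (fun m => cosTransform w (m + 1) + cosTransform w (m - 1) - 2 * cosTransform w 1)
    (fun m hm => by linarith [hw.planar m hm])
  obtain ⟨c2, hc2, h2⟩ := exists_uniform_gap (fun m : ZMod n => m ≠ 0 ∧ m ≠ 1)
    (fun m => cosTransform w m + cosTransform w (m - 1) - (cosTransform w 0 + cosTransform w 1))
    (fun m hm => by linarith [hw.mixed m hm.1 hm.2])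
  obtain ⟨c3, hc3, h3⟩ := exists_uniform_gap (fun m : ZMod n => m ≠ 0)
    (fun m => cosTransform w m - cosTransform w 0)
    (fun m hm => by linarith [hw.normal m hm])
  have hn : (0 : ℝ) < n := by exact_mod_cast NeZero.pos n
  have weaken : ∀ {c c' x y : ℝ}, c ≤ c' → 0 ≤ y → n * x ≤ n * (-c' * y) → x ≤ -c * y := by
    intro c c' x y hc hy h
    have := le_of_mul_le_mul_left h hn
    nlinarith
  have sq : ∀ a : ZMod n → ℝ, ∑ i, a i ^ 2 = ∑ i, Complex.normSq (a i : ℂ) := fun a =>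
    Finset.sum_congr rfl fun i _ => by rw [Complex.normSq_ofReal, pow_two]
  refine ⟨min c1 (min c2 c3), by positivity, fun a ha => ?_, fun b hb hb' => ?_, fun a ha => ?_⟩
  · refine weaken (min_le_left _ _) (Finset.sum_nonneg fun i _ => sq_nonneg _) ?_
    rw [sum_planar_form, sq]
    exact sum_normSq_dft_mul_le h1 fun m hm => by rw [not_not.1 hm, dft_ofReal_zero ha]
  · refine weaken ((min_le_right _ _).trans (min_le_left _ _))
      (Finset.sum_nonneg fun i _ => Complex.normSq_nonneg _) ?_
    rw [sum_mixed_form]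
    refine sum_normSq_dft_mul_le h2 fun m hm => ?_
    rcases not_and_or.1 hm with h | h
    · rw [not_not.1 h, dft_zero, hb]
    · rw [not_not.1 h, dft]
      simpa only [one_mul] using hb'
  · refine weaken ((min_le_right _ _).trans (min_le_right _ _))
      (Finset.sum_nonneg fun i _ => sq_nonneg _) ?_
    rw [sum_normal_form, sq]
    exact sum_normSq_dft_mul_le h3 fun m hm => by rw [not_not.1 hm, dft_ofReal_zero ha]

end


/-! ### The Frobenius inner product and norm. -/

section
variable {ι : Type*} [Fintype ι]

/-- The Frobenius inner product of real matrices. -/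
def frobInner (A B : Matrix ι ι ℝ) : ℝ := ∑ p, ∑ q, A p q * B p q

/-- The Frobenius norm of a real matrix. -/
noncomputable def frobNorm (A : Matrix ι ι ℝ) : ℝ := Real.sqrt (frobInner A A)

theorem frobInner_eq_trace (A B : Matrix ι ι ℝ) : frobInner A B = (A.transpose * B).trace := by
  simp only [frobInner, Matrix.trace, Matrix.diag, Matrix.mul_apply, Matrix.transpose_apply]
  exact Finset.sum_comm

theorem frobInner_comm (A B : Matrix ι ι ℝ) : frobInner A B = frobInner B A := by
  simp only [frobInner, mul_comm]

theorem frobInner_add_right (A B C : Matrix ι ι ℝ) :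
    frobInner A (B + C) = frobInner A B + frobInner A C := by
  simp only [frobInner, Matrix.add_apply, mul_add, Finset.sum_add_distrib]

theorem frobInner_sub_right (A B C : Matrix ι ι ℝ) :
    frobInner A (B - C) = frobInner A B - frobInner A C := by
  simp only [frobInner, Matrix.sub_apply, mul_sub, Finset.sum_sub_distrib]

theorem frobInner_smul_right (c : ℝ) (A B : Matrix ι ι ℝ) :
    frobInner A (c • B) = c * frobInner A B := by
  simp only [frobInner, Matrix.smul_apply, smul_eq_mul, Finset.mul_sum]
  exact Finset.sum_congr rfl fun _ _ => Finset.sum_congr rfl fun _ _ => by ring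

theorem frobInner_sum_right {κ : Type*} (s : Finset κ) (A : Matrix ι ι ℝ)
    (B : κ → Matrix ι ι ℝ) : frobInner A (∑ k ∈ s, B k) = ∑ k ∈ s, frobInner A (B k) := by
  simp only [frobInner_eq_trace, Finset.mul_sum, Matrix.trace_sum]

theorem frobInner_sub_left (A B C : Matrix ι ι ℝ) :
    frobInner (A - B) C = frobInner A C - frobInner B C := by
  simp only [frobInner_comm _ C, frobInner_sub_right]

theorem frobInner_smul_left (c : ℝ) (A B : Matrix ι ι ℝ) :
    frobInner (c • A) B = c * frobInner A B := by
  simp only [frobInner_comm _ B, frobInner_smul_right]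

theorem frobInner_sum_left {κ : Type*} (s : Finset κ) (A : Matrix ι ι ℝ)
    (B : κ → Matrix ι ι ℝ) : frobInner (∑ k ∈ s, B k) A = ∑ k ∈ s, frobInner (B k) A := by
  simp only [frobInner_comm _ A, frobInner_sum_right]

theorem frobInner_transpose (A B : Matrix ι ι ℝ) :
    frobInner A.transpose B.transpose = frobInner A B := by
  simp only [frobInner, Matrix.transpose_apply]
  exact Finset.sum_comm

theorem frobInner_self_nonneg (A : Matrix ι ι ℝ) : 0 ≤ frobInner A A :=
  Finset.sum_nonneg fun _ _ => Finset.sum_nonneg fun _ _ => mul_self_nonneg _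

theorem frobNorm_nonneg (A : Matrix ι ι ℝ) : 0 ≤ frobNorm A := Real.sqrt_nonneg _

theorem frobNorm_sq (A : Matrix ι ι ℝ) : frobNorm A ^ 2 = frobInner A A :=
  Real.sq_sqrt (frobInner_self_nonneg A)

theorem frobNorm_transpose (A : Matrix ι ι ℝ) : frobNorm A.transpose = frobNorm A := by
  rw [frobNorm, frobInner_transpose, frobNorm]

section
open scoped Matrix.Norms.Frobenius

theorem frobNorm_eq_norm (A : Matrix ι ι ℝ) : frobNorm A = ‖A‖ := by
  rw [Matrix.frobenius_norm_def, ← Real.sqrt_eq_rpow, frobNorm]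
  congr 1
  simp only [frobInner]
  refine Finset.sum_congr rfl fun _ _ => Finset.sum_congr rfl fun _ _ => ?_
  rw [Real.rpow_two, Real.norm_eq_abs, sq_abs, pow_two]

theorem frobNorm_mul_le (A B : Matrix ι ι ℝ) : frobNorm (A * B) ≤ frobNorm A * frobNorm B := by
  simp only [frobNorm_eq_norm]
  exact Matrix.frobenius_norm_mul A B

theorem frobNorm_add_le (A B : Matrix ι ι ℝ) : frobNorm (A + B) ≤ frobNorm A + frobNorm B := by
  simp only [frobNorm_eq_norm]
  exact norm_add_le A B

theorem frobNorm_sub_le (A B : Matrix ι ι ℝ) : frobNorm (A - B) ≤ frobNorm A + frobNorm B := by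
  simp only [frobNorm_eq_norm]
  exact norm_sub_le A B

theorem frobNorm_smul (c : ℝ) (A : Matrix ι ι ℝ) : frobNorm (c • A) = |c| * frobNorm A := by
  simp only [frobNorm_eq_norm]
  exact norm_smul c A

theorem frobNorm_sum_le {κ : Type*} (s : Finset κ) (B : κ → Matrix ι ι ℝ) :
    frobNorm (∑ k ∈ s, B k) ≤ ∑ k ∈ s, frobNorm (B k) := by
  simp only [frobNorm_eq_norm]
  exact norm_sum_le s B

end

theorem frobInner_le (A B : Matrix ι ι ℝ) : frobInner A B ≤ frobNorm A * frobNorm B := by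
  simp only [frobNorm, frobInner, ← Finset.sum_product', ← pow_two]
  exact Real.sum_mul_le_sqrt_mul_sqrt _ _ _

theorem abs_apply_le_frobNorm (A : Matrix ι ι ℝ) (p q : ι) : |A p q| ≤ frobNorm A := by
  rw [← Real.sqrt_sq_eq_abs, frobNorm]
  refine Real.sqrt_le_sqrt ?_
  rw [pow_two, frobInner]
  have h1 := Finset.single_le_sum (f := fun q => A p q * A p q)
    (fun _ _ => mul_self_nonneg _) (Finset.mem_univ q)
  have h2 := Finset.single_le_sum (f := fun p => ∑ q, A p q * A p q)
    (fun _ _ => Finset.sum_nonneg fun _ _ => mul_self_nonneg _) (Finset.mem_univ p)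
  exact h1.trans h2

theorem frobInner_mul_left [DecidableEq ι] (U A B : Matrix ι ι ℝ) :
    frobInner (U * A) B = frobInner A (U.transpose * B) := by
  rw [frobInner_eq_trace, frobInner_eq_trace, Matrix.transpose_mul, Matrix.mul_assoc]

theorem frobInner_mul_right [DecidableEq ι] (U A B : Matrix ι ι ℝ) :
    frobInner (A * U) B = frobInner A (B * U.transpose) := by
  rw [← frobInner_transpose, Matrix.transpose_mul, frobInner_mul_left, ← frobInner_transpose A,
    Matrix.transpose_mul, Matrix.transpose_transpose]

theorem frobInner_skew_symm {A B : Matrix ι ι ℝ} (hA : A.transpose = -A) (hB : B.transpose = B) :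
    frobInner A B = 0 := by
  have h := frobInner_transpose A B
  rw [hA, hB, ← neg_one_smul ℝ, frobInner_smul_left] at h
  linarith

theorem frobInner_skew_transpose {A : Matrix ι ι ℝ} (hA : A.transpose = -A) (B : Matrix ι ι ℝ) :
    frobInner A B.transpose = -frobInner A B := by
  have h := frobInner_transpose A B
  rw [hA, ← neg_one_smul ℝ, frobInner_smul_left] at h
  linarith

end

theorem RotGroup.mul_transpose {e : ℕ} (X : RotGroup e) :
    (X : Matrix (Fin 2 ⊕ Fin e) (Fin 2 ⊕ Fin e) ℝ) * (X : Matrix _ _ ℝ).transpose = 1 := by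
  have := (Matrix.mem_specialOrthogonalGroup_iff.1 X.2).1
  exact (Matrix.mem_orthogonalGroup_iff _ _).1 this

theorem RotGroup.transpose_mul {e : ℕ} (X : RotGroup e) :
    (X : Matrix (Fin 2 ⊕ Fin e) (Fin 2 ⊕ Fin e) ℝ).transpose * (X : Matrix _ _ ℝ) = 1 :=
  _root_.mul_eq_one_comm.1 X.mul_transpose

section
variable {ι : Type*} [Fintype ι] [DecidableEq ι] {U : Matrix ι ι ℝ}

theorem frobNorm_mul_orthogonal (hU : U * U.transpose = 1) (A : Matrix ι ι ℝ) :
    frobNorm (A * U) = frobNorm A := by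
  rw [frobNorm, frobInner_mul_right, Matrix.mul_assoc, hU, Matrix.mul_one, frobNorm]

theorem frobNorm_orthogonal_mul (hU : U.transpose * U = 1) (A : Matrix ι ι ℝ) :
    frobNorm (U * A) = frobNorm A := by
  rw [frobNorm, frobInner_mul_left, ← Matrix.mul_assoc, hU, Matrix.one_mul, frobNorm]

end

/-! ### Powers of the twist rotation and the block form of the linearization. -/

section
variable {n : ℕ} [NeZero n]

/-- The rotation by the angle `2 π k / n` in the first coordinate plane. -/
noncomputable def zrot (e : ℕ) (k : ZMod n) : Matrix (Fin 2 ⊕ Fin e) (Fin 2 ⊕ Fin e) ℝ :=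
  Matrix.fromBlocks !![zcos k, -zsin k; zsin k, zcos k] 0 0 1

theorem singleRotationMatrix_mul (e : ℕ) (θ φ : ℝ) :
    singleRotationMatrix e θ * singleRotationMatrix e φ = singleRotationMatrix e (θ + φ) := by
  rw [singleRotationMatrix, singleRotationMatrix, singleRotationMatrix, Matrix.fromBlocks_multiply]
  congr 1
  · rw [Real.cos_add, Real.sin_add]
    ext p q
    fin_cases p <;> fin_cases q <;> simp <;> ring
  all_goals simp

theorem singleRotationMatrix_zero (e : ℕ) : singleRotationMatrix e 0 = 1 := by
  rw [singleRotationMatrix, Real.cos_zero, Real.sin_zero, neg_zero, ← Matrix.one_fin_two,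
    Matrix.fromBlocks_one]

theorem singleRotationMatrix_transpose (e : ℕ) (θ : ℝ) :
    (singleRotationMatrix e θ).transpose = singleRotationMatrix e (-θ) := by
  rw [singleRotationMatrix, singleRotationMatrix, Matrix.fromBlocks_transpose, Real.cos_neg,
    Real.sin_neg, neg_neg]
  congr 1
  · ext p q
    fin_cases p <;> fin_cases q <;> simp
  all_goals simp

theorem singleRotation_pow (e : ℕ) (θ : ℝ) (k : ℕ) :
    singleRotation e θ ^ k = singleRotation e (k * θ) := by
  apply Subtype.ext
  induction k with
  | zero => simp [singleRotation, singleRotationMatrix_zero]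
  | succ k ih =>
    rw [pow_succ, Submonoid.coe_mul, ih]
    simp only [singleRotation, singleRotationMatrix_mul]
    push_cast
    rw [add_mul, one_mul]

theorem zrot_intCast (e : ℕ) (j : ℤ) :
    zrot e (j : ZMod n) = singleRotationMatrix e (j * (2 * Real.pi / n)) := by
  rw [zrot, zcos_intCast, zsin_intCast, singleRotationMatrix]

theorem coe_oneTwist (e : ℕ) (i : ZMod n) :
    (oneTwist n e i : Matrix (Fin 2 ⊕ Fin e) (Fin 2 ⊕ Fin e) ℝ) = zrot e i := by
  rw [oneTwist, singleRotation_pow]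
  have h := zrot_intCast (n := n) e (i.val : ℤ)
  rw [Int.cast_natCast, ZMod.natCast_zmod_val] at h
  rw [h]
  rfl

theorem zrot_add (e : ℕ) (k l : ZMod n) : zrot e (k + l) = zrot e k * zrot e l := by
  rw [← ZMod.coe_valMinAbs k, ← ZMod.coe_valMinAbs l, ← Int.cast_add, zrot_intCast, zrot_intCast,
    zrot_intCast, singleRotationMatrix_mul, Int.cast_add, add_mul]

theorem zrot_transpose (e : ℕ) (k : ZMod n) : (zrot e k).transpose = zrot e (-k) := by
  rw [← ZMod.coe_valMinAbs k, ← Int.cast_neg, zrot_intCast, zrot_intCast,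
    singleRotationMatrix_transpose, Int.cast_neg, neg_mul]

theorem zrot_zero (e : ℕ) : zrot e (0 : ZMod n) = 1 := by
  rw [← Int.cast_zero, zrot_intCast, Int.cast_zero, zero_mul, singleRotationMatrix_zero]

theorem zrot_mul_transpose (e : ℕ) (k : ZMod n) : zrot e k * (zrot e k).transpose = 1 := by
  rw [zrot_transpose, ← zrot_add, add_neg_cancel, zrot_zero]

theorem zrot_transpose_mul (e : ℕ) (k : ZMod n) : (zrot e k).transpose * zrot e k = 1 := by
  rw [zrot_transpose, ← zrot_add, neg_add_cancel, zrot_zero]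

theorem mul_zrot_inl_zero {e : ℕ} (A : Matrix (Fin 2 ⊕ Fin e) (Fin 2 ⊕ Fin e) ℝ) (k : ZMod n) (p) :
    (A * zrot e k) p (.inl 0) = A p (.inl 0) * zcos k + A p (.inl 1) * zsin k := by
  simp [Matrix.mul_apply, Fintype.sum_sum_type, Fin.sum_univ_two, zrot]

theorem mul_zrot_inl_one {e : ℕ} (A : Matrix (Fin 2 ⊕ Fin e) (Fin 2 ⊕ Fin e) ℝ) (k : ZMod n) (p) :
    (A * zrot e k) p (.inl 1) = A p (.inl 1) * zcos k - A p (.inl 0) * zsin k := by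
  simp [Matrix.mul_apply, Fintype.sum_sum_type, Fin.sum_univ_two, zrot]
  ring

theorem mul_zrot_inr {e : ℕ} (A : Matrix (Fin 2 ⊕ Fin e) (Fin 2 ⊕ Fin e) ℝ) (k : ZMod n) (p r) :
    (A * zrot e k) p (.inr r) = A p (.inr r) := by
  simp [Matrix.mul_apply, Fintype.sum_sum_type, zrot, Matrix.one_apply]

theorem zrot_mul_inl_zero {e : ℕ} (A : Matrix (Fin 2 ⊕ Fin e) (Fin 2 ⊕ Fin e) ℝ) (k : ZMod n) (q) :
    (zrot e k * A) (.inl 0) q = zcos k * A (.inl 0) q - zsin k * A (.inl 1) q := by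
  simp [Matrix.mul_apply, Fintype.sum_sum_type, Fin.sum_univ_two, zrot]
  ring

theorem zrot_mul_inl_one {e : ℕ} (A : Matrix (Fin 2 ⊕ Fin e) (Fin 2 ⊕ Fin e) ℝ) (k : ZMod n) (q) :
    (zrot e k * A) (.inl 1) q = zsin k * A (.inl 0) q + zcos k * A (.inl 1) q := by
  simp [Matrix.mul_apply, Fintype.sum_sum_type, Fin.sum_univ_two, zrot]

theorem zrot_mul_inr {e : ℕ} (A : Matrix (Fin 2 ⊕ Fin e) (Fin 2 ⊕ Fin e) ℝ) (k : ZMod n) (r q) :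
    (zrot e k * A) (.inr r) q = A (.inr r) q := by
  simp [Matrix.mul_apply, Fintype.sum_sum_type, zrot, Matrix.one_apply]

/-- The mixed block of a matrix on `ℝ² ⊕ ℝᵉ`, its columns being read as complex numbers. -/
noncomputable def mixedEntry {e : ℕ} (A : Matrix (Fin 2 ⊕ Fin e) (Fin 2 ⊕ Fin e) ℝ) (r : Fin e) :
    ℂ := ⟨A (.inl 0) (.inr r), A (.inl 1) (.inr r)⟩

theorem skew_apply {ι : Type*} {A : Matrix ι ι ℝ} (hA : A.transpose = -A) (p q : ι) :
    A p q = -A q p := by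
  have := congrFun (congrFun hA q) p
  simpa using this

theorem skew_apply_self {ι : Type*} {A : Matrix ι ι ℝ} (hA : A.transpose = -A) (p : ι) :
    A p p = 0 := by
  linarith [skew_apply hA p p]

theorem frobInner_self_skew {e : ℕ} {A : Matrix (Fin 2 ⊕ Fin e) (Fin 2 ⊕ Fin e) ℝ}
    (hA : A.transpose = -A) : frobInner A A =
      2 * A (.inl 1) (.inl 0) ^ 2 + 2 * ∑ r, Complex.normSq (mixedEntry A r) +
        ∑ r, ∑ s, A (.inr r) (.inr s) ^ 2 := by
  simp only [frobInner, Fintype.sum_sum_type, Fin.sum_univ_two, mixedEntry, Complex.normSq_mk,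
    skew_apply_self hA (.inl _), skew_apply hA (.inr _) (.inl _),
    skew_apply hA (.inl 0) (.inl 1), Finset.sum_add_distrib, ← pow_two]
  simp only [neg_sq]
  ring

/-- The blocks decouple. `T^k` commutes with planar skew matrices and pairs with them through its
cosine. On the right it rotates only the lower left mixed block, on the left only the upper right
one; this gives the factors `1 + χ(-k)` and `1 + cos`. On the normal block it acts trivially. -/
theorem frobInner_linearization {e : ℕ} {A B : Matrix (Fin 2 ⊕ Fin e) (Fin 2 ⊕ Fin e) ℝ}
    (hA : A.transpose = -A) (hB : B.transpose = -B) (k : ZMod n) :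
    frobInner A (B * zrot e k - zrot e k * A) =
      2 * zcos k * (A (.inl 1) (.inl 0) * B (.inl 1) (.inl 0) - A (.inl 1) (.inl 0) ^ 2) +
      ∑ r, (((starRingEnd ℂ) (mixedEntry A r) * mixedEntry B r *
          (1 + ZMod.stdAddChar (-k))).re - (1 + zcos k) * Complex.normSq (mixedEntry A r)) +
      ∑ r, ∑ s, (A (.inr r) (.inr s) * B (.inr r) (.inr s) - A (.inr r) (.inr s) ^ 2) := by
  have e1 : (ZMod.stdAddChar (-k) : ℂ).re = zcos k := zcos_neg k
  have e2 : (ZMod.stdAddChar (-k) : ℂ).im = -zsin k := zsin_neg k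
  simp only [frobInner, Fintype.sum_sum_type, Fin.sum_univ_two, Matrix.sub_apply,
    mul_zrot_inl_zero, mul_zrot_inl_one, mul_zrot_inr, zrot_mul_inl_zero, zrot_mul_inl_one,
    zrot_mul_inr, Finset.sum_add_distrib]
  have h3 : ∀ r, (((starRingEnd ℂ) (mixedEntry A r) * mixedEntry B r *
          (1 + ZMod.stdAddChar (-k))).re - (1 + zcos k) * Complex.normSq (mixedEntry A r)) =
      A (.inl 0) (.inr r) * (B (.inl 0) (.inr r) -
        (zcos k * A (.inl 0) (.inr r) - zsin k * A (.inl 1) (.inr r))) +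
      A (.inl 1) (.inr r) * (B (.inl 1) (.inr r) -
        (zsin k * A (.inl 0) (.inr r) + zcos k * A (.inl 1) (.inr r))) +
      (A (.inr r) (.inl 0) * (B (.inr r) (.inl 0) * zcos k + B (.inr r) (.inl 1) * zsin k -
        A (.inr r) (.inl 0)) +
      A (.inr r) (.inl 1) * (B (.inr r) (.inl 1) * zcos k - B (.inr r) (.inl 0) * zsin k -
        A (.inr r) (.inl 1))) := by
    intro r
    simp only [mixedEntry, Complex.mul_re, Complex.mul_im, Complex.add_re, Complex.add_im,
      Complex.conj_re, Complex.conj_im, Complex.one_re, Complex.one_im, e1, e2, Complex.normSq_mk,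
      skew_apply hA (.inr _) (.inl _), skew_apply hB (.inr _) (.inl _)]
    ring
  simp only [h3, Finset.sum_add_distrib, skew_apply_self hA (.inl _), skew_apply_self hB (.inl _),
    skew_apply hA (.inl 0) (.inl 1), skew_apply hB (.inl 0) (.inl 1)]
  have h4 : ∀ x y : ℝ, x * (y - x) = x * y - x ^ 2 := fun x y => by ring
  simp only [h4 (A (.inr _) (.inr _))]
  ring

theorem sum_sum_mul_sum_comm {κ : Type*} [Fintype κ] (w : ZMod n → ℝ)
    (f : ZMod n → ZMod n → κ → ℝ) :
    ∑ i, ∑ k, w k * ∑ r, f i k r = ∑ r, ∑ i, ∑ k, w k * f i k r := by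
  simp only [Finset.mul_sum]
  rw [Finset.sum_comm (s := (Finset.univ : Finset κ))]
  exact Finset.sum_congr rfl fun i _ => Finset.sum_comm

/-- The two sum conditions express orthogonality to left and to right translations. They remove mode
`0` from all blocks and mode `1` from the mixed block. -/
theorem SpectrallyStable.exists_matrix_gap {w : ZMod n → ℝ} (hw : SpectrallyStable w) :
    ∃ c > 0, ∀ (e : ℕ) (A : ZMod n → Matrix (Fin 2 ⊕ Fin e) (Fin 2 ⊕ Fin e) ℝ),
      (∀ i, (A i).transpose = -A i) → ∑ i, A i = 0 →
      ∑ i, (zrot e i).transpose * A i * zrot e i = 0 →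
      ∑ i, ∑ k, w k * frobInner (A i) (A (i + k) * zrot e k - zrot e k * A i) ≤
        -c * ∑ i, frobInner (A i) (A i) := by
  obtain ⟨c, hc, h1, h2, h3⟩ := hw.exists_gap
  -- The Frobenius norm counts planar and mixed entries twice, their quadratic forms once; hence
  -- half of the scalar gap.
  refine ⟨c / 2, by positivity, fun e A hA hl hr => ?_⟩
  have hl' : ∀ p q, ∑ i, A i p q = 0 := fun p q => by
    have := congrFun (congrFun hl p) q
    rwa [Matrix.sum_apply] at this
  have hr' : ∀ p q, ∑ i, ((zrot e i).transpose * A i * zrot e i) p q = 0 := fun p q => by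
    have := congrFun (congrFun hr p) q
    rwa [Matrix.sum_apply] at this
  have k1 := h1 (fun i => A i (.inl 1) (.inl 0)) (hl' _ _)
  have k2 : ∀ r, _ := fun r => h2 (fun i => mixedEntry (A i) r)
    (by
      apply Complex.ext
      · rw [Complex.re_sum]; exact hl' _ _
      · rw [Complex.im_sum]; exact hl' _ _)
    (by
      -- On normal columns the right factor `T^i` does nothing, and the left factor `T^(-i)`
      -- multiplies the complex entry by `χ(-i)`: this is Fourier mode `1`.
      have a1 := hr' (.inl 0) (.inr r)
      have a2 := hr' (.inl 1) (.inr r)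
      simp only [mul_zrot_inr, zrot_transpose, zrot_mul_inl_zero, zrot_mul_inl_one] at a1 a2
      apply Complex.ext
      · rw [Complex.re_sum]; exact a1
      · rw [Complex.im_sum]
        simp only [Complex.mul_im]
        refine Eq.trans (Finset.sum_congr rfl fun i _ => ?_) a2
        exact add_comm _ _)
  have k3 : ∀ r s, _ := fun r s => h3 (fun i => A i (.inr r) (.inr s)) (hl' _ _)
  have k2' := Finset.sum_le_sum fun r (_ : r ∈ Finset.univ) => k2 r
  have k3' := Finset.sum_le_sum fun r (_ : r ∈ Finset.univ) =>
    Finset.sum_le_sum fun s (_ : s ∈ Finset.univ) => k3 r s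
  have hb : 0 ≤ ∑ r, ∑ s, ∑ i, A i (.inr r) (.inr s) ^ 2 := by positivity
  have ha : 0 ≤ ∑ i, A i (.inl 1) (.inl 0) ^ 2 := by positivity
  have e1 : ∑ i, frobInner (A i) (A i) = 2 * ∑ i, A i (.inl 1) (.inl 0) ^ 2 +
      2 * ∑ r, ∑ i, Complex.normSq (mixedEntry (A i) r) +
      ∑ r, ∑ s, ∑ i, A i (.inr r) (.inr s) ^ 2 := by
    simp only [frobInner_self_skew (hA _), Finset.sum_add_distrib, ← Finset.mul_sum]
    rw [Finset.sum_comm (f := fun i r => Complex.normSq (mixedEntry (A i) r)),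
      Finset.sum_comm (f := fun i r => ∑ s, A i (.inr r) (.inr s) ^ 2)]
    congr 1
    exact Finset.sum_congr rfl fun r _ => Finset.sum_comm
  rw [e1]
  simp only [frobInner_linearization (hA _) (hA _), mul_add, Finset.sum_add_distrib,
    sum_sum_mul_sum_comm]
  simp only [mul_add, ← Finset.mul_sum] at k2' k3'
  linarith [mul_nonneg hc.le hb]

end


/-! ### Rotations to first and second order near the identity. -/

section
variable {ι : Type*} [Fintype ι] [DecidableEq ι]

/-- The rotation by the angle `s` in the plane spanned by two coordinate vectors. -/
noncomputable def coordRotation (p q : ι) (s : ℝ) : Matrix ι ι ℝ :=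
  1 + (Real.cos s - 1) • (Matrix.single p p 1 + Matrix.single q q 1) +
    Real.sin s • (Matrix.single q p 1 - Matrix.single p q 1)

theorem coordRotation_mul {p q : ι} (hpq : p ≠ q) (s t : ℝ) :
    coordRotation p q s * coordRotation p q t = coordRotation p q (s + t) := by
  set P : Matrix ι ι ℝ := Matrix.single p p 1 + Matrix.single q q 1 with hP
  set J : Matrix ι ι ℝ := Matrix.single q p 1 - Matrix.single p q 1 with hJ
  have h1 : P * P = P := by
    simp [hP, mul_add, add_mul, Matrix.single_mul_single_of_ne, hpq, hpq.symm]
  have h2 : P * J = J := by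
    simp [hP, hJ, mul_sub, add_mul, Matrix.single_mul_single_of_ne, hpq, hpq.symm]
  have h3 : J * P = J := by
    simp [hP, hJ, mul_add, sub_mul, Matrix.single_mul_single_of_ne, hpq, hpq.symm]
    abel
  have h4 : J * J = -P := by
    simp [hP, hJ, mul_sub, sub_mul, Matrix.single_mul_single_of_ne, hpq, hpq.symm]
    abel
  simp only [coordRotation, ← hP, ← hJ, mul_add, add_mul, mul_one, one_mul, Matrix.smul_mul,
    Matrix.mul_smul, h1, h2, h3, h4, Real.cos_add, Real.sin_add]
  module

omit [Fintype ι] in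
theorem coordRotation_zero (p q : ι) : coordRotation p q 0 = 1 := by
  simp [coordRotation]

omit [Fintype ι] in
theorem coordRotation_transpose (p q : ι) (s : ℝ) :
    (coordRotation p q s).transpose = coordRotation p q (-s) := by
  simp only [coordRotation, Matrix.transpose_add, Matrix.transpose_one, Matrix.transpose_smul,
    Matrix.transpose_sub, Matrix.transpose_single, Real.cos_neg, Real.sin_neg]
  module

theorem coordRotation_mem {p q : ι} (hpq : p ≠ q) (s : ℝ) :
    coordRotation p q s ∈ Matrix.specialOrthogonalGroup ι ℝ := by
  have orth : ∀ s, coordRotation p q s * (coordRotation p q s).transpose = 1 := fun s => by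
    rw [coordRotation_transpose, coordRotation_mul hpq, add_neg_cancel, coordRotation_zero]
  rw [Matrix.mem_specialOrthogonalGroup_iff, Matrix.mem_orthogonalGroup_iff]
  refine ⟨orth s, ?_⟩
  -- Orthogonality gives only `det² = 1`, but the rotation by `s` is the square of the rotation by
  -- `s/2`.
  have h1 := congrArg Matrix.det (orth (s / 2))
  rw [Matrix.det_mul, Matrix.det_transpose, Matrix.det_one] at h1
  rw [← h1, ← Matrix.det_mul, coordRotation_mul hpq, add_halves]

theorem eq_zero_of_cos_sin_le {a b : ℝ} (h : ∀ s : ℝ, (Real.cos s - 1) * a + Real.sin s * b ≤ 0) :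
    b = 0 := by
  have hd : HasDerivAt (fun s : ℝ => (Real.cos s - 1) * a + Real.sin s * b) b 0 := by
    refine ((((Real.hasDerivAt_cos 0).sub_const 1).mul_const a).add
      ((Real.hasDerivAt_sin 0).mul_const b)).congr_deriv ?_
    simp
  have hm : IsLocalMax (fun s : ℝ => (Real.cos s - 1) * a + Real.sin s * b) 0 :=
    Filter.Eventually.of_forall fun s => by simpa using h s
  exact hm.hasDerivAt_eq_zero hd

theorem frobInner_single (M : Matrix ι ι ℝ) (p q : ι) :
    frobInner M (Matrix.single p q 1) = M p q := by
  rw [frobInner, Finset.sum_eq_single p, Finset.sum_eq_single q] <;>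
    simp +contextual [Matrix.single_apply, eq_comm]

/-- A matrix whose trace pairing with rotations is maximal at the identity is symmetric. -/
theorem transpose_eq_of_forall_frobInner_le {M : Matrix ι ι ℝ}
    (h : ∀ S ∈ Matrix.specialOrthogonalGroup ι ℝ, frobInner M S ≤ frobInner M 1) :
    M.transpose = M := by
  ext q p
  rw [Matrix.transpose_apply]
  by_cases hpq : p = q
  · rw [hpq]
  have := eq_zero_of_cos_sin_le (a := M p p + M q q) (b := M q p - M p q) fun s => by
    have := h _ (coordRotation_mem hpq s)
    rw [coordRotation, frobInner_add_right, frobInner_add_right, frobInner_smul_right,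
      frobInner_smul_right, frobInner_add_right, frobInner_sub_right] at this
    simp only [frobInner_single] at this
    linarith
  linarith

/-- The skew part of a matrix. -/
noncomputable def skewPart (Y : Matrix ι ι ℝ) : Matrix ι ι ℝ := (1 / 2 : ℝ) • (Y - Y.transpose)

omit [Fintype ι] [DecidableEq ι] in
theorem skewPart_transpose (Y : Matrix ι ι ℝ) : (skewPart Y).transpose = -skewPart Y := by
  simp only [skewPart, Matrix.transpose_smul, Matrix.transpose_sub, Matrix.transpose_transpose]
  module

/-- Since `(Y-1)(Y-1)ᵀ = 2 - Y - Yᵀ`, the symmetric part of `Y - 1` is quadratically small. The skew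
part therefore serves as a local coordinate, and no matrix logarithm is needed. -/
theorem skewPart_sub_eq {Y : Matrix ι ι ℝ} (hY : Y * Y.transpose = 1) :
    Y - 1 = skewPart Y - (1 / 2 : ℝ) • ((Y - 1) * (Y - 1).transpose) := by
  rw [Matrix.transpose_sub, Matrix.transpose_one, mul_sub, sub_mul, hY, skewPart]
  simp only [mul_one, one_mul]
  module

theorem frobNorm_sq_sub_one {Y : Matrix ι ι ℝ} (hY : Y * Y.transpose = 1) :
    frobNorm (Y - 1) ^ 2 = frobNorm (skewPart Y) ^ 2 +
      frobNorm ((1 / 2 : ℝ) • ((Y - 1) * (Y - 1).transpose)) ^ 2 := by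
  set Q := (1 / 2 : ℝ) • ((Y - 1) * (Y - 1).transpose) with hQ
  have hQt : Q.transpose = Q := by
    rw [hQ, Matrix.transpose_smul, Matrix.transpose_mul, Matrix.transpose_transpose]
  have h := frobInner_skew_symm (skewPart_transpose Y) hQt
  rw [frobNorm_sq, skewPart_sub_eq hY, ← hQ, frobInner_sub_left, frobInner_sub_right,
    frobInner_sub_right, frobInner_comm Q, h, frobNorm_sq, frobNorm_sq]
  ring

omit [DecidableEq ι] in
theorem frobNorm_half_mul_transpose_le (W : Matrix ι ι ℝ) :
    frobNorm ((1 / 2 : ℝ) • (W * W.transpose)) ≤ 1 / 2 * frobNorm W ^ 2 := by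
  rw [frobNorm_smul, abs_of_pos (by norm_num)]
  have := frobNorm_mul_le W W.transpose
  rw [frobNorm_transpose] at this
  nlinarith

theorem frobNorm_skewPart_le {Y : Matrix ι ι ℝ} (hY : Y * Y.transpose = 1) :
    frobNorm (skewPart Y) ≤ frobNorm (Y - 1) := by
  have := frobNorm_sq_sub_one hY
  exact abs_le_of_sq_le_sq' (by nlinarith [sq_nonneg (frobNorm ((1 / 2 : ℝ) • ((Y - 1) * (Y - 1).transpose)))]) (frobNorm_nonneg _) |>.2

theorem le_frobInner_skewPart {Y : Matrix ι ι ℝ} (hY : Y * Y.transpose = 1) :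
    frobNorm (Y - 1) ^ 2 - 1 / 4 * (frobNorm (Y - 1) ^ 2) ^ 2 ≤
      frobInner (skewPart Y) (skewPart Y) := by
  have h1 := frobNorm_sq_sub_one hY
  have h2 := frobNorm_half_mul_transpose_le (Y - 1)
  have h3 := pow_le_pow_left₀ (frobNorm_nonneg _) h2 2
  rw [← frobNorm_sq]
  nlinarith

/-- With `W = Y - 1`, `W' = Y' - 1` and their quadratic symmetric parts `-Q`, `-Q'`, everything
beyond first order is `W' T Wᵀ - (Q' T + T Q)`, of norm at most `‖W'‖‖W‖ + (‖W‖² + ‖W'‖²)/2`. -/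
theorem frobInner_skewPart_expand_le {Y Y' T : Matrix ι ι ℝ} (hY : Y * Y.transpose = 1)
    (hY' : Y' * Y'.transpose = 1) (hT : T * T.transpose = 1) :
    frobInner (skewPart Y) (Y' * T * Y.transpose) ≤ frobInner (skewPart Y) T +
      frobInner (skewPart Y) (skewPart Y' * T - T * skewPart Y) +
      frobNorm (skewPart Y) * (frobNorm (Y - 1) ^ 2 + frobNorm (Y' - 1) ^ 2) := by
  set W := Y - 1 with hW
  set W' := Y' - 1 with hW'
  set Q := (1 / 2 : ℝ) • (W * W.transpose) with hQ
  set Q' := (1 / 2 : ℝ) • (W' * W'.transpose) with hQ'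
  have hT' : T.transpose * T = 1 := _root_.mul_eq_one_comm.1 hT
  have e1 : W = skewPart Y - Q := skewPart_sub_eq hY
  have e2 : W' = skewPart Y' - Q' := skewPart_sub_eq hY'
  have hQt : Q.transpose = Q := by
    rw [hQ, Matrix.transpose_smul, Matrix.transpose_mul, Matrix.transpose_transpose]
  have e3 : W.transpose = -skewPart Y - Q := by
    rw [e1, Matrix.transpose_sub, skewPart_transpose, hQt]
  have e4 : Y' * T * Y.transpose = T + (skewPart Y' * T - T * skewPart Y) +
      (W' * T * W.transpose - (Q' * T + T * Q)) := by
    have a1 : Y' = 1 + W' := by rw [hW']; abel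
    have a2 : Y.transpose = 1 + W.transpose := by
      rw [hW, Matrix.transpose_sub, Matrix.transpose_one]; abel
    have a3 : skewPart Y' = W' + Q' := by rw [e2]; abel
    have a4 : skewPart Y = -W.transpose - Q := by rw [e3]; abel
    rw [a3, a4, a2, a1]
    noncomm_ring
  have e5 : frobNorm (W' * T * W.transpose - (Q' * T + T * Q)) ≤
      frobNorm W ^ 2 + frobNorm W' ^ 2 := by
    have b1 := frobNorm_sub_le (W' * T * W.transpose) (Q' * T + T * Q)
    have b2 := frobNorm_add_le (Q' * T) (T * Q)
    have b3 := frobNorm_mul_le (W' * T) W.transpose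
    rw [frobNorm_mul_orthogonal hT, frobNorm_transpose] at b3
    rw [frobNorm_mul_orthogonal hT, frobNorm_orthogonal_mul hT'] at b2
    have b4 : frobNorm Q ≤ _ := frobNorm_half_mul_transpose_le W
    have b5 : frobNorm Q' ≤ _ := frobNorm_half_mul_transpose_le W'
    nlinarith [sq_nonneg (frobNorm W - frobNorm W')]
  rw [e4, frobInner_add_right, frobInner_add_right]
  have := frobInner_le (skewPart Y) (W' * T * W.transpose - (Q' * T + T * Q))
  have := mul_le_mul_of_nonneg_left e5 (frobNorm_nonneg (skewPart Y))
  linarith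

end

/-! ### The rate of change of the distance to the twist. -/

section
variable {n e : ℕ} [NeZero n]

theorem qkCoupling_eq (γ : ZMod n → ZMod n → ℝ) (X : Config n e) (i : ZMod n) :
    qkCoupling γ X i = ∑ j, γ i j • skewPart ((X j).1 *
      (X i).1.transpose) := by
  rw [qkCoupling, Finset.smul_sum]
  refine Finset.sum_congr rfl fun j _ => ?_
  rw [smul_comm, skewPart, Matrix.transpose_mul, Matrix.transpose_transpose]
  rfl

theorem qkCoupling_transpose (γ : ZMod n → ZMod n → ℝ) (X : Config n e) (i : ZMod n) :
    (qkCoupling γ X i).transpose = -qkCoupling γ X i := by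
  rw [qkCoupling_eq, Matrix.transpose_sum, ← Finset.sum_neg_distrib]
  refine Finset.sum_congr rfl fun j _ => ?_
  rw [Matrix.transpose_smul, skewPart_transpose, smul_neg]

theorem frobInner_skewPart {ι : Type*} [Fintype ι] {A : Matrix ι ι ℝ} (hA : A.transpose = -A)
    (B : Matrix ι ι ℝ) : frobInner A (skewPart B) = frobInner A B := by
  rw [skewPart, frobInner_smul_right, frobInner_sub_right, frobInner_skew_transpose hA]
  ring

/-- The squared Frobenius distance of two configurations. -/
noncomputable def sqDist (X Z : Config n e) : ℝ :=
  ∑ i, frobInner ((X i).1 - (Z i).1)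
    ((X i).1 - (Z i).1)

/-- The configuration relative to the `1`-twist. -/
noncomputable def relTwist (X : Config n e) (i : ZMod n) :
    Matrix (Fin 2 ⊕ Fin e) (Fin 2 ⊕ Fin e) ℝ :=
  (X i).1 * (zrot e i).transpose

theorem relTwist_mul_zrot (X : Config n e) (i : ZMod n) : relTwist X i * zrot e i = (X i).1 := by
  rw [relTwist, Matrix.mul_assoc, zrot_transpose_mul, Matrix.mul_one]

theorem relTwist_mul_transpose (X : Config n e) (i : ZMod n) :
    relTwist X i * (relTwist X i).transpose = 1 := by
  rw [relTwist, Matrix.transpose_mul, Matrix.transpose_transpose, Matrix.mul_assoc,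
    ← Matrix.mul_assoc _ (zrot e i), zrot_transpose_mul, Matrix.one_mul, RotGroup.mul_transpose]

theorem frobNorm_relTwist_sub_one_sq (X : Config n e) (i : ZMod n) :
    frobNorm (relTwist X i - 1) ^ 2 =
      frobInner ((X i).1 - (oneTwist n e i).1)
        ((X i).1 - (oneTwist n e i).1) := by
  rw [← frobNorm_mul_orthogonal (zrot_mul_transpose e i), Matrix.sub_mul, relTwist_mul_zrot,
    Matrix.one_mul, frobNorm_sq, coe_oneTwist]

theorem sqDist_oneTwist (X : Config n e) :
    sqDist X (oneTwist n e) = ∑ i, frobNorm (relTwist X i - 1) ^ 2 := by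
  simp only [sqDist, frobNorm_relTwist_sub_one_sq]

theorem frobNorm_relTwist_le (X : Config n e) (i : ZMod n) :
    frobNorm (relTwist X i - 1) ^ 2 ≤ sqDist X (oneTwist n e) := by
  rw [sqDist_oneTwist]
  exact Finset.single_le_sum (f := fun i => frobNorm (relTwist X i - 1) ^ 2)
    (fun _ _ => sq_nonneg _) (Finset.mem_univ i)

theorem coe_mul_transpose_eq (X : Config n e) (i j : ZMod n) :
    (X j).1 * (X i).1.transpose =
      relTwist X j * zrot e (j - i) * (relTwist X i).transpose := by
  rw [sub_eq_add_neg, zrot_add, ← zrot_transpose, ← Matrix.mul_assoc, relTwist_mul_zrot,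
    Matrix.mul_assoc, ← Matrix.transpose_mul, relTwist_mul_zrot]

/-- The coupling `F` is skew, so `⟨X_i, F X_i⟩ = ⟨1, F⟩ = 0`. What remains is `-⟨T^i X_iᵀ, F⟩ =
⟨Y_i, F⟩`, which sees only the skew part of `Y_i`. -/
theorem frobInner_sub_twist_coupling (γ : ZMod n → ZMod n → ℝ) (X : Config n e) (i : ZMod n) :
    frobInner ((X i).1 - (oneTwist n e i).1)
      (qkCoupling γ X i * (X i).1) =
    ∑ j, γ i j * frobInner (skewPart (relTwist X i))
      (relTwist X j * zrot e (j - i) * (relTwist X i).transpose) := by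
  have hF := qkCoupling_transpose γ X i
  have h1 : frobInner ((X i).1 - (oneTwist n e i).1)
      (qkCoupling γ X i * (X i).1) = frobInner (skewPart (relTwist X i)) (qkCoupling γ X i) := by
    rw [frobInner_comm, frobInner_comm _ (qkCoupling γ X i), frobInner_skewPart hF,
      frobInner_mul_right, Matrix.sub_mul, RotGroup.mul_transpose, frobInner_sub_right,
      frobInner_skew_symm hF Matrix.transpose_one, coe_oneTwist, zero_sub,
      ← frobInner_skew_transpose hF, Matrix.transpose_mul, Matrix.transpose_transpose, relTwist]
  rw [h1, qkCoupling_eq, frobInner_sum_right]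
  refine Finset.sum_congr rfl fun j _ => ?_
  rw [frobInner_smul_right, frobInner_skewPart (skewPart_transpose _), coe_mul_transpose_eq]

/-- This removes the zeroth order term: the contributions of `T^k` and `T^(-k)` cancel, which is why
the twist is an equilibrium. -/
theorem sum_even_mul_frobInner_zrot {w : ZMod n → ℝ} (hw : ∀ k, w (-k) = w k)
    {A : Matrix (Fin 2 ⊕ Fin e) (Fin 2 ⊕ Fin e) ℝ} (hA : A.transpose = -A) :
    ∑ k, w k * frobInner A (zrot e k) = 0 := by
  have h := Equiv.sum_comp (Equiv.neg (ZMod n)) fun k => w k * frobInner A (zrot e k)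
  simp only [Equiv.neg_apply, hw, ← zrot_transpose, frobInner_skew_transpose hA, mul_neg,
    Finset.sum_neg_distrib] at h
  linarith

theorem sum_weight_sub {w : ZMod n → ℝ} (hw : ∀ k, w (-k) = w k) (i : ZMod n) (f : ZMod n → ℝ) :
    ∑ j, w (i - j) * f j = ∑ k, w k * f (i + k) := by
  rw [← Equiv.sum_comp (Equiv.addLeft i)]
  refine Finset.sum_congr rfl fun k _ => ?_
  rw [Equiv.coe_addLeft, show i - (i + k) = -k by ring, hw]

/-- The linearized form plus an error of third order in the distance. Bounding every `‖Y_i - 1‖` by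
the total distance costs the harmless factor `n`. -/
theorem sum_frobInner_coupling_le {w : ZMod n → ℝ} (hw : ∀ k, w (-k) = w k) (hw0 : ∀ k, 0 ≤ w k)
    (X : Config n e) :
    ∑ i, frobInner ((X i).1 - (oneTwist n e i).1)
      (qkCoupling (fun i j => w (i - j)) X i * (X i).1) ≤
    ∑ i, ∑ k, w k * frobInner (skewPart (relTwist X i))
      (skewPart (relTwist X (i + k)) * zrot e k - zrot e k * skewPart (relTwist X i)) +
    2 * n * (∑ k, w k) * Real.sqrt (sqDist X (oneTwist n e)) * sqDist X (oneTwist n e) := by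
  set D := sqDist X (oneTwist n e) with hD
  have hW : ∀ i, frobNorm (relTwist X i - 1) ^ 2 ≤ D := frobNorm_relTwist_le X
  have hA : ∀ i, frobNorm (skewPart (relTwist X i)) ≤ Real.sqrt D := fun i =>
    (frobNorm_skewPart_le (relTwist_mul_transpose X i)).trans (Real.le_sqrt_of_sq_le (hW i))
  have hD0 : 0 ≤ D := (sq_nonneg _).trans (hW 0)
  have key : ∀ i k, w k * frobInner (skewPart (relTwist X i))
      (relTwist X (i + k) * zrot e k * (relTwist X i).transpose) ≤
      w k * frobInner (skewPart (relTwist X i)) (zrot e k) +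
      w k * frobInner (skewPart (relTwist X i))
        (skewPart (relTwist X (i + k)) * zrot e k - zrot e k * skewPart (relTwist X i)) +
      w k * (2 * Real.sqrt D * D) := by
    intro i k
    rw [← mul_add, ← mul_add]
    refine mul_le_mul_of_nonneg_left ?_ (hw0 k)
    refine (frobInner_skewPart_expand_le (relTwist_mul_transpose X i)
      (relTwist_mul_transpose X (i + k)) (zrot_mul_transpose e k)).trans ?_
    refine add_le_add le_rfl ?_
    have := mul_le_mul (hA i) (add_le_add (hW i) (hW (i + k))) (by positivity) (Real.sqrt_nonneg D)
    linarith
  have h1 : ∀ i, frobInner ((X i).1 - (oneTwist n e i).1)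
      (qkCoupling (fun i j => w (i - j)) X i * (X i).1) =
      ∑ k, w k * frobInner (skewPart (relTwist X i))
        (relTwist X (i + k) * zrot e k * (relTwist X i).transpose) := by
    intro i
    rw [frobInner_sub_twist_coupling, sum_weight_sub hw]
    simp only [add_sub_cancel_left]
  simp only [h1]
  refine (Finset.sum_le_sum fun i _ => Finset.sum_le_sum fun k _ => key i k).trans_eq ?_
  simp only [Finset.sum_add_distrib, sum_even_mul_frobInner_zrot hw (skewPart_transpose _),
    zero_add, ← Finset.sum_mul, Finset.sum_const, Finset.card_univ,
    ZMod.card, nsmul_eq_mul]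
  ring

end


/-! ### Translation symmetry and contraction towards the nearest twist. -/

section
variable {n e : ℕ} [NeZero n]

/-- Left and right translation of a configuration. -/
noncomputable def biTranslate (S R : RotGroup e) (X : Config n e) : Config n e :=
  fun i => S * X i * R

omit [NeZero n] in
theorem coe_biTranslate (S R : RotGroup e) (X : Config n e) (i : ZMod n) :
    (biTranslate S R X i).1 = S.1 * (X i).1 * R.1 := rfl

omit [NeZero n] in
theorem biTranslate_biTranslate (S S' R R' : RotGroup e) (X : Config n e) :
    biTranslate S R (biTranslate S' R' X) = biTranslate (S * S') (R' * R) X := by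
  funext i
  simp only [biTranslate, mul_assoc]

omit [NeZero n] in
theorem biTranslate_one (X : Config n e) : biTranslate 1 1 X = X := by
  funext i
  simp only [biTranslate, mul_one, one_mul]

theorem frobInner_orthogonal_conj {ι : Type*} [Fintype ι] [DecidableEq ι] {S R : Matrix ι ι ℝ}
    (hS : S.transpose * S = 1) (hR : R * R.transpose = 1) (A B : Matrix ι ι ℝ) :
    frobInner (S * A * R) (S * B * R) = frobInner A B := by
  rw [frobInner_mul_right, Matrix.mul_assoc, hR, Matrix.mul_one, frobInner_mul_left,
    ← Matrix.mul_assoc, hS, Matrix.one_mul]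

theorem sqDist_biTranslate (S R : RotGroup e) (X Z : Config n e) :
    sqDist (biTranslate S R X) (biTranslate S R Z) = sqDist X Z := by
  refine Finset.sum_congr rfl fun i _ => ?_
  rw [coe_biTranslate, coe_biTranslate, ← Matrix.sub_mul, ← Matrix.mul_sub,
    frobInner_orthogonal_conj S.transpose_mul R.mul_transpose]

theorem skewPart_conj {ι : Type*} [Fintype ι] (S A : Matrix ι ι ℝ) :
    skewPart (S * A * S.transpose) = S * skewPart A * S.transpose := by
  rw [skewPart, skewPart, Matrix.transpose_mul, Matrix.transpose_mul, Matrix.transpose_transpose,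
    Matrix.mul_smul, Matrix.smul_mul, Matrix.mul_sub, Matrix.sub_mul, Matrix.mul_assoc S A.transpose]

theorem qkCoupling_biTranslate (γ : ZMod n → ZMod n → ℝ) (S R : RotGroup e) (X : Config n e)
    (i : ZMod n) :
    qkCoupling γ (biTranslate S R X) i = S.1 * qkCoupling γ X i * S.1.transpose := by
  rw [qkCoupling_eq, qkCoupling_eq, Finset.mul_sum, Finset.sum_mul]
  refine Finset.sum_congr rfl fun j _ => ?_
  rw [Matrix.mul_smul, Matrix.smul_mul, ← skewPart_conj, coe_biTranslate, coe_biTranslate]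
  have h : S.1 * (X j).1 * R.1 * (S.1 * (X i).1 * R.1).transpose =
      S.1 * ((X j).1 * (X i).1.transpose) * S.1.transpose := by
    rw [Matrix.transpose_mul, Matrix.mul_assoc, ← Matrix.mul_assoc R.1, R.mul_transpose,
      Matrix.one_mul, Matrix.transpose_mul]
    simp only [Matrix.mul_assoc]
  rw [h]

/-- Half the rate of change of `sqDist X Z` along the flow. -/
noncomputable def approachRate (γ : ZMod n → ZMod n → ℝ) (X Z : Config n e) : ℝ :=
  ∑ i, frobInner ((X i).1 - (Z i).1) (qkCoupling γ X i * (X i).1)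

theorem approachRate_biTranslate (γ : ZMod n → ZMod n → ℝ) (S R : RotGroup e) (X Z : Config n e) :
    approachRate γ (biTranslate S R X) (biTranslate S R Z) = approachRate γ X Z := by
  refine Finset.sum_congr rfl fun i _ => ?_
  rw [qkCoupling_biTranslate, coe_biTranslate, coe_biTranslate, ← Matrix.sub_mul, ← Matrix.mul_sub]
  have h : S.1 * qkCoupling γ X i * S.1.transpose * (S.1 * (X i).1 * R.1) =
      S.1 * (qkCoupling γ X i * (X i).1) * R.1 := by
    simp only [Matrix.mul_assoc]
    rw [← Matrix.mul_assoc S.1.transpose, S.transpose_mul, Matrix.one_mul]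
  rw [h, frobInner_orthogonal_conj S.transpose_mul R.mul_transpose]

theorem frobInner_rotGroup_self (X Y : RotGroup e) :
    frobInner X.1 X.1 = frobInner Y.1 Y.1 := by
  rw [frobInner_eq_trace, frobInner_eq_trace, X.transpose_mul, Y.transpose_mul]

/-- All rotations have the same Frobenius norm, so a nearest twist is one of maximal pairing with
`X`, a condition linear in each translation. -/
theorem sqDist_eq (X Z : Config n e) :
    sqDist X Z = n * (2 * frobInner (1 : RotGroup e).1 (1 : RotGroup e).1) -
      2 * ∑ i, frobInner (X i).1 (Z i).1 := by
  have hc : (n : ℝ) * (2 * frobInner (1 : RotGroup e).1 (1 : RotGroup e).1) =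
      ∑ _i : ZMod n, 2 * frobInner (1 : RotGroup e).1 (1 : RotGroup e).1 := by
    rw [Finset.sum_const, Finset.card_univ, ZMod.card, nsmul_eq_mul]
  rw [Finset.mul_sum, hc, ← Finset.sum_sub_distrib]
  refine Finset.sum_congr rfl fun i _ => ?_
  rw [frobInner_sub_left, frobInner_sub_right, frobInner_sub_right, frobInner_comm (Z i).1 (X i).1,
    frobInner_rotGroup_self (X i) 1, frobInner_rotGroup_self (Z i) 1]
  ring

/-- First variation under left translations: `⟨∑ Y_i, S⟩` is maximal at `S = 1`, which makes `∑ Y_i`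
symmetric. -/
theorem sum_skewPart_relTwist {X : Config n e}
    (h : ∀ S R : RotGroup e, sqDist X (oneTwist n e) ≤ sqDist X (biTranslate S R (oneTwist n e))) :
    ∑ i, skewPart (relTwist X i) = 0 := by
  have hsym : (∑ i, relTwist X i).transpose = ∑ i, relTwist X i := by
    refine transpose_eq_of_forall_frobInner_le fun S hS => ?_
    have h1 := h ⟨S, hS⟩ 1
    have e1 : ∀ i, frobInner (X i).1 (oneTwist n e i).1 = frobInner (relTwist X i) 1 := fun i => by
      rw [coe_oneTwist, relTwist, frobInner_mul_right, Matrix.one_mul, Matrix.transpose_transpose]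
    have e2 : ∀ i, frobInner (X i).1 (biTranslate ⟨S, hS⟩ 1 (oneTwist n e) i).1 =
        frobInner (relTwist X i) S := fun i => by
      rw [coe_biTranslate, coe_oneTwist, relTwist, frobInner_mul_right, Matrix.transpose_transpose]
      simp
    rw [sqDist_eq, sqDist_eq] at h1
    simp only [e1, e2] at h1
    rw [frobInner_sum_left, frobInner_sum_left]
    linarith
  simp only [skewPart]
  rw [← Finset.smul_sum, Finset.sum_sub_distrib, ← Matrix.transpose_sum, hsym, sub_self, smul_zero]

/-- The same for right translations, with `T^(-i) X_i` in the place of `Y_i = X_i T^(-i)`. -/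
theorem sum_conj_skewPart_relTwist {X : Config n e}
    (h : ∀ S R : RotGroup e, sqDist X (oneTwist n e) ≤ sqDist X (biTranslate S R (oneTwist n e))) :
    ∑ i, (zrot e i).transpose * skewPart (relTwist X i) * zrot e i = 0 := by
  have e0 : ∀ i, (zrot e i).transpose * relTwist X i * zrot e i = (zrot e i).transpose * (X i).1 :=
    fun i => by rw [Matrix.mul_assoc, relTwist_mul_zrot]
  have hsym : (∑ i, (zrot e i).transpose * (X i).1).transpose =
      ∑ i, (zrot e i).transpose * (X i).1 := by
    refine transpose_eq_of_forall_frobInner_le fun R hR => ?_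
    have h1 := h 1 ⟨R, hR⟩
    have e1 : ∀ i, frobInner (X i).1 (oneTwist n e i).1 =
        frobInner ((zrot e i).transpose * (X i).1) 1 := fun i => by
      rw [coe_oneTwist, frobInner_mul_left, Matrix.mul_one, Matrix.transpose_transpose]
    have e2 : ∀ i, frobInner (X i).1 (biTranslate 1 ⟨R, hR⟩ (oneTwist n e) i).1 =
        frobInner ((zrot e i).transpose * (X i).1) R := fun i => by
      rw [coe_biTranslate, coe_oneTwist, frobInner_mul_left, Matrix.transpose_transpose]
      simp
    rw [sqDist_eq, sqDist_eq] at h1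
    simp only [e1, e2] at h1
    rw [frobInner_sum_left, frobInner_sum_left]
    linarith
  have e3 : ∀ i, (zrot e i).transpose * skewPart (relTwist X i) * zrot e i =
      (1 / 2 : ℝ) • ((zrot e i).transpose * (X i).1 -
        ((zrot e i).transpose * (X i).1).transpose) := fun i => by
    have := skewPart_conj (zrot e i).transpose (relTwist X i)
    rw [Matrix.transpose_transpose] at this
    rw [← this, e0, skewPart]
  simp only [e3]
  rw [← Finset.smul_sum, Finset.sum_sub_distrib, ← Matrix.transpose_sum, hsym, sub_self, smul_zero]

theorem sqDist_nonneg (X Z : Config n e) : 0 ≤ sqDist X Z :=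
  Finset.sum_nonneg fun _ _ => frobInner_self_nonneg _

theorem SpectrallyStable.exists_contraction_twist {w : ZMod n → ℝ} (hs : SpectrallyStable w)
    (hw : ∀ k, w (-k) = w k) (hw0 : ∀ k, 0 ≤ w k) :
    ∃ c > 0, ∃ ρ > 0, ∀ (e : ℕ) (X : Config n e),
      (∀ S R : RotGroup e, sqDist X (oneTwist n e) ≤ sqDist X (biTranslate S R (oneTwist n e))) →
      sqDist X (oneTwist n e) ≤ ρ →
      approachRate (fun i j => w (i - j)) X (oneTwist n e) ≤ -c * sqDist X (oneTwist n e) := by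
  obtain ⟨c, hc, hgap⟩ := hs.exists_matrix_gap
  set G := 2 * n * (∑ k, w k) with hG
  have hG0 : 0 ≤ G := by
    have := Finset.sum_nonneg fun k (_ : k ∈ Finset.univ) => hw0 k
    positivity
  -- For `D ≤ 1` the skew parts carry at least `3/4` of `D`, so the linear part contributes at most
  -- `-(3/4)cD`. The second bound on `D` limits the cubic error to `(c/4)D`.
  refine ⟨c / 2, by positivity, min 1 ((c / (4 * (G + 1))) ^ 2), by positivity,
    fun e X hmin hρ => ?_⟩
  set D := sqDist X (oneTwist n e) with hD
  have hD0 : 0 ≤ D := sqDist_nonneg _ _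
  have h1 := sum_frobInner_coupling_le hw hw0 X
  have h2 := hgap e (fun i => skewPart (relTwist X i)) (fun i => skewPart_transpose _)
    (sum_skewPart_relTwist hmin) (sum_conj_skewPart_relTwist hmin)
  have h3 : D - 1 / 4 * D ≤
      ∑ i, frobInner (skewPart (relTwist X i)) (skewPart (relTwist X i)) := by
    have : ∀ i ∈ Finset.univ, frobNorm (relTwist X i - 1) ^ 2 * (1 - 1 / 4) ≤
        frobInner (skewPart (relTwist X i)) (skewPart (relTwist X i)) := fun i _ => by
      have a1 := le_frobInner_skewPart (relTwist_mul_transpose X i)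
      have a2 := frobNorm_relTwist_le X i
      have a3 := sq_nonneg (frobNorm (relTwist X i - 1))
      have a4 : frobNorm (relTwist X i - 1) ^ 2 ≤ 1 := a2.trans (hρ.trans (min_le_left _ _))
      nlinarith
    have := Finset.sum_le_sum this
    rw [← Finset.sum_mul, ← sqDist_oneTwist] at this
    linarith
  have h4 : Real.sqrt D ≤ c / (4 * (G + 1)) :=
    Real.sqrt_le_iff.2 ⟨by positivity, hρ.trans (min_le_right _ _)⟩
  have h5 : G * Real.sqrt D ≤ c / 4 := by
    have : (G + 1) * Real.sqrt D ≤ (G + 1) * (c / (4 * (G + 1))) := by gcongr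
    have e1 : (G + 1) * (c / (4 * (G + 1))) = c / 4 := by field_simp
    nlinarith [Real.sqrt_nonneg D]
  have h6 := mul_le_mul_of_nonneg_right h5 hD0
  have h7 := mul_le_mul_of_nonneg_left h3 hc.le
  rw [← hD, ← hG] at h1
  have h8 : approachRate (fun i j => w (i - j)) X (oneTwist n e) ≤ _ := h1
  linarith

theorem SpectrallyStable.exists_contraction {w : ZMod n → ℝ} (hs : SpectrallyStable w)
    (hw : ∀ k, w (-k) = w k) (hw0 : ∀ k, 0 ≤ w k) :
    ∃ c > 0, ∃ ρ > 0, ∀ (e : ℕ) (X : Config n e) (S R : RotGroup e),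
      (∀ S' R' : RotGroup e, sqDist X (biTranslate S R (oneTwist n e)) ≤
        sqDist X (biTranslate S' R' (oneTwist n e))) →
      sqDist X (biTranslate S R (oneTwist n e)) ≤ ρ →
      approachRate (fun i j => w (i - j)) X (biTranslate S R (oneTwist n e)) ≤
        -c * sqDist X (biTranslate S R (oneTwist n e)) := by
  obtain ⟨c, hc, ρ, hρ, h⟩ := hs.exists_contraction_twist hw hw0
  refine ⟨c, hc, ρ, hρ, fun e X S R hmin hX => ?_⟩
  have hX' : X = biTranslate S R (biTranslate S⁻¹ R⁻¹ X) := by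
    rw [biTranslate_biTranslate, mul_inv_cancel, inv_mul_cancel, biTranslate_one]
  rw [hX', sqDist_biTranslate] at hX ⊢
  rw [approachRate_biTranslate]
  refine h e _ (fun S' R' => ?_) hX
  rw [← sqDist_biTranslate S R, ← hX', ← sqDist_biTranslate S R _ (biTranslate S' R' _), ← hX',
    biTranslate_biTranslate]
  exact hmin _ _

theorem frobNorm_skewPart_le_frobNorm {ι : Type*} [Fintype ι] (A : Matrix ι ι ℝ) :
    frobNorm (skewPart A) ≤ frobNorm A := by
  rw [skewPart, frobNorm_smul, abs_of_pos (by norm_num)]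
  have := frobNorm_sub_le A A.transpose
  rw [frobNorm_transpose] at this
  linarith

theorem skewPart_neg_transpose {ι : Type*} (A : Matrix ι ι ℝ) :
    skewPart A.transpose = -skewPart A := by
  rw [skewPart, skewPart, Matrix.transpose_transpose, ← smul_neg, neg_sub]

theorem sum_even_smul_skewPart_zrot {w : ZMod n → ℝ} (hw : ∀ k, w (-k) = w k) :
    ∑ k, w k • skewPart (zrot e k) = 0 := by
  have h := Equiv.sum_comp (Equiv.neg (ZMod n)) fun k => w k • skewPart (zrot e k)
  simp only [Equiv.neg_apply, hw, ← zrot_transpose, skewPart_neg_transpose, smul_neg,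
    Finset.sum_neg_distrib] at h
  ext p q
  have h' := congrFun (congrFun h p) q
  rw [Matrix.neg_apply] at h'
  rw [Matrix.zero_apply]
  linarith

/-- The coupling vanishes at the twist and is Lipschitz, so decay of the distance turns into decay
of the velocity. -/
theorem frobNorm_qkCoupling_le_twist {w : ZMod n → ℝ} (hw : ∀ k, w (-k) = w k)
    (hw0 : ∀ k, 0 ≤ w k) (X : Config n e) (i : ZMod n) :
    frobNorm (qkCoupling (fun i j => w (i - j)) X i) ≤
      2 * (∑ k, w k) * Real.sqrt (sqDist X (oneTwist n e)) := by
  have h0 : qkCoupling (fun i j => w (i - j)) X i =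
      ∑ k, w k • skewPart (relTwist X (i + k) * zrot e k * (relTwist X i).transpose - zrot e k) := by
    have hsub : ∀ A B : Matrix (Fin 2 ⊕ Fin e) (Fin 2 ⊕ Fin e) ℝ,
        skewPart (A - B) = skewPart A - skewPart B := fun A B => by
      simp only [skewPart, Matrix.transpose_sub]
      module
    simp only [hsub, smul_sub, Finset.sum_sub_distrib, sum_even_smul_skewPart_zrot hw, sub_zero]
    rw [qkCoupling_eq, ← Equiv.sum_comp (Equiv.addLeft i)]
    refine Finset.sum_congr rfl fun k _ => ?_
    rw [Equiv.coe_addLeft, show i - (i + k) = -k by ring, hw, coe_mul_transpose_eq,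
      add_sub_cancel_left]
  rw [h0]
  refine (frobNorm_sum_le _ _).trans ?_
  rw [mul_comm 2, mul_assoc, Finset.sum_mul]
  refine Finset.sum_le_sum fun k _ => ?_
  rw [frobNorm_smul, abs_of_nonneg (hw0 k)]
  refine mul_le_mul_of_nonneg_left ((frobNorm_skewPart_le_frobNorm _).trans ?_) (hw0 k)
  have hY := relTwist_mul_transpose X i
  have hY' : (relTwist X i).transpose * relTwist X i = 1 := _root_.mul_eq_one_comm.1 hY
  rw [← frobNorm_mul_orthogonal hY]
  have e1 : (relTwist X (i + k) * zrot e k * (relTwist X i).transpose - zrot e k) * relTwist X i =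
      (relTwist X (i + k) - 1) * zrot e k - zrot e k * (relTwist X i - 1) := by
    rw [Matrix.sub_mul, Matrix.mul_assoc, hY', Matrix.mul_one, Matrix.sub_mul, Matrix.mul_sub,
      Matrix.one_mul, Matrix.mul_one]
    abel
  rw [e1]
  refine (frobNorm_sub_le _ _).trans ?_
  rw [frobNorm_mul_orthogonal (zrot_mul_transpose e k),
    frobNorm_orthogonal_mul (zrot_transpose_mul e k)]
  have b : ∀ j, frobNorm (relTwist X j - 1) ≤ Real.sqrt (sqDist X (oneTwist n e)) := fun j =>
    Real.le_sqrt_of_sq_le (frobNorm_relTwist_le X j)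
  linarith [b i, b (i + k)]

theorem frobNorm_qkCoupling_le {w : ZMod n → ℝ} (hw : ∀ k, w (-k) = w k)
    (hw0 : ∀ k, 0 ≤ w k) (X : Config n e) (S R : RotGroup e) (i : ZMod n) :
    frobNorm (qkCoupling (fun i j => w (i - j)) X i) ≤
      2 * (∑ k, w k) * Real.sqrt (sqDist X (biTranslate S R (oneTwist n e))) := by
  have hX' : X = biTranslate S R (biTranslate S⁻¹ R⁻¹ X) := by
    rw [biTranslate_biTranslate, mul_inv_cancel, inv_mul_cancel, biTranslate_one]
  rw [hX', sqDist_biTranslate, qkCoupling_biTranslate, frobNorm_mul_orthogonal, frobNorm_orthogonal_mul]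
  · exact frobNorm_qkCoupling_le_twist hw hw0 _ i
  · exact S.transpose_mul
  · rw [Matrix.transpose_transpose, S.transpose_mul]

end


/-! ### Nonlinear stability by a Lyapunov argument. -/

theorem isClosed_specialOrthogonalGroup (ι : Type*) [Fintype ι] [DecidableEq ι] :
    IsClosed (Matrix.specialOrthogonalGroup ι ℝ : Set (Matrix ι ι ℝ)) := by
  have h : (Matrix.specialOrthogonalGroup ι ℝ : Set (Matrix ι ι ℝ)) =
      {A | A * A.transpose = 1} ∩ {A | A.det = 1} := by
    ext A
    rw [SetLike.mem_coe, Matrix.mem_specialOrthogonalGroup_iff, Matrix.mem_orthogonalGroup_iff]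
    rfl
  rw [h]
  exact (isClosed_eq (continuous_id.matrix_mul continuous_id.matrix_transpose)
    continuous_const).inter (isClosed_eq continuous_id.matrix_det continuous_const)

instance RotGroup.compactSpace (e : ℕ) : CompactSpace (RotGroup e) := by
  refine isCompact_iff_compactSpace.1 ?_
  have hK : IsCompact (Set.pi Set.univ fun _ : Fin 2 ⊕ Fin e =>
      Set.pi Set.univ fun _ : Fin 2 ⊕ Fin e => Set.Icc (-1 : ℝ) 1) :=
    isCompact_univ_pi fun _ => isCompact_univ_pi fun _ => isCompact_Icc
  refine IsCompact.of_isClosed_subset hK (isClosed_specialOrthogonalGroup _) fun A hA p _ q _ => ?_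
  have hu : A ∈ Matrix.unitaryGroup (Fin 2 ⊕ Fin e) ℝ :=
    (Matrix.mem_specialOrthogonalGroup_iff.1 hA).1
  exact abs_le.1 (entry_norm_bound_of_unitary hu p q)

section
variable {n e : ℕ}

theorem continuous_config_apply (i : ZMod n) (p q : Fin 2 ⊕ Fin e) :
    Continuous fun X : Config n e => (X i).1 p q :=
  (continuous_subtype_val.comp (continuous_apply i)).matrix_elem p q

theorem isInducing_config :
    Topology.IsInducing fun (X : Config n e) (i : ZMod n) (p q : Fin 2 ⊕ Fin e) => (X i).1 p q :=
  Topology.IsInducing.piMap fun _ => Topology.IsInducing.subtypeVal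

theorem exists_entrywise_subset [NeZero n] {Z : Config n e} {U : Set (Config n e)} (hU : U ∈ 𝓝 Z) :
    ∃ ε > 0, ∀ X : Config n e, (∀ i p q, |(X i).1 p q - (Z i).1 p q| < ε) → X ∈ U := by
  rw [isInducing_config.nhds_eq_comap, Filter.mem_comap] at hU
  obtain ⟨V, hV, hVU⟩ := hU
  obtain ⟨ε, hε, hball⟩ := Metric.mem_nhds_iff.1 hV
  refine ⟨ε, hε, fun X hX => hVU (hball ?_)⟩
  rw [Metric.mem_ball, dist_pi_lt_iff hε]
  intro i
  rw [dist_pi_lt_iff hε]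
  intro p
  rw [dist_pi_lt_iff hε]
  intro q
  rw [Real.dist_eq]
  exact hX i p q

variable [NeZero n]

theorem continuous_sqDist : Continuous fun p : Config n e × Config n e => sqDist p.1 p.2 := by
  unfold sqDist frobInner
  simp only [Matrix.sub_apply]
  refine continuous_finsetSum _ fun i _ => continuous_finsetSum _ fun p _ =>
    continuous_finsetSum _ fun q _ => ?_
  have h := ((continuous_config_apply (e := e) i p q).comp continuous_fst).sub
    ((continuous_config_apply (e := e) i p q).comp continuous_snd)
  exact h.mul h

/-- The squared distance of a configuration to the family of `1`-twists. -/
noncomputable def famSqDist (X : Config n e) : ℝ :=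
  sInf ((fun p : RotGroup e × RotGroup e => sqDist X (biTranslate p.1 p.2 (oneTwist n e))) ''
    Set.univ)

omit [NeZero n] in
theorem continuous_biTranslate (Z : Config n e) :
    Continuous fun p : RotGroup e × RotGroup e => biTranslate p.1 p.2 Z :=
  continuous_pi fun _ => (continuous_fst.mul continuous_const).mul continuous_snd

theorem continuous_famSqDist : Continuous (famSqDist : Config n e → ℝ) := by
  have hf : Continuous fun q : Config n e × (RotGroup e × RotGroup e) =>
      sqDist q.1 (biTranslate q.2.1 q.2.2 (oneTwist n e)) :=
    continuous_sqDist.comp (g := fun p : Config n e × Config n e => sqDist p.1 p.2)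
      (f := fun q : Config n e × (RotGroup e × RotGroup e) =>
        (q.1, biTranslate q.2.1 q.2.2 (oneTwist n e)))
      (continuous_fst.prodMk ((continuous_biTranslate (oneTwist n e)).comp continuous_snd))
  exact isCompact_univ.continuous_sInf hf

theorem famSqDist_le (X : Config n e) (S R : RotGroup e) :
    famSqDist X ≤ sqDist X (biTranslate S R (oneTwist n e)) :=
  csInf_le ⟨0, by rintro _ ⟨p, -, rfl⟩; exact sqDist_nonneg _ _⟩ ⟨(S, R), trivial, rfl⟩

theorem exists_famSqDist_eq (X : Config n e) :
    ∃ S R : RotGroup e, famSqDist X = sqDist X (biTranslate S R (oneTwist n e)) := by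
  obtain ⟨p, -, hp⟩ := (isCompact_univ (X := RotGroup e × RotGroup e)).exists_sInf_image_eq
    Set.univ_nonempty (f := fun p => sqDist X (biTranslate p.1 p.2 (oneTwist n e)))
    ((continuous_sqDist.comp (continuous_const.prodMk
      (continuous_biTranslate (oneTwist n e)))).continuousOn)
  exact ⟨p.1, p.2, hp⟩

variable {γ : ZMod n → ZMod n → ℝ} {X : ℝ → Config n e}

theorem IsQKSolution.continuousOn (hX : IsQKSolution γ X) : ContinuousOn X (Set.Ici 0) := by
  rw [isInducing_config.continuousOn_iff]
  exact continuousOn_pi.2 fun i => continuousOn_pi.2 fun p => continuousOn_pi.2 fun q =>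
    fun t ht => (hX t ht i p q).continuousWithinAt

theorem IsQKSolution.hasDerivWithinAt_sqDist (hX : IsQKSolution γ X) (Z : Config n e) {t : ℝ}
    (ht : 0 ≤ t) :
    HasDerivWithinAt (fun s => sqDist (X s) Z) (2 * approachRate γ (X t) Z) (Set.Ici 0) t := by
  have h : HasDerivWithinAt (fun s => sqDist (X s) Z)
      (∑ i, ∑ p, ∑ q, ((qkCoupling γ (X t) i * (X t i).1) p q * ((X t i).1 p q - (Z i).1 p q) +
        ((X t i).1 p q - (Z i).1 p q) * (qkCoupling γ (X t) i * (X t i).1) p q))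
      (Set.Ici 0) t := by
    unfold sqDist frobInner
    simp only [Matrix.sub_apply]
    refine HasDerivWithinAt.fun_sum fun i _ => HasDerivWithinAt.fun_sum fun p _ =>
      HasDerivWithinAt.fun_sum fun q _ => ?_
    have h1 := (hX t ht i p q).sub_const ((Z i).1 p q)
    exact h1.mul h1
  refine h.congr_deriv ?_
  simp only [approachRate, frobInner, Finset.mul_sum, Matrix.sub_apply]
  refine Finset.sum_congr rfl fun i _ => Finset.sum_congr rfl fun p _ =>
    Finset.sum_congr rfl fun q _ => ?_
  ring

/-- An infimum need not be differentiable along the flow. But the distance to the twist that is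
nearest at time `x` dominates it afterwards and agrees with it at `x`, which bounds its right Dini
derivative; the comparison principle asks for no more. -/
theorem IsQKSolution.famSqDist_le (hX : IsQKSolution γ X) {c ρ η : ℝ} (hc : 0 < c) (hη : 0 < η)
    (hηρ : η ≤ ρ) (hcon : ∀ (Y : Config n e) (S R : RotGroup e),
      (∀ S' R' : RotGroup e, sqDist Y (biTranslate S R (oneTwist n e)) ≤
        sqDist Y (biTranslate S' R' (oneTwist n e))) →
      sqDist Y (biTranslate S R (oneTwist n e)) ≤ ρ →
      approachRate γ Y (biTranslate S R (oneTwist n e)) ≤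
        -c * sqDist Y (biTranslate S R (oneTwist n e)))
    (h0 : famSqDist (X 0) ≤ η) {t : ℝ} (ht : 0 ≤ t) :
    famSqDist (X t) ≤ η * Real.exp (-c * t) := by
  choose S R hSR using fun s : ℝ => exists_famSqDist_eq (X s)
  have hf : ContinuousOn (fun s => famSqDist (X s)) (Set.Icc 0 t) :=
    continuous_famSqDist.comp_continuousOn (hX.continuousOn.mono Set.Icc_subset_Ici_self)
  have hB : ∀ x : ℝ, HasDerivAt (fun s => η * Real.exp (-c * s))
      (η * (Real.exp (-c * x) * -c)) x := fun x => by
    have : HasDerivAt (fun s : ℝ => -c * s) (-c) x := by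
      simpa using (hasDerivAt_id x).const_mul (-c)
    exact this.exp.const_mul η
  refine image_le_of_liminf_slope_right_lt_deriv_boundary hf
    (f' := fun s => 2 * approachRate γ (X s) (biTranslate (S s) (R s) (oneTwist n e)))
    (fun x hx r hr => ?_) (by simpa using h0) hB (fun x hx hfx => ?_) ⟨ht, le_rfl⟩
  · have hd := (hX.hasDerivWithinAt_sqDist (biTranslate (S x) (R x) (oneTwist n e)) hx.1).mono
      (Set.Ici_subset_Ici.2 hx.1)
    have hs := (hasDerivWithinAt_iff_tendsto_slope' Set.self_notMem_Ioi).1 hd.Ioi_of_Ici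
    refine Filter.Eventually.frequently ?_
    filter_upwards [hs.eventually_lt_const hr, self_mem_nhdsWithin] with z hz hxz
    refine lt_of_le_of_lt ?_ hz
    rw [slope_def_field, slope_def_field, hSR x]
    have hpos : 0 < z - x := sub_pos.2 hxz
    gcongr
    exact _root_.famSqDist_le _ _ _
  -- At a point of contact the squared distance falls at rate at least `2c`, the barrier only at
  -- rate `c`; this supplies the strict inequality.
  · have hmin : ∀ S' R' : RotGroup e,
        sqDist (X x) (biTranslate (S x) (R x) (oneTwist n e)) ≤
          sqDist (X x) (biTranslate S' R' (oneTwist n e)) := fun S' R' => by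
      rw [← hSR x]
      exact _root_.famSqDist_le _ _ _
    have hle : η * Real.exp (-c * x) ≤ ρ := by
      have : Real.exp (-c * x) ≤ 1 := Real.exp_le_one_iff.2 (by nlinarith [hx.1])
      nlinarith
    have h1 := hcon (X x) (S x) (R x) hmin (by rw [← hSR x, hfx]; exact hle)
    rw [← hSR x, hfx] at h1
    have h2 : 0 < η * Real.exp (-c * x) := by positivity
    nlinarith

theorem IsQKSolution.abs_sub_le (hX : IsQKSolution γ X) {c M : ℝ} (hc : 0 < c)
    (hM : ∀ t, 0 ≤ t → ∀ i, frobNorm (qkCoupling γ (X t) i) ≤ M * Real.exp (-c * t))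
    {s t : ℝ} (hs : 0 ≤ s) (hst : s ≤ t) (i : ZMod n) (p q : Fin 2 ⊕ Fin e) :
    |(X t i).1 p q - (X s i).1 p q| ≤ M / c * Real.exp (-c * s) := by
  have hB : ∀ x : ℝ, HasDerivAt (fun x => M / c * (Real.exp (-c * s) - Real.exp (-c * x)))
      (M * Real.exp (-c * x)) x := fun x => by
    have : HasDerivAt (fun s : ℝ => -c * s) (-c) x := by
      simpa using (hasDerivAt_id x).const_mul (-c)
    refine ((this.exp.const_sub _).const_mul (M / c)).congr_deriv ?_
    field_simp
  have h := image_norm_le_of_norm_deriv_right_le_deriv_boundary (a := s) (b := t)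
    (f := fun x => (X x i).1 p q - (X s i).1 p q)
    (f' := fun x => (qkCoupling γ (X x) i * (X x i).1) p q)
    (fun x hx => ((hX x (hs.trans hx.1) i p q).continuousWithinAt.mono
      (fun y hy => hs.trans hy.1)).sub continuousWithinAt_const)
    (fun x hx => ((hX x (hs.trans hx.1) i p q).mono
      (Set.Ici_subset_Ici.2 (hs.trans hx.1))).sub_const _)
    (by simp) hB (fun x hx => ?_) ⟨hst, le_rfl⟩
  · have hM0 : 0 ≤ M := by
      have := (frobNorm_nonneg _).trans (hM 0 le_rfl i)
      simpa using this
    refine h.trans ?_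
    have := Real.exp_pos (-c * t)
    have : 0 ≤ M / c := by positivity
    gcongr
    linarith
  · refine (abs_apply_le_frobNorm _ p q).trans ?_
    rw [frobNorm_mul_orthogonal (X x i).mul_transpose]
    exact hM x (hs.trans hx.1) i

theorem eq_of_sqDist_eq_zero {X Z : Config n e} (h : sqDist X Z = 0) : X = Z := by
  funext i
  apply Subtype.ext
  ext p q
  have h1 := (Finset.sum_eq_zero_iff_of_nonneg fun i _ => frobInner_self_nonneg _).1 h i
    (Finset.mem_univ i)
  have h2 := abs_apply_le_frobNorm ((X i).1 - (Z i).1) p q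
  rw [frobNorm, h1, Real.sqrt_zero, Matrix.sub_apply] at h2
  have := abs_nonpos_iff.1 h2
  linarith

theorem mem_oneTwistFamily_of_famSqDist_le {X : Config n e} (h : famSqDist X ≤ 0) :
    X ∈ oneTwistFamily n e := by
  obtain ⟨S, R, hSR⟩ := exists_famSqDist_eq X
  exact ⟨S, R, eq_of_sqDist_eq_zero (le_antisymm (hSR ▸ h) (sqDist_nonneg _ _))⟩

theorem famSqDist_le_oneTwist (X : Config n e) : famSqDist X ≤ sqDist X (oneTwist n e) := by
  simpa only [biTranslate_one] using famSqDist_le X 1 1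

theorem sqDist_oneTwist_mem_nhds {η : ℝ} (hη : 0 < η) :
    {X : Config n e | sqDist X (oneTwist n e) < η} ∈ 𝓝 (oneTwist n e) := by
  have hc : Continuous fun X : Config n e => sqDist X (oneTwist n e) :=
    continuous_sqDist.comp (g := fun p : Config n e × Config n e => sqDist p.1 p.2)
      (f := fun X : Config n e => (X, oneTwist n e)) (continuous_id.prodMk continuous_const)
  refine (isOpen_lt hc continuous_const).mem_nhds ?_
  simpa [sqDist, frobInner] using hη

theorem tendsto_matrix {ι α : Type*} {f : α → Matrix ι ι ℝ} {A : Matrix ι ι ℝ} {l : Filter α}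
    (h : ∀ p q, Filter.Tendsto (fun t => f t p q) l (𝓝 (A p q))) : Filter.Tendsto f l (𝓝 A) :=
  tendsto_pi_nhds.2 fun p => tendsto_pi_nhds.2 fun q => h p q

/-- A trajectory with exponentially decaying velocity converges. -/
theorem IsQKSolution.exists_tendsto (hX : IsQKSolution γ X) {c M : ℝ} (hc : 0 < c)
    (hM : ∀ t, 0 ≤ t → ∀ i, frobNorm (qkCoupling γ (X t) i) ≤ M * Real.exp (-c * t)) :
    ∃ Z, Filter.Tendsto X Filter.atTop (𝓝 Z) := by
  have hlim : ∀ i p q, ∃ l, Filter.Tendsto (fun t => (X t i).1 p q) Filter.atTop (𝓝 l) := by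
    intro i p q
    -- Solutions are controlled only for `t ≥ 0`, hence the truncation.
    have hcau : CauchySeq fun t : ℝ => (X (max t 0) i).1 p q := by
      refine cauchySeq_of_le_tendsto_0' (fun t : ℝ => M / c * Real.exp (-c * max t 0))
        (fun s t hst => ?_) ?_
      · rw [dist_comm, Real.dist_eq]
        exact hX.abs_sub_le hc hM (le_max_right _ _) (max_le_max_right 0 hst) i p q
      · have h1 : Filter.Tendsto (fun t : ℝ => c * t) Filter.atTop Filter.atTop :=
          Filter.tendsto_id.const_mul_atTop hc
        have h2 := (Real.tendsto_exp_neg_atTop_nhds_zero.comp h1).const_mul (M / c)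
        rw [mul_zero] at h2
        refine h2.congr' ?_
        filter_upwards [Filter.eventually_ge_atTop 0] with t ht
        rw [max_eq_left ht, Function.comp, neg_mul]
    obtain ⟨l, hl⟩ := cauchySeq_tendsto_of_complete hcau
    refine ⟨l, hl.congr' ?_⟩
    filter_upwards [Filter.eventually_ge_atTop 0] with t ht
    rw [max_eq_left ht]
  choose l hl using hlim
  have hl' : ∀ i, Filter.Tendsto (fun t => (X t i).1) Filter.atTop (𝓝 (Matrix.of (l i))) := fun i =>
    tendsto_matrix (hl i)
  refine ⟨fun i => ⟨Matrix.of (l i), (isClosed_specialOrthogonalGroup _).mem_of_tendsto (hl' i)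
    (Filter.Eventually.of_forall fun t => (X t i).2)⟩, ?_⟩
  exact tendsto_pi_nhds.2 fun i => tendsto_subtype_rng.2 (hl' i)

/-- From initial distance below `τ`, the squared distance to the family decays like `τ² exp(-ct)`
and the speed like `Gτ exp(-ct/2)`. Integrating the speed gives Lyapunov stability and a limit, and
the limit has distance zero from the family. -/
theorem SpectrallyStable.supportsOneTwists {w : ZMod n → ℝ} (hs : SpectrallyStable w)
    (hw : ∀ k, w (-k) = w k) (hw0 : ∀ k, 0 ≤ w k) (e : ℕ) :
    SupportsOneTwists e fun i j => w (i - j) := by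
  obtain ⟨c, hc, ρ, hρ, hcon⟩ := hs.exists_contraction hw hw0
  set G := 2 * ∑ k, w k with hG
  have hG0 : 0 ≤ G := by
    have := Finset.sum_nonneg fun k (_ : k ∈ Finset.univ) => hw0 k
    positivity
  have hdecay : ∀ {τ : ℝ} {X : ℝ → Config n e}, 0 < τ → τ ^ 2 ≤ ρ →
      IsQKSolution (fun i j => w (i - j)) X → sqDist (X 0) (oneTwist n e) < τ ^ 2 → ∀ t, 0 ≤ t →
      famSqDist (X t) ≤ τ ^ 2 * Real.exp (-c * t) := fun hτ hτρ hX h0 t ht =>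
    hX.famSqDist_le hc (by positivity) hτρ (hcon e) ((famSqDist_le_oneTwist _).trans h0.le) ht
  have hspeed : ∀ {τ : ℝ} {X : ℝ → Config n e}, 0 < τ → τ ^ 2 ≤ ρ →
      IsQKSolution (fun i j => w (i - j)) X → sqDist (X 0) (oneTwist n e) < τ ^ 2 → ∀ t, 0 ≤ t →
      ∀ i, frobNorm (qkCoupling (fun i j => w (i - j)) (X t) i) ≤
        G * τ * Real.exp (-(c / 2) * t) := fun {τ X} hτ hτρ hX h0 t ht i => by
    obtain ⟨S, R, hSR⟩ := exists_famSqDist_eq (X t)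
    refine (frobNorm_qkCoupling_le hw hw0 (X t) S R i).trans ?_
    rw [← hSR, ← hG, mul_assoc G τ]
    refine mul_le_mul_of_nonneg_left (Real.sqrt_le_iff.2 ⟨by positivity, ?_⟩) hG0
    refine (hdecay hτ hτρ hX h0 t ht).trans_eq ?_
    rw [mul_pow, ← Real.exp_nat_mul]
    congr 2
    push_cast
    ring
  refine ⟨fun U hU => ?_, {X | sqDist X (oneTwist n e) < Real.sqrt ρ ^ 2},
    sqDist_oneTwist_mem_nhds (by positivity), fun X hX h0 => ?_⟩
  · obtain ⟨ε, hε, hεU⟩ := exists_entrywise_subset hU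
    -- The initial offset `τ` plus the total displacement `Gτ/(c/2)` stays at most `ε/2`.
    set τ := min (Real.sqrt ρ) (ε / (2 * (1 + G / (c / 2)))) with hτdef
    have hτ : 0 < τ := lt_min (Real.sqrt_pos.2 hρ) (by positivity)
    have hτρ : τ ^ 2 ≤ ρ := by
      rw [← Real.sq_sqrt hρ.le]
      exact pow_le_pow_left₀ hτ.le (min_le_left _ _) 2
    refine ⟨_, sqDist_oneTwist_mem_nhds (η := τ ^ 2) (by positivity), fun X hX h0 t ht =>
      hεU _ fun i p q => ?_⟩
    have h1 := hX.abs_sub_le (by positivity) (hspeed hτ hτρ hX h0) le_rfl ht i p q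
    rw [mul_zero, Real.exp_zero, mul_one] at h1
    have h2 : |(X 0 i).1 p q - (oneTwist n e i).1 p q| ≤ τ := by
      refine (abs_apply_le_frobNorm ((X 0 i).1 - (oneTwist n e i).1) p q).trans ?_
      rw [frobNorm]
      refine Real.sqrt_le_iff.2 ⟨hτ.le, le_trans ?_ h0.le⟩
      exact Finset.single_le_sum (f := fun i => frobInner ((X 0 i).1 - (oneTwist n e i).1)
        ((X 0 i).1 - (oneTwist n e i).1)) (fun _ _ => frobInner_self_nonneg _) (Finset.mem_univ i)
    have h3 := abs_sub_le ((X t i).1 p q) ((X 0 i).1 p q) ((oneTwist n e i).1 p q)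
    have h4 : τ * (1 + G / (c / 2)) ≤ ε / 2 := by
      have hpos : 0 < 1 + G / (c / 2) := by positivity
      have := mul_le_mul_of_nonneg_right
        (min_le_right (Real.sqrt ρ) (ε / (2 * (1 + G / (c / 2))))) hpos.le
      refine this.trans_eq ?_
      field_simp
    have h5 : G * τ / (c / 2) = τ * (G / (c / 2)) := by ring
    rw [h5] at h1
    linarith
  · have hτ : 0 < Real.sqrt ρ := Real.sqrt_pos.2 hρ
    have hτρ : Real.sqrt ρ ^ 2 ≤ ρ := (Real.sq_sqrt hρ.le).le
    obtain ⟨Z, hZ⟩ := hX.exists_tendsto (by positivity) (hspeed hτ hτρ hX h0)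
    refine ⟨Z, mem_oneTwistFamily_of_famSqDist_le ?_, hZ⟩
    have h1 : Filter.Tendsto (fun t : ℝ => c * t) Filter.atTop Filter.atTop :=
      Filter.tendsto_id.const_mul_atTop hc
    have h2 := (Real.tendsto_exp_neg_atTop_nhds_zero.comp h1).const_mul (Real.sqrt ρ ^ 2)
    rw [mul_zero] at h2
    refine le_of_tendsto_of_tendsto ((continuous_famSqDist.tendsto Z).comp hZ) h2 ?_
    filter_upwards [Filter.eventually_ge_atTop 0] with t ht
    have := hdecay hτ hτρ hX h0 t ht
    rwa [neg_mul] at this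

end


/-! ### Global solutions and the reduction of planar configurations to phases. -/

/-- A bounded Lipschitz vector field has a solution on `[0, ∞)` through every point. -/
theorem exists_forward_solution {E : Type*} [NormedAddCommGroup E] [NormedSpace ℝ E]
    [CompleteSpace E] {f : E → E} {K L : NNReal} (hK : LipschitzWith K f) (hL : ∀ x, ‖f x‖ ≤ L)
    (x₀ : E) :
    ∃ α : ℝ → E, α 0 = x₀ ∧ ∀ t, 0 ≤ t → HasDerivWithinAt α (f (α t)) (Set.Ici 0) t := by
  have hloc : ∀ N : ℕ, ∃ α : ℝ → E, α 0 = x₀ ∧ ∀ t ∈ Set.Icc (0 : ℝ) (N + 1),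
      HasDerivWithinAt α (f (α t)) (Set.Icc 0 (N + 1)) t := by
    intro N
    have hN : (0 : ℝ) ≤ N + 1 := by positivity
    -- The field is bounded by `L` everywhere, so the ball of radius `L(N+1)` cannot be left by time
    -- `N + 1`, and Picard–Lindelöf covers the whole interval.
    have hpl : IsPicardLindelof (fun _ => f) (tmin := 0) (tmax := N + 1) ⟨0, le_rfl, hN⟩ x₀
        (L * (N + 1)) 0 L K := by
      refine IsPicardLindelof.of_time_independent (fun x _ => hL x) hK.lipschitzOnWith ?_
      simp [max_eq_left hN]
    exact hpl.exists_eq_forall_mem_Icc_hasDerivWithinAt₀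
  choose α h0 hα using hloc
  have hagree : ∀ {M N : ℕ}, M ≤ N → Set.EqOn (α M) (α N) (Set.Icc 0 (M + 1)) := by
    intro M N hMN
    have hMN' : (M : ℝ) + 1 ≤ N + 1 := by gcongr
    have right : ∀ P : ℕ, (M : ℝ) + 1 ≤ P + 1 → ∀ t ∈ Set.Ico (0 : ℝ) (M + 1),
        HasDerivWithinAt (α P) (f (α P t)) (Set.Ici t) t := fun P hP t ht =>
      ((hα P t ⟨ht.1, ht.2.le.trans hP⟩).mono (Set.Icc_subset_Icc_left ht.1)).mono_of_mem_nhdsWithin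
        (Icc_mem_nhdsGE (ht.2.trans_le hP))
    exact ODE_solution_unique (v := fun _ => f) (fun _ => hK)
      (fun t ht => (hα M t ht).continuousWithinAt) (right M le_rfl)
      (fun t ht => ((hα N t ⟨ht.1, ht.2.trans hMN'⟩).mono
        (Set.Icc_subset_Icc_right hMN')).continuousWithinAt)
      (right N hMN') ((h0 M).trans (h0 N).symm)
  -- The solution with index `⌊t⌋` lives on `[0, ⌊t⌋ + 1]`, hence beyond `t`, and it agrees with the
  -- glued function up to that end.
  refine ⟨fun t => α ⌊t⌋₊ t, by simpa using h0 0, fun t ht => ?_⟩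
  have hlt : t < ⌊t⌋₊ + 1 := Nat.lt_floor_add_one t
  have hd : HasDerivWithinAt (α ⌊t⌋₊) (f (α ⌊t⌋₊ t)) (Set.Ici 0) t :=
    (hα ⌊t⌋₊ t ⟨ht, hlt.le⟩).mono_of_mem_nhdsWithin (by
      rw [mem_nhdsWithin]
      exact ⟨Set.Iio (⌊t⌋₊ + 1), isOpen_Iio, hlt, fun s hs => ⟨hs.2, le_of_lt hs.1⟩⟩)
  refine hd.congr_of_eventuallyEq ?_ rfl
  filter_upwards [self_mem_nhdsWithin, mem_nhdsWithin_of_mem_nhds (Iio_mem_nhds hlt)] with s hs hs'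
  have hle : ⌊s⌋₊ ≤ ⌊t⌋₊ := by
    have h1 := Nat.floor_le (show (0 : ℝ) ≤ s from hs)
    have h2 : (⌊s⌋₊ : ℝ) < ⌊t⌋₊ + 1 := h1.trans_lt hs'
    have h3 : ⌊s⌋₊ < ⌊t⌋₊ + 1 := by exact_mod_cast h2
    omega
  exact hagree hle ⟨hs, (Nat.lt_floor_add_one s).le⟩

section
variable {n : ℕ} [NeZero n]

/-- The Kuramoto vector field for phases relative to the twist. -/
noncomputable def kuramotoField (w : ZMod n → ℝ) (φ : ZMod n → ℝ) (i : ZMod n) : ℝ :=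
  ∑ k, w k * (zsin k * Real.cos (φ (i + k) - φ i) + zcos k * Real.sin (φ (i + k) - φ i))

/-- The angle of a vertex in the `1`-twist. -/
noncomputable def twistAngle (i : ZMod n) : ℝ := (i.valMinAbs : ℝ) * (2 * Real.pi / n)

theorem cos_twistAngle (i : ZMod n) : Real.cos (twistAngle i) = zcos i := by
  rw [twistAngle, ← zcos_intCast, ZMod.coe_valMinAbs]

theorem sin_twistAngle (i : ZMod n) : Real.sin (twistAngle i) = zsin i := by
  rw [twistAngle, ← zsin_intCast, ZMod.coe_valMinAbs]

/-- In this form each term is visibly bounded by `1` and `1`-Lipschitz in `x`. -/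
theorem phase_eq_sin (k : ZMod n) (x : ℝ) :
    zsin k * Real.cos x + zcos k * Real.sin x = Real.sin (twistAngle k + x) := by
  rw [Real.sin_add, cos_twistAngle, sin_twistAngle]

theorem norm_kuramotoField_le {w : ZMod n → ℝ} (hw0 : ∀ k, 0 ≤ w k) (φ : ZMod n → ℝ) :
    ‖kuramotoField w φ‖ ≤ ∑ k, w k := by
  refine (pi_norm_le_iff_of_nonneg (Finset.sum_nonneg fun k _ => hw0 k)).2 fun i => ?_
  rw [kuramotoField]
  refine (norm_sum_le _ _).trans (Finset.sum_le_sum fun k _ => ?_)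
  rw [phase_eq_sin, norm_mul, Real.norm_eq_abs, Real.norm_eq_abs, abs_of_nonneg (hw0 k)]
  exact mul_le_of_le_one_right (hw0 k) (Real.abs_sin_le_one _)

theorem dist_kuramotoField_le {w : ZMod n → ℝ} (hw0 : ∀ k, 0 ≤ w k) (φ φ' : ZMod n → ℝ) :
    dist (kuramotoField w φ) (kuramotoField w φ') ≤ (2 * ∑ k, w k) * dist φ φ' := by
  have hW := Finset.sum_nonneg fun k (_ : k ∈ Finset.univ) => hw0 k
  refine (dist_pi_le_iff (by positivity)).2 fun i => ?_
  rw [Real.dist_eq, kuramotoField, kuramotoField, ← Finset.sum_sub_distrib, mul_comm 2, mul_assoc,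
    Finset.sum_mul]
  refine (Finset.abs_sum_le_sum_abs _ _).trans (Finset.sum_le_sum fun k _ => ?_)
  rw [phase_eq_sin, phase_eq_sin, ← mul_sub, abs_mul, abs_of_nonneg (hw0 k)]
  refine mul_le_mul_of_nonneg_left ((Real.abs_sin_sub_sin_le _ _).trans ?_) (hw0 k)
  have h1 : twistAngle k + (φ (i + k) - φ i) - (twistAngle k + (φ' (i + k) - φ' i)) =
      (φ (i + k) - φ' (i + k)) - (φ i - φ' i) := by ring
  have h2 := dist_le_pi_dist φ φ' (i + k)
  have h3 := dist_le_pi_dist φ φ' i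
  rw [Real.dist_eq] at h2 h3
  rw [h1]
  have := abs_sub (φ (i + k) - φ' (i + k)) (φ i - φ' i)
  linarith

theorem exists_kuramoto_solution {w : ZMod n → ℝ} (hw0 : ∀ k, 0 ≤ w k) (φ₀ : ZMod n → ℝ) :
    ∃ φ : ℝ → ZMod n → ℝ, φ 0 = φ₀ ∧ ∀ t, 0 ≤ t → ∀ i,
      HasDerivWithinAt (fun s => φ s i) (kuramotoField w (φ t) i) (Set.Ici 0) t := by
  have hW := Finset.sum_nonneg fun k (_ : k ∈ Finset.univ) => hw0 k
  obtain ⟨φ, h0, hφ⟩ := exists_forward_solution (f := kuramotoField w)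
    (K := (2 * ∑ k, w k).toNNReal) (L := (∑ k, w k).toNNReal)
    (LipschitzWith.of_dist_le_mul fun x y => by
      rw [Real.coe_toNNReal _ (by positivity)]
      exact dist_kuramotoField_le hw0 x y)
    (fun x => by
      rw [Real.coe_toNNReal _ hW]
      exact norm_kuramotoField_le hw0 x) φ₀
  exact ⟨φ, h0, fun t ht => hasDerivWithinAt_pi.1 (hφ t ht)⟩

/-- The infinitesimal rotation of the first coordinate plane. -/
def planeGenerator (e : ℕ) : Matrix (Fin 2 ⊕ Fin e) (Fin 2 ⊕ Fin e) ℝ :=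
  Matrix.fromBlocks !![0, -1; 1, 0] 0 0 0

theorem skewPart_singleRotationMatrix (e : ℕ) (θ : ℝ) :
    skewPart (singleRotationMatrix e θ) = Real.sin θ • planeGenerator e := by
  rw [skewPart, singleRotationMatrix_transpose, singleRotationMatrix, singleRotationMatrix,
    planeGenerator]
  ext (p | p) (q | q)
  · fin_cases p <;> fin_cases q <;> simp <;> ring
  all_goals simp

theorem hasDerivWithinAt_singleRotationMatrix {e : ℕ} {θ : ℝ → ℝ} {θ' : ℝ} {s : Set ℝ} {t : ℝ}
    (h : HasDerivWithinAt θ θ' s t) (p q : Fin 2 ⊕ Fin e) :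
    HasDerivWithinAt (fun x => singleRotationMatrix e (θ x) p q)
      (((θ' • planeGenerator e) * singleRotationMatrix e (θ t)) p q) s t := by
  have hc := h.cos
  have hs := h.sin
  rw [planeGenerator, singleRotationMatrix, Matrix.fromBlocks_smul, Matrix.fromBlocks_multiply]
  simp only [singleRotationMatrix]
  rcases p with p | p <;> rcases q with q | q
  · fin_cases p <;> fin_cases q <;> simp
    · exact hc.congr_deriv (by ring)
    · exact hs.neg.congr_deriv (by ring)
    · exact hs.congr_deriv (by ring)
    · exact hc.congr_deriv (by ring)
  all_goals simpa using hasDerivWithinAt_const _ _ _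

/-- The configuration of rotations of the first coordinate plane with given phases relative to the
twist. -/
noncomputable def planarConfig (e : ℕ) (φ : ZMod n → ℝ) : Config n e :=
  fun i => singleRotation e (twistAngle i + φ i)

theorem sin_twistAngle_add_sub (i j : ZMod n) (x y : ℝ) :
    Real.sin (twistAngle j + y - (twistAngle i + x)) =
      zsin (j - i) * Real.cos (y - x) + zcos (j - i) * Real.sin (y - x) := by
  rw [show twistAngle j + y - (twistAngle i + x) = twistAngle j + -twistAngle i + (y - x) by ring,
    Real.sin_add, Real.sin_add, Real.cos_add, Real.sin_neg, Real.cos_neg, cos_twistAngle,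
    sin_twistAngle, cos_twistAngle, sin_twistAngle, sub_eq_add_neg j, zsin_add, zcos_add, zcos_neg,
    zsin_neg]

theorem cos_twistAngle_add_sub (i j : ZMod n) (x y : ℝ) :
    Real.cos (twistAngle j + y - (twistAngle i + x)) = Real.cos (twistAngle (j - i) + (y - x)) := by
  rw [Real.cos_add, cos_twistAngle, sin_twistAngle,
    show twistAngle j + y - (twistAngle i + x) = twistAngle j + -twistAngle i + (y - x) by ring,
    Real.cos_add, Real.sin_add, Real.cos_add, Real.sin_neg, Real.cos_neg, cos_twistAngle,
    sin_twistAngle, cos_twistAngle, sin_twistAngle, sub_eq_add_neg j, zsin_add, zcos_add, zcos_neg,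
    zsin_neg]

/-- Planar configurations form an invariant set on which the system is the classical Kuramoto model,
so one phase argument shows instability in every dimension. -/
theorem qkCoupling_planarConfig {w : ZMod n → ℝ} (hw : ∀ k, w (-k) = w k) (e : ℕ)
    (φ : ZMod n → ℝ) (i : ZMod n) :
    qkCoupling (fun i j => w (i - j)) (planarConfig e φ) i =
      kuramotoField w φ i • planeGenerator e := by
  rw [qkCoupling_eq, kuramotoField, Finset.sum_smul, ← Equiv.sum_comp (Equiv.addLeft i)]
  refine Finset.sum_congr rfl fun k _ => ?_
  rw [Equiv.coe_addLeft, show i - (i + k) = -k by ring, hw, mul_smul]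
  have h : (planarConfig e φ (i + k)).1 * (planarConfig e φ i).1.transpose =
      singleRotationMatrix e (twistAngle (i + k) + φ (i + k) - (twistAngle i + φ i)) := by
    simp only [planarConfig, singleRotation]
    rw [singleRotationMatrix_transpose, singleRotationMatrix_mul, sub_eq_add_neg]
  rw [h, skewPart_singleRotationMatrix, sin_twistAngle_add_sub, add_sub_cancel_left]

theorem isQKSolution_planarConfig {w : ZMod n → ℝ} (hw : ∀ k, w (-k) = w k) (e : ℕ)
    {φ : ℝ → ZMod n → ℝ} (hφ : ∀ t, 0 ≤ t → ∀ i,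
      HasDerivWithinAt (fun s => φ s i) (kuramotoField w (φ t) i) (Set.Ici 0) t) :
    IsQKSolution (fun i j => w (i - j)) fun t => planarConfig e (φ t) := by
  intro t ht i p q
  rw [qkCoupling_planarConfig hw]
  exact hasDerivWithinAt_singleRotationMatrix ((hφ t ht i).const_add (twistAngle i)) p q

theorem planarConfig_zero (e : ℕ) : planarConfig e (0 : ZMod n → ℝ) = oneTwist n e := by
  funext i
  apply Subtype.ext
  rw [coe_oneTwist, zrot, ← cos_twistAngle, ← sin_twistAngle]
  simp only [planarConfig, singleRotation, Pi.zero_apply, add_zero]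
  rfl

omit [NeZero n] in
theorem continuous_planarConfig (e : ℕ) :
    Continuous (planarConfig e : (ZMod n → ℝ) → Config n e) := by
  refine continuous_pi fun i => Continuous.subtype_mk ?_ _
  refine continuous_pi fun p => continuous_pi fun q => ?_
  have h : Continuous fun φ : ZMod n → ℝ => twistAngle i + φ i := by fun_prop
  simp only [singleRotationMatrix]
  rcases p with p | p <;> rcases q with q | q
  · fin_cases p <;> fin_cases q <;> simp <;> fun_prop
  all_goals simpa using continuous_const

theorem frobInner_singleRotationMatrix (e : ℕ) (a b : ℝ) :
    frobInner (singleRotationMatrix e a) (singleRotationMatrix e b) =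
      2 * Real.cos (a - b) + e := by
  simp [frobInner, singleRotationMatrix, Fintype.sum_sum_type, Fin.sum_univ_two, Matrix.one_apply,
    Real.cos_sub]
  ring

end


/-! ### Growth of the unstable mode of the phase system. -/

section
variable {n : ℕ} [NeZero n]

/-- The linear part of the Kuramoto vector field at the twist. -/
noncomputable def kuramotoLinear (w : ZMod n → ℝ) (φ : ZMod n → ℝ) (i : ZMod n) : ℝ :=
  ∑ k, w k * (zcos k * (φ (i + k) - φ i))

theorem sum_even_mul_zsin {w : ZMod n → ℝ} (hw : ∀ k, w (-k) = w k) (m : ZMod n) :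
    ∑ k, w k * zsin (m * k) = 0 := by
  have h := Equiv.sum_comp (Equiv.neg (ZMod n)) fun k => w k * zsin (m * k)
  simp only [Equiv.neg_apply, hw, mul_neg, zsin_neg, Finset.sum_neg_distrib] at h
  linarith

theorem abs_phase_remainder_le {x y z : ℝ} (hx : |x| ≤ 1) (hy : |y| ≤ 1) (hz : |z| ≤ 1) :
    |x * (Real.cos z - 1) + y * (Real.sin z - z)| ≤ z ^ 2 := by
  have h1 : |Real.cos z - 1| ≤ z ^ 2 / 2 := by
    rw [abs_le]
    constructor <;> linarith [Real.one_sub_sq_div_two_le_cos (x := z), Real.cos_le_one z,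
      sq_nonneg z]
  have h2 : |Real.sin z - z| ≤ z ^ 2 / 2 := by
    have key : ∀ z : ℝ, 0 ≤ z → z ≤ 1 → |Real.sin z - z| ≤ z ^ 2 / 2 := by
      intro z h0 h1
      rcases h0.eq_or_lt with rfl | hpos
      · simp
      · rw [abs_le]
        have a1 := Real.sin_gt_sub_cube hpos
        have a2 := Real.sin_lt hpos
        constructor <;> nlinarith [sq_nonneg z, mul_nonneg (sq_nonneg z) (sub_nonneg.2 h1)]
    rcases le_total 0 z with h | h
    · exact key z h (abs_le.1 hz).2
    · have := key (-z) (by linarith) (by linarith [(abs_le.1 hz).1])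
      rwa [Real.sin_neg, neg_sq, neg_sub_neg, abs_sub_comm] at this
  refine (abs_add_le _ _).trans ?_
  rw [abs_mul, abs_mul]
  nlinarith [abs_nonneg x, abs_nonneg y, abs_nonneg (Real.cos z - 1), abs_nonneg (Real.sin z - z)]

theorem abs_zcos_le_one (k : ZMod n) : |zcos k| ≤ 1 := by
  rw [← cos_twistAngle]; exact Real.abs_cos_le_one _

theorem abs_zsin_le_one (k : ZMod n) : |zsin k| ≤ 1 := by
  rw [← sin_twistAngle]; exact Real.abs_sin_le_one _

theorem abs_kuramotoField_sub_linear_le {w : ZMod n → ℝ} (hw : ∀ k, w (-k) = w k)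
    (hw0 : ∀ k, 0 ≤ w k) {φ : ZMod n → ℝ} {r : ℝ} (hr : r ≤ 1) (hφ : ∀ i j, |φ j - φ i| ≤ r)
    (i : ZMod n) :
    |kuramotoField w φ i - kuramotoLinear w φ i| ≤ 2 * r * (∑ k, w k) * ∑ j, |φ j| := by
  have h0 := sum_even_mul_zsin hw 1
  simp only [one_mul] at h0
  have e1 : kuramotoField w φ i - kuramotoLinear w φ i =
      ∑ k, w k * (zsin k * (Real.cos (φ (i + k) - φ i) - 1) +
        zcos k * (Real.sin (φ (i + k) - φ i) - (φ (i + k) - φ i))) := by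
    rw [kuramotoField, kuramotoLinear, ← sub_zero (∑ k, _ - ∑ k, _), ← h0,
      ← Finset.sum_sub_distrib, ← Finset.sum_sub_distrib]
    exact Finset.sum_congr rfl fun k _ => by ring
  rw [e1, mul_comm (2 * r), mul_assoc, Finset.sum_mul]
  refine (Finset.abs_sum_le_sum_abs _ _).trans (Finset.sum_le_sum fun k _ => ?_)
  rw [abs_mul, abs_of_nonneg (hw0 k)]
  refine mul_le_mul_of_nonneg_left ?_ (hw0 k)
  refine (abs_phase_remainder_le (abs_zsin_le_one k) (abs_zcos_le_one k)
    ((hφ _ _).trans hr)).trans ?_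
  have a : ∀ j, |φ j| ≤ ∑ j, |φ j| := fun j =>
    Finset.single_le_sum (f := fun j => |φ j|) (fun _ _ => abs_nonneg _) (Finset.mem_univ j)
  have b := abs_sub (φ (i + k)) (φ i)
  have d := hφ i (i + k)
  rw [← sq_abs]
  nlinarith [a i, a (i + k), abs_nonneg (φ (i + k) - φ i)]

/-- The multiplier is `∑ w_k cos_k (χ(k) - 1)`. Its real part follows from `cos² = (1 + cos 2)/2`,
and its imaginary part is half a sum of `w_k sin_(2k)`, which vanishes because `w` is even. -/
theorem dft_kuramotoLinear {w : ZMod n → ℝ} (hw : ∀ k, w (-k) = w k) (φ : ZMod n → ℝ) :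
    dft (fun i => (kuramotoLinear w φ i : ℂ)) 1 =
      (((cosTransform w 2 + cosTransform w 0) / 2 - cosTransform w 1 : ℝ) : ℂ) *
        dft (fun i => (φ i : ℂ)) 1 := by
  have h1 : ∀ k : ZMod n, ∑ j, (ZMod.stdAddChar (-(1 * j)) : ℂ) * (φ (j + k) : ℂ) =
      ZMod.stdAddChar k * dft (fun i => (φ i : ℂ)) 1 := by
    intro k
    rw [dft, Finset.mul_sum]
    conv_rhs => rw [← Equiv.sum_comp (Equiv.addRight k)]
    refine Finset.sum_congr rfl fun j _ => ?_
    rw [Equiv.coe_addRight, ← mul_assoc, ← AddChar.map_add_eq_mul]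
    congr 2
    ring
  have h2 : dft (fun i => (kuramotoLinear w φ i : ℂ)) 1 =
      ∑ k, ((w k * zcos k : ℝ) : ℂ) * ((ZMod.stdAddChar k - 1) * dft (fun i => (φ i : ℂ)) 1) := by
    rw [dft]
    simp only [kuramotoLinear, Complex.ofReal_sum, Finset.mul_sum]
    rw [Finset.sum_comm]
    refine Finset.sum_congr rfl fun k _ => ?_
    rw [sub_mul, one_mul, ← h1, dft, ← Finset.sum_sub_distrib, Finset.mul_sum]
    refine Finset.sum_congr rfl fun j _ => ?_
    push_cast
    ring
  rw [h2]
  simp only [← mul_assoc, ← Finset.sum_mul]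
  congr 1
  apply Complex.ext
  · simp only [Complex.re_sum, Complex.re_ofReal_mul, Complex.ofReal_re, Complex.sub_re,
      Complex.one_re, cosTransform, zero_mul, one_mul, zcos_zero]
    rw [← Finset.sum_add_distrib, Finset.sum_div, ← Finset.sum_sub_distrib]
    refine Finset.sum_congr rfl fun k _ => ?_
    rw [show (2 : ZMod n) * k = k + k by ring, zcos_add, ← zcos]
    have := zcos_sq_add_zsin_sq k
    linear_combination (w k / 2) * this
  · simp only [Complex.im_sum, Complex.im_ofReal_mul, Complex.ofReal_im, Complex.sub_im,
      Complex.one_im, sub_zero]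
    have := sum_even_mul_zsin hw 2
    rw [← mul_zero (1 / 2 : ℝ), ← this, Finset.mul_sum]
    refine Finset.sum_congr rfl fun k _ => ?_
    rw [show (2 : ZMod n) * k = k + k by ring, zsin_add, ← zsin]
    ring

theorem normSq_dft_neg (a : ZMod n → ℝ) (m : ZMod n) :
    Complex.normSq (dft (fun i => (a i : ℂ)) (-m)) =
      Complex.normSq (dft (fun i => (a i : ℂ)) m) := by
  have h : dft (fun i => (a i : ℂ)) (-m) = (starRingEnd ℂ) (dft (fun i => (a i : ℂ)) m) := by
    simp only [dft, map_sum, map_mul, star_stdAddChar, Complex.conj_ofReal, neg_mul]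
  rw [h, Complex.normSq_conj]

/-- Every mode other than `±1` has a nonpositive rate, since both shifted transforms are at most
`D(1)`. The modes `1` and `-1` contribute equally, whence the factor `2`. -/
theorem sum_mul_kuramotoLinear_le {w : ZMod n → ℝ} (hn : 3 ≤ n)
    (hle : ∀ m : ZMod n, m ≠ 0 → cosTransform w m ≤ cosTransform w 1) (φ : ZMod n → ℝ) :
    n * ∑ i, φ i * kuramotoLinear w φ i ≤
      2 * ((cosTransform w 2 + cosTransform w 0) / 2 - cosTransform w 1) *
        Complex.normSq (dft (fun i => (φ i : ℂ)) 1) := by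
  have h1 : n * ∑ i, φ i * kuramotoLinear w φ i = 1 / 2 *
      (n * ∑ i, ∑ k, w k * (2 * zcos k * (φ i * φ (i + k) - φ i ^ 2))) := by
    rw [mul_left_comm, Finset.mul_sum (a := (1 / 2 : ℝ))]
    congr 1
    refine Finset.sum_congr rfl fun i _ => ?_
    rw [kuramotoLinear, Finset.mul_sum, Finset.mul_sum]
    exact Finset.sum_congr rfl fun k _ => by ring
  rw [h1, sum_planar_form]
  have hne := zmod_one_ne_neg_one hn
  have h2 : ∑ m, Complex.normSq (dft (fun i => (φ i : ℂ)) m) *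
      (cosTransform w (m + 1) + cosTransform w (m - 1) - 2 * cosTransform w 1) ≤
      ∑ m ∈ {1, -1}, Complex.normSq (dft (fun i => (φ i : ℂ)) m) *
        (cosTransform w (m + 1) + cosTransform w (m - 1) - 2 * cosTransform w 1) := by
    rw [← Finset.sum_add_sum_compl ({1, -1} : Finset (ZMod n)), add_le_iff_nonpos_right]
    refine Finset.sum_nonpos fun m hm => ?_
    simp only [Finset.mem_compl, Finset.mem_insert, Finset.mem_singleton, not_or] at hm
    refine mul_nonpos_of_nonneg_of_nonpos (Complex.normSq_nonneg _) ?_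
    have b1 := hle (m + 1) fun h => hm.2 (by linear_combination h)
    have b2 := hle (m - 1) fun h => hm.1 (by linear_combination h)
    linarith
  rw [Finset.sum_pair hne, normSq_dft_neg, sub_self, one_add_one_eq_two, neg_add_cancel,
    show (-1 - 1 : ZMod n) = -2 by ring, cosTransform_neg] at h2
  linarith

/-- The quadratic form that measures the excess of the first Fourier mode. -/
noncomputable def modeExcess (φ : ZMod n → ℝ) : ℝ :=
  4 * Complex.normSq (dft (fun i => (φ i : ℂ)) 1) - n * ∑ i, φ i ^ 2

theorem hasDerivWithinAt_modeExcess {φ : ℝ → ZMod n → ℝ} {φ' : ZMod n → ℝ} {s : Set ℝ} {t : ℝ}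
    (h : ∀ i, HasDerivWithinAt (fun x => φ x i) (φ' i) s t) :
    HasDerivWithinAt (fun x => modeExcess (φ x))
      (8 * ((starRingEnd ℂ) (dft (fun i => (φ t i : ℂ)) 1) * dft (fun i => (φ' i : ℂ)) 1).re -
        2 * (n * ∑ i, φ t i * φ' i)) s t := by
  have hre : ∀ ψ : ZMod n → ℝ, (dft (fun i => (ψ i : ℂ)) 1).re = ∑ j, zcos j * ψ j := fun ψ => by
    simp only [dft, Complex.re_sum, Complex.re_mul_ofReal, one_mul]
    exact Finset.sum_congr rfl fun j _ => by rw [← zcos, zcos_neg]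
  have him : ∀ ψ : ZMod n → ℝ, (dft (fun i => (ψ i : ℂ)) 1).im = ∑ j, -zsin j * ψ j := fun ψ => by
    simp only [dft, Complex.im_sum, Complex.im_mul_ofReal, one_mul]
    exact Finset.sum_congr rfl fun j _ => by rw [← zsin, zsin_neg]
  simp only [modeExcess, Complex.normSq_apply, Complex.mul_re, Complex.conj_re, Complex.conj_im,
    hre, him]
  have d1 := HasDerivWithinAt.fun_sum fun j (_ : j ∈ Finset.univ) => (h j).const_mul (zcos j)
  have d2 := HasDerivWithinAt.fun_sum fun j (_ : j ∈ Finset.univ) => (h j).const_mul (-zsin j)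
  have d3 := HasDerivWithinAt.fun_sum fun j (_ : j ∈ Finset.univ) => (h j).pow 2
  refine ((((d1.mul d1).add (d2.mul d2)).const_mul 4).sub (d3.const_mul (n : ℝ))).congr_deriv ?_
  have e : ∑ i, ((2 : ℕ) : ℝ) * φ t i ^ (2 - 1) * φ' i = 2 * ∑ i, φ t i * φ' i := by
    rw [Finset.mul_sum]
    exact Finset.sum_congr rfl fun i _ => by push_cast; ring
  rw [e]
  ring

theorem norm_dft_le (a : ZMod n → ℝ) (m : ZMod n) :
    ‖dft (fun i => (a i : ℂ)) m‖ ≤ ∑ i, |a i| := by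
  refine (norm_sum_le _ _).trans (Finset.sum_le_sum fun i _ => ?_)
  rw [norm_mul, norm_stdAddChar, one_mul, Complex.norm_real, Real.norm_eq_abs]

/-- By Parseval the excess is the energy in the modes `±1` minus the energy in all others. The
linear flow raises it at rate at least `8λ|z|² - 4λ|z|² = 4λ|z|²`, where `z` is the first mode and
`λ` stands for `lam`. Where the excess is nonnegative, `z` dominates all phases, so the quadratic
remainder uses up at most half of this. -/
theorem modeExcess_deriv_ge {w : ZMod n → ℝ} (hn : 3 ≤ n) (hw : ∀ k, w (-k) = w k)
    (hw0 : ∀ k, 0 ≤ w k) (hle : ∀ m : ZMod n, m ≠ 0 → cosTransform w m ≤ cosTransform w 1)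
    {lam r : ℝ} (hlam : lam = (cosTransform w 2 + cosTransform w 0) / 2 - cosTransform w 1)
    (hr0 : 0 ≤ r) (hr : r ≤ 1) (hrlam : 40 * n * r * (∑ k, w k) ≤ lam)
    {φ : ZMod n → ℝ} (hφ : ∀ i j, |φ j - φ i| ≤ r) (hV : 0 ≤ modeExcess φ) :
    lam / 2 * modeExcess φ ≤
      8 * ((starRingEnd ℂ) (dft (fun i => (φ i : ℂ)) 1) *
        dft (fun i => (kuramotoField w φ i : ℂ)) 1).re -
        2 * (n * ∑ i, φ i * kuramotoField w φ i) := by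
  set W := ∑ k, w k with hWdef
  have hW : 0 ≤ W := Finset.sum_nonneg fun k _ => hw0 k
  set z := dft (fun i => (φ i : ℂ)) 1 with hz
  set a := ∑ j, |φ j| with ha
  have ha0 : 0 ≤ a := Finset.sum_nonneg fun _ _ => abs_nonneg _
  set N : ZMod n → ℝ := fun i => kuramotoField w φ i - kuramotoLinear w φ i with hN
  have hNb : ∀ i, |N i| ≤ 2 * r * W * a := abs_kuramotoField_sub_linear_le hw hw0 hr hφ
  have hsplit : ∀ i, kuramotoField w φ i = kuramotoLinear w φ i + N i := fun i => by
    simp only [hN]; ring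
  have hn0 : (0 : ℝ) < n := by exact_mod_cast NeZero.pos n
  have e1 : dft (fun i => (kuramotoField w φ i : ℂ)) 1 = lam * z + dft (fun i => (N i : ℂ)) 1 := by
    rw [hlam, hz, ← dft_kuramotoLinear hw, dft, dft, dft, ← Finset.sum_add_distrib]
    refine Finset.sum_congr rfl fun i _ => ?_
    rw [hsplit]
    push_cast
    ring
  have e2 : ∑ i, φ i * kuramotoField w φ i =
      ∑ i, φ i * kuramotoLinear w φ i + ∑ i, φ i * N i := by
    rw [← Finset.sum_add_distrib]
    exact Finset.sum_congr rfl fun i _ => by rw [hsplit]; ring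
  have e3 : ((starRingEnd ℂ) z * (lam * z + dft (fun i => (N i : ℂ)) 1)).re =
      lam * Complex.normSq z + ((starRingEnd ℂ) z * dft (fun i => (N i : ℂ)) 1).re := by
    rw [mul_add, Complex.add_re, mul_left_comm, ← Complex.normSq_eq_conj_mul_self,
      ← Complex.ofReal_mul, Complex.ofReal_re]
  have b1 : -(a * (n * (2 * r * W * a))) ≤ ((starRingEnd ℂ) z * dft (fun i => (N i : ℂ)) 1).re := by
    have h1 := (abs_le.1 (Complex.abs_re_le_norm
      ((starRingEnd ℂ) z * dft (fun i => (N i : ℂ)) 1))).1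
    rw [norm_mul, Complex.norm_conj] at h1
    have h2 : ‖z‖ ≤ a := norm_dft_le φ 1
    have h3 : ‖dft (fun i => (N i : ℂ)) 1‖ ≤ n * (2 * r * W * a) := by
      refine (norm_dft_le N 1).trans ((Finset.sum_le_sum fun i _ => hNb i).trans_eq ?_)
      rw [Finset.sum_const, Finset.card_univ, ZMod.card, nsmul_eq_mul]
    have h4 := mul_le_mul h2 h3 (norm_nonneg _) ha0
    linarith
  have b2 : ∑ i, φ i * N i ≤ a * (2 * r * W * a) := by
    rw [ha, Finset.sum_mul]
    refine Finset.sum_le_sum fun i _ => (le_abs_self _).trans ?_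
    rw [abs_mul]
    exact mul_le_mul_of_nonneg_left (hNb i) (abs_nonneg _)
  have b3 := sum_mul_kuramotoLinear_le hn hle φ
  rw [← hlam, ← hz] at b3
  have b4 : a ^ 2 ≤ n * ∑ i, φ i ^ 2 := by
    have := sq_sum_le_card_mul_sum_sq (s := (Finset.univ : Finset (ZMod n))) (f := fun i => |φ i|)
    simpa only [Finset.card_univ, ZMod.card, sq_abs] using this
  have b5 : a ^ 2 ≤ 4 * Complex.normSq z := by
    have : 0 ≤ 4 * Complex.normSq z - n * ∑ i, φ i ^ 2 := hV
    linarith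
  -- The constant `20` collects the remainder terms: `8 · 2` from the mode and `2 · 2` from the
  -- square sum. With `a² ≤ 4|z|²` it explains the `40` in `hrlam`.
  have b6 : 20 * n * r * W * a ^ 2 ≤ 2 * lam * Complex.normSq z := by
    have h1 : 20 * n * r * W * a ^ 2 ≤ 20 * n * r * W * (4 * Complex.normSq z) := by gcongr
    have h2 := mul_le_mul_of_nonneg_right hrlam (Complex.normSq_nonneg z)
    linarith
  have hlam0 : 0 ≤ lam := le_trans (by positivity) hrlam
  have b7 : modeExcess φ ≤ 4 * Complex.normSq z := by
    have : 0 ≤ n * ∑ i, φ i ^ 2 := by positivity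
    simp only [modeExcess, ← hz]
    linarith
  have b8 := mul_le_mul_of_nonneg_left b7 (show 0 ≤ lam / 2 by positivity)
  have b9 := mul_le_mul_of_nonneg_left b2 hn0.le
  rw [e1, e2, e3]
  nlinarith

theorem sum_zcos_two_mul (hn : 3 ≤ n) : ∑ k : ZMod n, zcos (2 * k) = 0 := by
  have h := AddChar.sum_mulShift (2 : ZMod n) (ZMod.isPrimitive_stdAddChar n)
  rw [if_neg] at h
  · have h' := congrArg Complex.re h
    rw [Complex.re_sum] at h'
    simpa only [zcos, mul_comm _ (2 : ZMod n), Nat.cast_zero, Complex.zero_re] using h'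
  · intro h2
    exact zmod_one_ne_neg_one hn (by linear_combination h2)

theorem modeExcess_smul_zcos_pos (hn : 3 ≤ n) {η : ℝ} (hη : 0 < η) :
    0 < modeExcess fun i : ZMod n => η * zcos i := by
  have hn0 : (0 : ℝ) < n := by exact_mod_cast NeZero.pos n
  have h1 : ∑ k : ZMod n, zcos k ^ 2 = n / 2 := by
    have h2 : ∀ k : ZMod n, zcos k ^ 2 = 1 / 2 + 1 / 2 * zcos (2 * k) := fun k => by
      rw [two_mul, zcos_add]
      linear_combination (1 / 2) * zcos_sq_add_zsin_sq k
    simp only [h2, Finset.sum_add_distrib, ← Finset.mul_sum, sum_zcos_two_mul hn,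
      Finset.sum_const, Finset.card_univ, ZMod.card, nsmul_eq_mul]
    ring
  have hre : (dft (fun i : ZMod n => ((η * zcos i : ℝ) : ℂ)) 1).re = η * (n / 2) := by
    simp only [dft, Complex.re_sum, Complex.re_mul_ofReal, one_mul]
    rw [← h1, Finset.mul_sum]
    refine Finset.sum_congr rfl fun j _ => ?_
    rw [← zcos, zcos_neg]
    ring
  have h3 : ∑ i : ZMod n, (η * zcos i) ^ 2 = η ^ 2 * (n / 2) := by
    rw [← h1, Finset.mul_sum]
    exact Finset.sum_congr rfl fun i _ => by ring
  rw [modeExcess, h3, Complex.normSq_apply, hre]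
  have : 0 < η ^ 2 * (n : ℝ) ^ 2 := by positivity
  nlinarith [mul_self_nonneg (dft (fun i : ZMod n => ((η * zcos i : ℝ) : ℂ)) 1).im]

theorem dft_sub_const (φ : ZMod n → ℝ) (x : ℝ) (hn : 3 ≤ n) :
    dft (fun i => ((φ i - x : ℝ) : ℂ)) 1 = dft (fun i => (φ i : ℂ)) 1 := by
  have h := AddChar.sum_mulShift (-1 : ZMod n) (ZMod.isPrimitive_stdAddChar n)
  rw [if_neg, Nat.cast_zero] at h
  · have h' : ∑ j : ZMod n, (ZMod.stdAddChar (-(1 * j)) : ℂ) = 0 := by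
      rw [← h]
      exact Finset.sum_congr rfl fun j _ => by rw [mul_neg, mul_comm]
    rw [dft, dft, ← sub_eq_zero, ← Finset.sum_sub_distrib, ← mul_zero (-x : ℂ), ← h',
      Finset.mul_sum]
    refine Finset.sum_congr rfl fun j _ => ?_
    push_cast
    ring
  · intro h1
    have h0 : (1 : ZMod n) = 0 := by linear_combination -h1
    exact zmod_one_ne_neg_one hn (by rw [h0, neg_zero])

/-- Only differences of phases are bounded, and the common phase may drift. Mode `1` does not see
constants, so `φ 0` can be subtracted. -/
theorem modeExcess_le (hn : 3 ≤ n) {φ : ZMod n → ℝ} {r : ℝ} (hφ : ∀ i j, |φ j - φ i| ≤ r) :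
    modeExcess φ ≤ 4 * (n * r) ^ 2 := by
  have h1 : ‖dft (fun i => (φ i : ℂ)) 1‖ ≤ n * r := by
    rw [← dft_sub_const φ (φ 0) hn]
    refine (norm_dft_le (fun i => φ i - φ 0) 1).trans
      ((Finset.sum_le_sum fun i _ => hφ 0 i).trans_eq ?_)
    rw [Finset.sum_const, Finset.card_univ, ZMod.card, nsmul_eq_mul]
  have h2 := pow_le_pow_left₀ (norm_nonneg _) h1 2
  rw [Complex.sq_norm] at h2
  have : 0 ≤ n * ∑ i, φ i ^ 2 := by positivity
  rw [modeExcess]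
  linarith

theorem abs_sub_le_of_step {φ : ZMod n → ℝ} {ρ : ℝ} (h : ∀ i, |φ (i + 1) - φ i| ≤ ρ)
    (i j : ZMod n) : |φ j - φ i| ≤ n * ρ := by
  have hρ : 0 ≤ ρ := (abs_nonneg _).trans (h 0)
  have key : ∀ k : ℕ, |φ (i + k) - φ i| ≤ k * ρ := by
    intro k
    induction k with
    | zero => simp
    | succ k ih =>
      have h1 := h (i + k)
      have h2 := abs_sub_le (φ (i + k + 1)) (φ (i + k)) (φ i)
      push_cast
      rw [← add_assoc]
      linarith
  have h1 := key (j - i).val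
  rw [ZMod.natCast_zmod_val, add_sub_cancel] at h1
  refine h1.trans (mul_le_mul_of_nonneg_right ?_ hρ)
  exact_mod_cast (ZMod.val_lt (j - i)).le

/-- Phases that stay close to each other cannot have a positive excess in an unstable first mode. -/
theorem false_of_forall_step_le {w : ZMod n → ℝ} (hn : 3 ≤ n) (hw : ∀ k, w (-k) = w k)
    (hw0 : ∀ k, 0 ≤ w k) (hle : ∀ m : ZMod n, m ≠ 0 → cosTransform w m ≤ cosTransform w 1)
    {lam r : ℝ} (hlam : lam = (cosTransform w 2 + cosTransform w 0) / 2 - cosTransform w 1)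
    (hlam0 : 0 < lam) (hr0 : 0 ≤ r) (hr : r ≤ 1) (hrlam : 40 * n * r * (∑ k, w k) ≤ lam)
    {φ : ℝ → ZMod n → ℝ} (hφ : ∀ t, 0 ≤ t → ∀ i,
      HasDerivWithinAt (fun s => φ s i) (kuramotoField w (φ t) i) (Set.Ici 0) t)
    (hclose : ∀ t, 0 ≤ t → ∀ i j, |φ t j - φ t i| ≤ r) (h0 : 0 < modeExcess (φ 0)) : False := by
  have hd := fun t (ht : 0 ≤ t) => hasDerivWithinAt_modeExcess (hφ t ht)
  -- The rate `lam / 4`, half of the one available, gives the strict inequality at contact.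
  -- Positivity of the excess is needed only there, where it is inherited from the exponential.
  have hgrow : ∀ T, 0 ≤ T → modeExcess (φ 0) * Real.exp (lam / 4 * T) ≤ modeExcess (φ T) := by
    intro T hT
    have hB : ∀ x : ℝ, HasDerivAt (fun x => -(modeExcess (φ 0) * Real.exp (lam / 4 * x)))
        (-(modeExcess (φ 0) * (Real.exp (lam / 4 * x) * (lam / 4)))) x := fun x => by
      have : HasDerivAt (fun s : ℝ => lam / 4 * s) (lam / 4) x := by
        simpa using (hasDerivAt_id x).const_mul (lam / 4)
      exact (this.exp.const_mul _).neg
    have := image_le_of_deriv_right_lt_deriv_boundary (f := fun t => -modeExcess (φ t))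
      (a := 0) (b := T)
      (fun t ht => ((hd t ht.1).neg.continuousWithinAt).mono Set.Icc_subset_Ici_self)
      (fun t ht => (hd t ht.1).neg.mono (Set.Ici_subset_Ici.2 ht.1)) (by simp) hB
      (fun t ht heq => ?_) ⟨hT, le_rfl⟩
    · simpa using this
    · have heq' : modeExcess (φ t) = modeExcess (φ 0) * Real.exp (lam / 4 * t) := neg_inj.1 heq
      have hpos : 0 < modeExcess (φ t) := by rw [heq']; positivity
      have h1 := modeExcess_deriv_ge hn hw hw0 hle hlam hr0 hr hrlam (hclose t ht.1) hpos.le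
      have h2 : modeExcess (φ 0) * (Real.exp (lam / 4 * t) * (lam / 4)) =
          lam / 4 * modeExcess (φ t) := by rw [heq']; ring
      rw [h2]
      have h3 : 0 < lam * modeExcess (φ t) := by positivity
      refine neg_lt_neg (lt_of_lt_of_le ?_ h1)
      linarith
  have hlim : Filter.Tendsto (fun T : ℝ => modeExcess (φ 0) * Real.exp (lam / 4 * T)) Filter.atTop
      Filter.atTop :=
    (Real.tendsto_exp_atTop.comp (Filter.tendsto_id.const_mul_atTop (by positivity))).const_mul_atTop
      h0
  obtain ⟨T, hT, hT0⟩ := ((hlim.eventually_gt_atTop (4 * (n * r) ^ 2)).and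
    (Filter.eventually_ge_atTop 0)).exists
  exact absurd (hgrow T hT0) (not_le.2 ((modeExcess_le hn (hclose T hT0)).trans_lt hT))

/-! ### Leaving a neighbourhood of the whole family. -/

/-- The pairing of neighbouring rotations, which is constant on the family of twists. -/
noncomputable def neighbourPairing {e : ℕ} (X : Config n e) (i : ZMod n) : ℝ :=
  frobInner (X (i + 1)).1 (X i).1

omit [NeZero n] in
theorem continuous_neighbourPairing {e : ℕ} (i : ZMod n) :
    Continuous fun X : Config n e => neighbourPairing X i := by
  unfold neighbourPairing frobInner
  exact continuous_finsetSum _ fun p _ => continuous_finsetSum _ fun q _ =>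
    (continuous_config_apply (i + 1) p q).mul (continuous_config_apply i p q)

theorem neighbourPairing_planarConfig (e : ℕ) (φ : ZMod n → ℝ) (i : ZMod n) :
    neighbourPairing (planarConfig e φ) i =
      2 * Real.cos (twistAngle (1 : ZMod n) + (φ (i + 1) - φ i)) + e := by
  have h : neighbourPairing (planarConfig e φ) i =
      frobInner (singleRotationMatrix e (twistAngle (i + 1) + φ (i + 1)))
        (singleRotationMatrix e (twistAngle i + φ i)) := rfl
  rw [h, frobInner_singleRotationMatrix, cos_twistAngle_add_sub, add_sub_cancel_left]

theorem neighbourPairing_of_mem_family {e : ℕ} {X : Config n e} (hX : X ∈ oneTwistFamily n e)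
    (i : ZMod n) : neighbourPairing X i = 2 * Real.cos (twistAngle (1 : ZMod n)) + e := by
  obtain ⟨S, R, rfl⟩ := hX
  have h : neighbourPairing (fun i => S * oneTwist n e i * R) i =
      neighbourPairing (oneTwist n e) i :=
    frobInner_orthogonal_conj S.transpose_mul R.mul_transpose _ _
  rw [h, ← planarConfig_zero, neighbourPairing_planarConfig]
  simp

theorem twistAngle_one (hn : 3 ≤ n) : twistAngle (1 : ZMod n) = 2 * Real.pi / n := by
  have : (1 : ZMod n).valMinAbs = 1 :=
    (ZMod.valMinAbs_spec (1 : ZMod n) 1).2 ⟨by simp, ⟨by omega, by omega⟩⟩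
  rw [twistAngle, this, Int.cast_one, one_mul]

/-- The neighbourhood `U` bounds the deviation of `neighbourPairing` from its value on the family,
so it does not see translations. A trajectory started at a small multiple of the first mode that
stayed in `U` would keep all neighbouring phase differences at most `ρ`, against
`false_of_forall_step_le`. -/
theorem oneTwistUnstable_of_mode {w : ZMod n → ℝ} (hn : 3 ≤ n) (hw : ∀ k, w (-k) = w k)
    (hw0 : ∀ k, 0 ≤ w k) (hle : ∀ m : ZMod n, m ≠ 0 → cosTransform w m ≤ cosTransform w 1)
    (hgap : 2 * cosTransform w 1 < cosTransform w 2 + cosTransform w 0) (e : ℕ) :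
    OneTwistUnstable e fun i j => w (i - j) := by
  have hW : 0 ≤ ∑ k, w k := Finset.sum_nonneg fun k _ => hw0 k
  have hn0 : (3 : ℝ) ≤ n := by exact_mod_cast hn
  have hπ := Real.pi_pos
  set lam := (cosTransform w 2 + cosTransform w 0) / 2 - cosTransform w 1 with hlam
  have hlam0 : 0 < lam := by rw [hlam]; linarith
  set θ := twistAngle (1 : ZMod n) with hθ
  have hθ0 : 0 < θ := by rw [hθ, twistAngle_one hn]; positivity
  have hθπ : θ < Real.pi := by
    rw [hθ, twistAngle_one hn, div_lt_iff₀ (by linarith)]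
    nlinarith
  obtain ⟨r, hr0, hr, hrlam⟩ : ∃ r : ℝ, 0 < r ∧ r ≤ 1 ∧ 40 * n * r * (∑ k, w k) ≤ lam := by
    refine ⟨min 1 (lam / (40 * n * (∑ k, w k) + 1)), by positivity, min_le_left _ _, ?_⟩
    have h1 : 0 < 40 * n * (∑ k, w k) + 1 := by positivity
    have h2 := mul_le_mul_of_nonneg_left (min_le_right 1 (lam / (40 * n * (∑ k, w k) + 1))) h1.le
    rw [mul_div_cancel₀ _ h1.ne'] at h2
    have h3 : 0 ≤ min 1 (lam / (40 * n * (∑ k, w k) + 1)) := by positivity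
    linarith
  -- With `n` steps of size `ρ` all phases stay within `r`. The other two bounds keep `θ ± ρ` in
  -- `[0, π]`, where the cosine is strictly monotone.
  set ρ := min (r / n) (min θ (Real.pi - θ)) with hρdef
  have hρ0 : 0 < ρ := lt_min (by positivity) (lt_min hθ0 (sub_pos.2 hθπ))
  have hρ1 : ρ ≤ θ := (min_le_right _ _).trans (min_le_left _ _)
  have hρ2 : ρ ≤ Real.pi - θ := (min_le_right _ _).trans (min_le_right _ _)
  have hρr : n * ρ ≤ r := by
    have := mul_le_mul_of_nonneg_left (min_le_left (r / n) (min θ (Real.pi - θ)))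
      (show (0 : ℝ) ≤ n by linarith)
    rwa [mul_div_cancel₀ _ (by linarith)] at this
  have hc1 : Real.cos (θ + ρ) < Real.cos θ :=
    Real.cos_lt_cos_of_nonneg_of_le_pi hθ0.le (by linarith) (by linarith)
  have hc2 : Real.cos θ < Real.cos (θ + -ρ) :=
    Real.cos_lt_cos_of_nonneg_of_le_pi (by linarith) hθπ.le (by linarith)
  set ε := min (Real.cos θ - Real.cos (θ + ρ)) (Real.cos (θ + -ρ) - Real.cos θ) with hε
  have hε0 : 0 < ε := lt_min (by linarith) (by linarith)
  set U : Set (Config n e) :=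
    {X | ∀ i, |neighbourPairing X i - (2 * Real.cos θ + e)| < ε} with hU
  have hUo : IsOpen U := by
    simp only [hU, Set.ofPred_forall]
    exact isOpen_iInter_of_finite fun i =>
      isOpen_lt ((continuous_neighbourPairing i).sub continuous_const).abs continuous_const
  refine ⟨U, hUo.mem_nhdsSet.2 fun X hX i => ?_, fun V hV => ?_⟩
  · rw [neighbourPairing_of_mem_family hX, sub_self, abs_zero]
    exact hε0
  obtain ⟨η, hη0, hηρ, hηV⟩ : ∃ η : ℝ, 0 < η ∧ 2 * η < ρ ∧
      planarConfig e (fun i : ZMod n => η * zcos i) ∈ V := by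
    have hcont : Continuous fun η : ℝ => planarConfig e (fun i : ZMod n => η * zcos i) :=
      (continuous_planarConfig e).comp (by fun_prop)
    have h0 : planarConfig e (fun i : ZMod n => (0 : ℝ) * zcos i) = oneTwist n e := by
      rw [← planarConfig_zero]
      congr 1
      funext i
      simp
    have hev : ∀ᶠ η : ℝ in 𝓝 0, planarConfig e (fun i : ZMod n => η * zcos i) ∈ V :=
      hcont.continuousAt.eventually (by simp only [h0]; exact hV)
    have hev2 : ∀ᶠ η : ℝ in 𝓝 0, 2 * η < ρ :=
      (show Continuous fun η : ℝ => 2 * η by fun_prop).continuousAt.eventually_lt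
        continuousAt_const (by simpa using hρ0)
    obtain ⟨η, hη⟩ := (((hev.and hev2).filter_mono nhdsWithin_le_nhds).and
      (self_mem_nhdsWithin : Set.Ioi (0 : ℝ) ∈ 𝓝[>] 0)).exists
    exact ⟨η, hη.2, hη.1.2, hη.1.1⟩
  obtain ⟨φ, hφ0, hφ⟩ := exists_kuramoto_solution hw0 fun i : ZMod n => η * zcos i
  refine ⟨fun t => planarConfig e (φ t), isQKSolution_planarConfig hw e hφ, by simpa only [hφ0] using hηV, ?_⟩
  by_contra! hstay
  have hstep : ∀ t, 0 ≤ t → ∀ i, |φ t (i + 1) - φ t i| ≤ ρ := by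
    intro t ht i
    by_contra! hlt
    have hc : ContinuousOn (fun s => |φ s (i + 1) - φ s i|) (Set.Icc 0 t) := fun s hs =>
      (((hφ s hs.1 (i + 1)).sub (hφ s hs.1 i)).continuousWithinAt.abs).mono
        Set.Icc_subset_Ici_self
    have hstart : |φ 0 (i + 1) - φ 0 i| ≤ ρ := by
      rw [hφ0]
      have h1 := abs_le.1 (abs_zcos_le_one (i + 1))
      have h2 := abs_le.1 (abs_zcos_le_one i)
      rw [abs_le]
      constructor <;> nlinarith
    -- To exceed `ρ`, a phase difference would have to equal `±ρ` at some time. There the pairing is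
    -- off by at least `2ε`, which is impossible in `U`.
    obtain ⟨s, hs, hsρ⟩ := intermediate_value_Icc ht hc ⟨hstart, hlt.le⟩
    have hin := hstay s hs.1 i
    rw [neighbourPairing_planarConfig, ← hθ] at hin
    rcases eq_or_eq_neg_of_abs_eq hsρ with h | h
    · rw [h] at hin
      have h1 := (abs_lt.1 hin).1
      have h2 := min_le_left (Real.cos θ - Real.cos (θ + ρ)) (Real.cos (θ + -ρ) - Real.cos θ)
      linarith
    · rw [h] at hin
      have h1 := (abs_lt.1 hin).2
      have h2 := min_le_right (Real.cos θ - Real.cos (θ + ρ)) (Real.cos (θ + -ρ) - Real.cos θ)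
      linarith
  refine false_of_forall_step_le hn hw hw0 hle hlam hlam0 hr0.le hr hrlam hφ
    (fun t ht i j => (abs_sub_le_of_step (hstep t ht) i j).trans hρr) ?_
  rw [hφ0]
  exact modeExcess_smul_zcos_pos hn hη0

theorem OneTwistUnstable.not_supports {e : ℕ} {γ : ZMod n → ZMod n → ℝ}
    (h : OneTwistUnstable e γ) : ¬ SupportsOneTwists e γ := by
  rintro ⟨hL, -⟩
  obtain ⟨U, hU, hex⟩ := h
  have hmem : oneTwist n e ∈ oneTwistFamily n e := ⟨1, 1, by funext i; simp⟩
  obtain ⟨V, hV, hstay⟩ := hL U (nhds_le_nhdsSet hmem hU)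
  obtain ⟨X, hX, hX0, t, ht, hXt⟩ := hex V hV
  exact hXt (hstay X hX hX0 t ht)

end

/-! ### The theorem. -/

theorem alphaGraph_eq (α : ℝ) (n : ℕ) :
    alphaGraph α n = fun i j => windowWeight n ⌊α * n⌋₊ (i - j) := rfl

theorem mainTheorem3 :
    ∃ αs : ℝ,
      IsLeast {a : ℝ | 0 < a ∧ Real.pi * a - Real.sin (2 * Real.pi * a)
        + 1 / 4 * Real.sin (4 * Real.pi * a) = 0} αs ∧
      |αs - 0.340461| < 5 / 10 ^ 7 ∧
      (∀ α : ℝ, 0 < α → α < αs →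
        ∃ N : ℕ, ∀ (n : ℕ) [NeZero n], N < n → ∀ e : ℕ,
          SupportsOneTwists e (alphaGraph α n)) ∧
      (∀ α : ℝ, αs < α → α ≤ 1 / 2 →
        ∃ N : ℕ, ∀ (n : ℕ) [NeZero n], N < n → ∀ e : ℕ,
          ¬ SupportsOneTwists e (alphaGraph α n) ∧ OneTwistUnstable e (alphaGraph α n)) := by
  obtain ⟨αs, hleast, habs, hneg, hpos⟩ := exists_threshold_root
  have hαs := abs_lt.1 habs
  refine ⟨αs, hleast, habs, fun α hα hα' => ?_, fun α hα hα' => ?_⟩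
  · have hhalf : α < 1 / 2 := by
      norm_num at hαs ⊢
      linarith
    obtain ⟨N, -, hN⟩ := eventually_spectrallyStable hα hhalf (hneg α hα hα')
    refine ⟨N, fun n _ hn e => ?_⟩
    rw [alphaGraph_eq]
    exact (hN n hn).supportsOneTwists (windowWeight_neg _) (windowWeight_nonneg _) e
  · obtain ⟨N, hN3, hN⟩ := eventually_unstable_mode (hleast.1.1.trans hα) hα' (hpos α hα hα')
    refine ⟨N, fun n _ hn e => ?_⟩
    obtain ⟨hgap, hle⟩ := hN n hn
    have hu : OneTwistUnstable e (alphaGraph α n) := by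
      rw [alphaGraph_eq]
      exact oneTwistUnstable_of_mode (by omega) (windowWeight_neg _) (windowWeight_nonneg _) hle
        hgap e
    exact ⟨hu.not_supports, hu⟩
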